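/- Let $L[x]_t$ be the last-passage time of the Hammersley model: given a homogeneous Poisson point process of intensity $1$ in the plane, $L[x]_t$ is the maximal number of Poisson points in a sequence of Poisson points of $(0,x]\times(0,t]$ that is strictly increasing in both coordinates (and $L[x]_t=0$ if $x\le 0$ or $t\le 0$). Fix $\gamma\in(0,2/3)$ and $s>0$, put $\mu:=s^{-1/2}$ and $\sigma:=s^{-1/4}$, and define $$\Delta_n(u):=\frac{L[sn+un^{\gamma}]_n-L[sn]_n-\mu un^{\gamma}}{\sigma n^{\gamma/2}},\qquad u\in\mathbb{R}.$$ Then, as $n\to\infty$ (through the real numbers, in particular through the integers), the processes $\Delta_n=(\Delta_n(u))_{u\in\mathbb{R}}$ converge in distribution to the standard two-sided Brownian motion $\mathcal{B}=(\mathcal{B}(u))_{u\in\mathbb{R}}$, in the sense of weak convergence of probability measures on the space of cadlag functions $\mathbb{R}\to\mathbb{R}$ with Skorokhod's $J_1$ topology. (Here $\mathcal{B}$ is a process such that $(\mathcal{B}(u))_{u\ge 0}$ and $(\mathcal{B}(-u))_{u\ge 0}$ are independent standard Brownian motions started at $0$.) -/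

import Mathlib

open MeasureTheory ProbabilityTheory Filter Topology Set
open scoped NNReal ENNReal

noncomputable section

namespace Hammersley

/-! ### The space of cadlag functions on the real line, with Skorokhod's J1 topology -/

/-- Cadlag functions `ℝ → ℝ`: right-continuous at every point, with finite left limits. -/
structure CadlagPath where
  toFun : ℝ → ℝ
  rightCts : ∀ t, ContinuousWithinAt toFun (Ici t) t
  leftLim : ∀ t, ∃ l, Tendsto toFun (𝓝[<] t) (𝓝 l)

instance : CoeFun CadlagPath (fun _ => ℝ → ℝ) := ⟨CadlagPath.toFun⟩

/-- `(f, g)` is in the `ε`-entourage if some increasing homeomorphism `τ` of the line moves every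
point by at most `ε` and `g ∘ τ` is within `ε` of `f`, uniformly on `[-1/ε, 1/ε]`. -/
def skorokhodEntourage (ε : ℝ) : Set (CadlagPath × CadlagPath) :=
  {p | ∃ τ : ℝ ≃o ℝ, (∀ t, |τ t - t| ≤ ε) ∧ ∀ t, |t| ≤ 1 / ε → |p.2 (τ t) - p.1 t| ≤ ε}

lemma skorokhodEntourage_mono {δ ε : ℝ} (hδ : 0 < δ) (h : δ ≤ ε) :
    skorokhodEntourage δ ⊆ skorokhodEntourage ε := by
  rintro ⟨f, g⟩ ⟨τ, h1, h2⟩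
  exact ⟨τ, fun t => (h1 t).trans h, fun t ht =>
    (h2 t (ht.trans (one_div_le_one_div_of_le hδ h))).trans h⟩

/-- The entourages for `ε > 0` form a filter basis. -/
def skorokhodBasis : FilterBasis (CadlagPath × CadlagPath) where
  sets := {U | ∃ ε > 0, U = skorokhodEntourage ε}
  nonempty := ⟨_, 1, one_pos, rfl⟩
  inter_sets := by
    rintro _ _ ⟨ε, hε, rfl⟩ ⟨δ, hδ, rfl⟩
    exact ⟨_, ⟨min ε δ, lt_min hε hδ, rfl⟩, subset_inter
      (skorokhodEntourage_mono (lt_min hε hδ) (min_le_left _ _))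
      (skorokhodEntourage_mono (lt_min hε hδ) (min_le_right _ _))⟩

lemma aux_bound {ε e : ℝ} (he : 0 < e) (h1 : e ≤ 1) (h2 : e ≤ ε) {t r : ℝ} (ht : |t| ≤ 1 / ε)
    (hr : |r - t| ≤ e / 2) : |r| ≤ 1 / (e / 2) := by
  have h3 : 1 / ε ≤ 1 / e := one_div_le_one_div_of_le he h2
  have h4 : 1 ≤ 1 / e := by rw [le_div_iff₀ he]; linarith
  have h5 : 1 / (e / 2) = 2 * (1 / e) := by field_simp
  have h6 : |r| ≤ |r - t| + |t| := by simpa using abs_add_le (r - t) t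
  rw [h5]; linarith

/-- Skorokhod's J1 topology on cadlag functions on the line, given by its natural uniformity:
`f k → f` iff there are increasing homeomorphisms `τ k` of the line with `τ k t - t → 0`
uniformly on the line and `f k (τ k t) - f t → 0` uniformly on compact sets. -/
instance : UniformSpace CadlagPath := UniformSpace.ofCore <|
  UniformSpace.Core.mkOfBasis skorokhodBasis
    (by
      rintro _ ⟨ε, hε, rfl⟩ f
      exact ⟨OrderIso.refl ℝ, fun t => by simpa using hε.le, fun t _ => by simpa using hε.le⟩)
    (by
      rintro _ ⟨ε, hε, rfl⟩
      have he : 0 < min ε 1 := lt_min hε one_pos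
      refine ⟨_, ⟨min ε 1 / 2, by positivity, rfl⟩, ?_⟩
      rintro ⟨f, g⟩ ⟨τ, h1, h2⟩
      have hs : min ε 1 / 2 ≤ ε := by linarith [min_le_left ε 1]
      have h3 : ∀ t, |τ.symm t - t| ≤ min ε 1 / 2 := fun t => by
        have := h1 (τ.symm t)
        rwa [τ.apply_symm_apply, abs_sub_comm] at this
      refine ⟨τ.symm, fun t => (h3 t).trans hs, fun t ht => ?_⟩
      have := h2 (τ.symm t) (aux_bound he (min_le_right _ _) (min_le_left _ _) ht (h3 t))
      rw [τ.apply_symm_apply, abs_sub_comm] at this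
      exact this.trans hs)
    (by
      rintro _ ⟨ε, hε, rfl⟩
      have he : 0 < min ε 1 := lt_min hε one_pos
      refine ⟨_, ⟨min ε 1 / 2, by positivity, rfl⟩, ?_⟩
      rintro ⟨f, h⟩ ⟨g, ⟨τ, h1, h2⟩, ⟨ρ, k1, k2⟩⟩
      have hs : min ε 1 ≤ ε := min_le_left ε 1
      refine ⟨τ.trans ρ, fun t => ?_, fun t ht => ?_⟩
      · have := abs_sub_le (ρ (τ t)) (τ t) t
        simp only [OrderIso.trans_apply]
        linarith [k1 (τ t), h1 t]
      · have a1 := k2 (τ t) (aux_bound he (min_le_right _ _) hs ht (h1 t))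
        have a2 := h2 t (aux_bound he (min_le_right _ _) hs ht (by simpa using (half_pos he).le))
        have := abs_sub_le (h (ρ (τ t))) (g (τ t)) (f t)
        simp only [OrderIso.trans_apply]
        linarith)

instance : MeasurableSpace CadlagPath := borel CadlagPath

instance : BorelSpace CadlagPath := ⟨rfl⟩

/-! ### Planar Poisson processes -/

/-- A locally finite set of points in the plane. -/
structure Configuration where
  points : Set (ℝ × ℝ)
  locallyFinite : ∀ K : Set (ℝ × ℝ), IsCompact K → (points ∩ K).Finite

/-- A random configuration is a homogeneous Poisson point process of intensity `1` in the plane: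
the number of points in a bounded Borel set is Poisson distributed with mean the area of the set,
and the numbers of points in disjoint sets are independent. -/
structure IsPoissonProcess {Ω : Type*} [MeasurableSpace Ω] (X : Ω → Configuration)
    (P : Measure Ω) : Prop where
  hasLaw_count : ∀ A : Set (ℝ × ℝ), MeasurableSet A → Bornology.IsBounded A →
    HasLaw (fun ω => ((X ω).points ∩ A).ncard) (poissonMeasure (volume A).toNNReal) P
  iIndepFun_count : ∀ (m : ℕ) (A : Fin m → Set (ℝ × ℝ)), (∀ i, MeasurableSet (A i)) →
    (∀ i, Bornology.IsBounded (A i)) → Pairwise (fun i j => Disjoint (A i) (A j)) →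
    iIndepFun (fun (i : Fin m) ω => ((X ω).points ∩ A i).ncard) P

/-! ### Two-sided Brownian motion -/

/-- Standard two-sided Brownian motion: `t ↦ B t` and `t ↦ B (-t)`, `t ≥ 0`, are independent
standard Brownian motions started at `0`. -/
structure IsTwoSidedBrownian {Ω : Type*} [MeasurableSpace Ω] (B : ℝ → Ω → ℝ)
    (P : Measure Ω) : Prop where
  forward : IsBrownianReal (fun (t : ℝ≥0) ω => B t ω) P
  backward : IsBrownianReal (fun (t : ℝ≥0) ω => B (-t) ω) P
  indep : IndepFun (fun ω (t : ℝ≥0) => B t ω) (fun ω (t : ℝ≥0) => B (-t) ω) P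

/-! ### Last-passage times -/

/-- The maximal length of a sequence of points of `A` that is strictly increasing in both
coordinates. -/
def longestIncreasing (A : Set (ℝ × ℝ)) : ℕ :=
  sSup {k | ∃ z : Fin k → ℝ × ℝ, (∀ i, z i ∈ A) ∧
    StrictMono (fun i => (z i).1) ∧ StrictMono (fun i => (z i).2)}

/-- The last-passage time `L([x]_s, [y]_t)`, where `p = (x, s)` and `q = (y, t)`: the maximal
number of points in an increasing sequence of points of the configuration in
`(x, y] × (s, t]`. -/
def lastPassage (S : Configuration) (p q : ℝ × ℝ) : ℕ :=
  longestIncreasing (S.points ∩ Ioc p.1 q.1 ×ˢ Ioc p.2 q.2)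

/-- `L[x]_t = L([0]_0, [x]_t)`. -/
def lastPassageZero (S : Configuration) (x t : ℝ) : ℕ := lastPassage S (0, 0) (x, t)

/-- The rescaled increment
`Δ_n(u) = (L[s n + u n^γ]_n - L[s n]_n - μ u n^γ) / (σ n^(γ/2))`,
`μ = s^(-1/2)`, `σ = s^(-1/4)`. -/
def increment (γ s n : ℝ) (S : Configuration) (u : ℝ) : ℝ :=
  ((lastPassageZero S (s * n + u * n ^ γ) n : ℝ) - (lastPassageZero S (s * n) n : ℝ)
    - s ^ (-(1 / 2) : ℝ) * u * n ^ γ) / (s ^ (-(1 / 4) : ℝ) * n ^ (γ / 2))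

/-- The supremum in `longestIncreasing` is a maximum over a bounded set when the set is finite. -/
lemma bddAbove_increasing {A : Set (ℝ × ℝ)} (hA : A.Finite) :
    BddAbove {k | ∃ z : Fin k → ℝ × ℝ, (∀ i, z i ∈ A) ∧
      StrictMono (fun i => (z i).1) ∧ StrictMono (fun i => (z i).2)} := by
  refine ⟨A.ncard, ?_⟩
  rintro k ⟨z, hz, h1, -⟩
  have hinj : Function.Injective z := fun i j h => h1.injective (congrArg Prod.fst h)
  have := Set.ncard_le_ncard (Set.range_subset_iff.2 hz) hA
  rwa [Set.ncard_range_of_injective hinj, Nat.card_eq_fintype_card, Fintype.card_fin] at this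

lemma lastPassageZero_eventually_right (S : Configuration) (x t : ℝ) :
    ∀ᶠ y in 𝓝[>] x, lastPassageZero S y t = lastPassageZero S x t := by
  have hf : (Prod.fst '' (S.points ∩ Icc x (x + 1) ×ˢ Icc 0 t) \ {x}).Finite :=
    ((S.locallyFinite _ (isCompact_Icc.prod isCompact_Icc)).image _).sdiff
  have hn : (Prod.fst '' (S.points ∩ Icc x (x + 1) ×ˢ Icc 0 t) \ {x})ᶜ ∈ 𝓝 x :=
    hf.isClosed.isOpen_compl.mem_nhds (by simp)
  obtain ⟨l, r, hlr, hsub⟩ := mem_nhds_iff_exists_Ioo_subset.1 hn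
  filter_upwards [Ioo_mem_nhdsGT (lt_min hlr.2 (lt_add_one x))] with y hy
  unfold lastPassageZero lastPassage
  congr 1
  ext ⟨a, b⟩
  simp only [mem_inter_iff, mem_prod, mem_Ioc]
  constructor
  · rintro ⟨hS, ⟨h1, h2⟩, h3, h4⟩
    refine ⟨hS, ⟨h1, ?_⟩, h3, h4⟩
    by_contra hax
    push Not at hax
    have hyr := lt_min_iff.1 hy.2
    exact hsub ⟨hlr.1.trans hax, h2.trans_lt hyr.1⟩
      ⟨⟨(a, b), ⟨hS, ⟨hax.le, h2.trans hyr.2.le⟩, h3.le, h4⟩, rfl⟩, hax.ne'⟩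
  · rintro ⟨hS, ⟨h1, h2⟩, h3, h4⟩
    exact ⟨hS, ⟨h1, h2.trans hy.1.le⟩, h3, h4⟩

lemma lastPassageZero_eventually_left (S : Configuration) (x t : ℝ) :
    ∃ c : ℕ, ∀ᶠ y in 𝓝[<] x, lastPassageZero S y t = c := by
  refine ⟨longestIncreasing (S.points ∩ Ioo 0 x ×ˢ Ioc 0 t), ?_⟩
  have hf : (Prod.fst '' (S.points ∩ Icc (x - 1) x ×ˢ Icc 0 t) \ {x}).Finite :=
    ((S.locallyFinite _ (isCompact_Icc.prod isCompact_Icc)).image _).sdiff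
  have hn : (Prod.fst '' (S.points ∩ Icc (x - 1) x ×ˢ Icc 0 t) \ {x})ᶜ ∈ 𝓝 x :=
    hf.isClosed.isOpen_compl.mem_nhds (by simp)
  obtain ⟨l, r, hlr, hsub⟩ := mem_nhds_iff_exists_Ioo_subset.1 hn
  filter_upwards [Ioo_mem_nhdsLT (max_lt hlr.1 (sub_one_lt x))] with y hy
  unfold lastPassageZero lastPassage
  congr 1
  ext ⟨a, b⟩
  simp only [mem_inter_iff, mem_prod, mem_Ioc, mem_Ioo]
  constructor
  · rintro ⟨hS, ⟨h1, h2⟩, h3, h4⟩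
    exact ⟨hS, ⟨h1, h2.trans_lt hy.2⟩, h3, h4⟩
  · rintro ⟨hS, ⟨h1, h2⟩, h3, h4⟩
    refine ⟨hS, ⟨h1, ?_⟩, h3, h4⟩
    by_contra hay
    push Not at hay
    have hyr := max_lt_iff.1 hy.1
    exact hsub ⟨hyr.1.trans hay, h2.trans hlr.2⟩
      ⟨⟨(a, b), ⟨hS, ⟨(hyr.2.trans hay).le, h2.le⟩, h3.le, h4⟩, rfl⟩, h2.ne⟩

lemma lastPassageZero_of_nonpos (S : Configuration) (x : ℝ) {t : ℝ} (ht : t ≤ 0) :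
    lastPassageZero S x t = lastPassageZero S 0 t := by
  simp [lastPassageZero, lastPassage, Ioc_eq_empty_of_le ht]

lemma comp_affine_right (S : Configuration) (a n γ u : ℝ) :
    ∀ᶠ v in 𝓝[>] u, lastPassageZero S (a + v * n ^ γ) n = lastPassageZero S (a + u * n ^ γ) n := by
  rcases le_or_gt n 0 with hn | hn
  · exact Eventually.of_forall fun v => by
      rw [lastPassageZero_of_nonpos S _ hn, lastPassageZero_of_nonpos S (a + u * n ^ γ) hn]
  · have hb : 0 < n ^ γ := Real.rpow_pos_of_pos hn γ
    have ht : Tendsto (fun v : ℝ => a + v * n ^ γ) (𝓝[>] u) (𝓝[>] (a + u * n ^ γ)) := by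
      refine tendsto_nhdsWithin_iff.2 ⟨((by fun_prop : Continuous fun v : ℝ =>
        a + v * n ^ γ).tendsto u).mono_left nhdsWithin_le_nhds, ?_⟩
      filter_upwards [self_mem_nhdsWithin] with v hv
      have := mul_lt_mul_of_pos_right (mem_Ioi.1 hv) hb
      simp only [mem_Ioi]; linarith
    exact ht.eventually (lastPassageZero_eventually_right S _ n)

lemma comp_affine_left (S : Configuration) (a n γ u : ℝ) :
    ∃ c : ℕ, ∀ᶠ v in 𝓝[<] u, lastPassageZero S (a + v * n ^ γ) n = c := by
  rcases le_or_gt n 0 with hn | hn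
  · exact ⟨_, Eventually.of_forall fun v => lastPassageZero_of_nonpos S _ hn⟩
  · have hb : 0 < n ^ γ := Real.rpow_pos_of_pos hn γ
    have ht : Tendsto (fun v : ℝ => a + v * n ^ γ) (𝓝[<] u) (𝓝[<] (a + u * n ^ γ)) := by
      refine tendsto_nhdsWithin_iff.2 ⟨((by fun_prop : Continuous fun v : ℝ =>
        a + v * n ^ γ).tendsto u).mono_left nhdsWithin_le_nhds, ?_⟩
      filter_upwards [self_mem_nhdsWithin] with v hv
      have := mul_lt_mul_of_pos_right (mem_Iio.1 hv) hb
      simp only [mem_Iio]; linarith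
    obtain ⟨c, hc⟩ := lastPassageZero_eventually_left S (a + u * n ^ γ) n
    exact ⟨c, ht.eventually hc⟩

/-- The process `u ↦ Δ_n(u)` as an element of the space of cadlag functions. -/
def incrementPath (γ s n : ℝ) (S : Configuration) : CadlagPath where
  toFun := increment γ s n S
  rightCts t := by
    rw [← continuousWithinAt_Ioi_iff_Ici]
    have hc : Continuous fun u : ℝ => ((lastPassageZero S (s * n + t * n ^ γ) n : ℝ)
        - (lastPassageZero S (s * n) n : ℝ)
        - s ^ (-(1 / 2) : ℝ) * u * n ^ γ) / (s ^ (-(1 / 4) : ℝ) * n ^ (γ / 2)) := by fun_prop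
    refine (hc.continuousWithinAt (s := Ioi t) (x := t)).congr_of_eventuallyEq ?_ rfl
    filter_upwards [comp_affine_right S (s * n) n γ t] with v hv
    simp only [increment, hv]
  leftLim t := by
    obtain ⟨c, hc⟩ := comp_affine_left S (s * n) n γ t
    have hcont : Continuous fun u : ℝ => ((c : ℝ) - (lastPassageZero S (s * n) n : ℝ)
        - s ^ (-(1 / 2) : ℝ) * u * n ^ γ) / (s ^ (-(1 / 4) : ℝ) * n ^ (γ / 2)) := by fun_prop
    refine ⟨_, ((hcont.tendsto t).mono_left nhdsWithin_le_nhds).congr' ?_⟩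
    filter_upwards [hc] with v hv
    simp only [increment, hv]

end Hammersley

end

open scoped Uniformity

noncomputable section

namespace Hammersley
/-! ### The discrete model: Boolean dynamics on the edges of the quadrant -/

/-! The increments of the last-passage time near `(s n, n)` are compared with those of a stationary
model, which are a Bernoulli random walk, and Donsker's theorem is applied to that walk.

Discretisation. On a grid so fine that no row or column contains two points, last-passage times at
grid points obey a Boolean recursion driven by the occupied cells (`IsGood.lastPassageZero_eq_lpt`),
and these are independent of probability `r ^ 2` (`IsPoissonProcess.hasLaw_occupied`). The grid is
scaled so that the ray to `(s n, n)` becomes the diagonal. Independent sources of odds `l * r` on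
the lower side and sinks of odds `r / l` on the left side make the model stationary: the edges
leaving a rectangle through the top and the right are again independent Bernoulli
(`Balanced.measurePreserving_outgoing`).

Local comparison. If the best path of the stationary model leaves the boundary through the sources,
its horizontal increments further to the right dominate those of the model without boundary. If it
leaves through the sinks, its increments further to the left are dominated. Along the diagonal the
rate `l = 1` is critical: at rate `1 - 2 * η` the path leaves through the sinks, at the inverse rate
through the sources, up to a probability of order `1 / (η ^ 3 * n)` (`exit_zero_dens_le`). Hence the
increments wanted lie between two stationary ones, coupled monotonically through common uniform
levels, and Markov's inequality bounds the gap over a window (`window_comparison_dens`).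

Exit points. The variance of the stationary last-passage time is expressed by the mean exit point on
either axis (`Balanced.variance_le`, `Balanced.variance_le'`). An exit far out forces a large
fluctuation once the density is raised (`exit_le_of_mean_le`). Together they bound the mean exit
point on one axis by a term `ε * n` plus half of the one on the other axis; by symmetry both are of
order `ε * n` as soon as `ε ^ 3 * n ≥ 10`, and so is the variance
(`NearCharacteristic.variance_le_const`).

Exponents. One needs `η ^ 3 * n → ∞`, and the bias `η * n ^ γ` of the tilted density must be `o(n ^
(γ / 2))`. So `η` must lie strictly between the orders `n ^ (-1/3)` and `n ^ (-γ/2)`, which is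
possible exactly when `γ < 2/3`; `tilt` is the geometric mean of the two.

Weak convergence. Bounded uniformly continuous test functions suffice. Paths are replaced by step
paths on a fixed grid, using a fourth-moment maximal inequality; the finitely many increments
converge by characteristic functions; step paths of Brownian motion converge back in the Skorokhod
topology (`tendsto_integral_of_close_to_walk`). -/

/-- The upper edge of a cell, from its lower edge `x`, its left edge `y` and its weight `w`. -/
def cellH (x y w : Bool) : Bool := !y && (x || w)

/-- The right edge of a cell, from its lower edge `x`, its left edge `y` and its weight `w`. -/
def cellV (x y w : Bool) : Bool := !x && (y || w)

/-- The vertical edges along a row with lower edges `I`, leftmost edge `y` and weights `w`. -/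
def vert (I : ℕ → Bool) (y : Bool) (w : ℕ → Bool) : ℕ → Bool
  | 0 => y
  | i + 1 => cellV (I i) (vert I y w i) (w i)

/-- The horizontal edges at height `j`, for sources `I`, sinks `J` and weights `w`. -/
def hor (I J : ℕ → Bool) (w : ℕ × ℕ → Bool) : ℕ → ℕ → Bool
  | 0 => I
  | j + 1 => fun i => cellH (hor I J w j i)
      (vert (hor I J w j) (J j) (fun i => w (j, i)) i) (w (j, i))

/-- The vertical edges of row `j`. -/
def ver (I J : ℕ → Bool) (w : ℕ × ℕ → Bool) (j : ℕ) : ℕ → Bool :=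
  vert (hor I J w j) (J j) (fun i => w (j, i))

/-- The number of `true`s among the first `n` terms. -/
def count (x : ℕ → Bool) (n : ℕ) : ℕ := ∑ i ∈ Finset.range n, (x i).toNat

/-- The last-passage time of the discrete model with sources `I` and sinks `J`. -/
def lpt (I J : ℕ → Bool) (w : ℕ × ℕ → Bool) (j i : ℕ) : ℕ :=
  count J j + count (hor I J w j) i

/-- No boundary points. -/
def noPoints : ℕ → Bool := fun _ => false

lemma count_zero (x : ℕ → Bool) : count x 0 = 0 := rfl

lemma count_succ (x : ℕ → Bool) (n : ℕ) : count x (n + 1) = count x n + (x n).toNat :=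
  Finset.sum_range_succ _ _

@[simp] lemma count_noPoints (n : ℕ) : count noPoints n = 0 := by simp [count, noPoints]

lemma count_add (x : ℕ → Bool) (k n : ℕ) :
    count x (k + n) = count x k + count (fun i => x (k + i)) n := Finset.sum_range_add _ _ _

lemma count_mono {x y : ℕ → Bool} (h : x ≤ y) (n : ℕ) : count x n ≤ count y n :=
  Finset.sum_le_sum fun i _ => Bool.toNat_le_toNat (h i)

lemma count_le (x : ℕ → Bool) (n : ℕ) : count x n ≤ n := by
  refine (Finset.sum_le_card_nsmul _ _ 1 fun i _ => Bool.toNat_le _).trans (by simp)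

lemma count_congr {x y : ℕ → Bool} {n : ℕ} (h : ∀ i < n, x i = y i) : count x n = count y n :=
  Finset.sum_congr rfl fun i hi => by rw [h i (Finset.mem_range.1 hi)]

section Dynamics

variable (I J : ℕ → Bool) (w : ℕ × ℕ → Bool)

lemma hor_zero : hor I J w 0 = I := rfl

lemma ver_zero (j : ℕ) : ver I J w j 0 = J j := rfl

lemma hor_succ (j i : ℕ) :
    hor I J w (j + 1) i = cellH (hor I J w j i) (ver I J w j i) (w (j, i)) := rfl

lemma ver_succ (j i : ℕ) :
    ver I J w j (i + 1) = cellV (hor I J w j i) (ver I J w j i) (w (j, i)) := rfl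

lemma lpt_zero_left (i : ℕ) : lpt I J w 0 i = count I i := by simp [lpt, hor_zero, count_zero]

lemma lpt_zero_right (j : ℕ) : lpt I J w j 0 = count J j := by simp [lpt, count_zero]

lemma lpt_succ_right (j i : ℕ) : lpt I J w j (i + 1) = lpt I J w j i + (hor I J w j i).toNat := by
  simp [lpt, count_succ, add_assoc]

/-- Each cell conserves flux: lower plus right edge equals left plus upper edge, both being the
maximum of the lower edge, the left edge and the weight. Hence the edges are differences of a single
function on the vertices. -/
lemma lpt_succ_left (j i : ℕ) : lpt I J w (j + 1) i = lpt I J w j i + (ver I J w j i).toNat := by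
  induction i with
  | zero => simp [lpt_zero_right, count_succ, ver_zero]
  | succ i ih =>
    rw [lpt_succ_right, ih, lpt_succ_right, hor_succ, ver_succ]
    cases hor I J w j i <;> cases ver I J w j i <;> cases w (j, i) <;> simp [cellH, cellV]

lemma lpt_eq_count_add (j i : ℕ) :
    lpt I J w j i = count I i + count (fun j' => ver I J w j' i) j := by
  induction j with
  | zero => simp [lpt_zero_left, count_zero]
  | succ j ih => rw [lpt_succ_left, ih, count_succ, add_assoc]

end Dynamics

/-! ### Comparison and superposition for the last-passage recursion. -/

/-- The last-passage recursion in the interior of the quadrant. -/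
def IsLastPassage (w : ℕ × ℕ → Bool) (f : ℕ → ℕ → ℕ) : Prop :=
  ∀ j i, f (j + 1) (i + 1) = max (max (f (j + 1) i) (f j (i + 1))) (f j i + (w (j, i)).toNat)

lemma isLastPassage_lpt (I J : ℕ → Bool) (w : ℕ × ℕ → Bool) : IsLastPassage w (lpt I J w) := by
  intro j i
  rw [lpt_succ_right, lpt_succ_left I J w j i, lpt_succ_right, hor_succ]
  cases hor I J w j i <;> cases ver I J w j i <;> cases w (j, i) <;> simp [cellH]

namespace IsLastPassage

variable {w : ℕ × ℕ → Bool} {f g : ℕ → ℕ → ℕ}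

/-- The recursion is monotone and commutes with adding constants, so a bound on the two axes
propagates. The case `c = 0` gives uniqueness, `c = 1` the effect of a single extra source. -/
lemma le_add (hf : IsLastPassage w f) (hg : IsLastPassage w g) (c : ℕ) {T M : ℕ}
    (h0 : ∀ i ≤ M, f 0 i ≤ g 0 i + c) (h1 : ∀ j ≤ T, f j 0 ≤ g j 0 + c) :
    ∀ j ≤ T, ∀ i ≤ M, f j i ≤ g j i + c := by
  intro j
  induction j with
  | zero => exact fun _ i hi => h0 i hi
  | succ j ihj =>
    intro hj i
    induction i with
    | zero => exact fun _ => h1 _ hj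
    | succ i ihi =>
      intro hi
      rw [hf, hg]
      have a1 := ihi (by omega)
      have a2 := ihj (by omega) (i + 1) hi
      have a3 := ihj (by omega) i (by omega)
      omega

lemma eq_of_boundary (hf : IsLastPassage w f) (hg : IsLastPassage w g) {T M : ℕ}
    (h0 : ∀ i ≤ M, f 0 i = g 0 i) (h1 : ∀ j ≤ T, f j 0 = g j 0) {j i : ℕ} (hj : j ≤ T)
    (hi : i ≤ M) : f j i = g j i := by
  refine le_antisymm ?_ ?_
  · exact le_add hf hg 0 (fun i hi => (h0 i hi).le) (fun j hj => (h1 j hj).le) j hj i hi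
  · exact le_add hg hf 0 (fun i hi => (h0 i hi).ge) (fun j hj => (h1 j hj).ge) j hj i hi

/-- The recursion is linear in the max-plus sense. -/
lemma sup (hf : IsLastPassage w f) (hg : IsLastPassage w g) :
    IsLastPassage w fun j i => max (f j i) (g j i) := by
  intro j i
  simp only [hf j i, hg j i]
  omega

lemma transpose (hf : IsLastPassage w f) :
    IsLastPassage (fun z => w z.swap) fun j i => f i j := by
  intro j i
  simp only [hf i j, Prod.swap_prod_mk, max_comm (f (i + 1) j)]

end IsLastPassage

lemma lpt_transpose (I J : ℕ → Bool) (w : ℕ × ℕ → Bool) (j i : ℕ) :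
    lpt J I (fun z => w z.swap) i j = lpt I J w j i :=
  (isLastPassage_lpt J I fun z => w z.swap).eq_of_boundary (isLastPassage_lpt I J w).transpose
    (T := i) (M := j)
    (fun i _ => by rw [lpt_zero_left, lpt_zero_right])
    (fun j _ => by rw [lpt_zero_left, lpt_zero_right]) le_rfl le_rfl

/-- A path collects sources or sinks, never both. Formally, the maximum of the two solutions is a
solution, and on each axis one of the two vanishes. -/
lemma lpt_eq_max (I J : ℕ → Bool) (w : ℕ × ℕ → Bool) (j i : ℕ) :
    lpt I J w j i = max (lpt I noPoints w j i) (lpt noPoints J w j i) :=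
  (isLastPassage_lpt I J w).eq_of_boundary
    ((isLastPassage_lpt I noPoints w).sup (isLastPassage_lpt noPoints J w)) (T := j) (M := i)
    (fun i _ => by simp [lpt_zero_left]) (fun j _ => by simp [lpt_zero_right]) le_rfl le_rfl

lemma lpt_mono {I I' J J' : ℕ → Bool} (hI : I ≤ I') (hJ : J ≤ J') (w : ℕ × ℕ → Bool) (j i : ℕ) :
    lpt I J w j i ≤ lpt I' J' w j i :=
  (isLastPassage_lpt I J w).le_add (isLastPassage_lpt I' J' w) 0 (T := j) (M := i)
    (fun i _ => by simpa [lpt_zero_left] using count_mono hI i)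
    (fun j _ => by simpa [lpt_zero_right] using count_mono hJ j) j le_rfl i le_rfl

/-- Attractiveness: more sources and fewer sinks give more horizontal and fewer vertical edges. -/
lemma hor_ver_mono {I I' J J' : ℕ → Bool} (hI : I ≤ I') (hJ : J' ≤ J) (w : ℕ × ℕ → Bool) (j : ℕ) :
    hor I J w j ≤ hor I' J' w j ∧ ver I' J' w j ≤ ver I J w j := by
  have cH : ∀ {x x' y y' : Bool} (v : Bool), x ≤ x' → y' ≤ y → cellH x y v ≤ cellH x' y' v := by
    decide
  have cV : ∀ {x x' y y' : Bool} (v : Bool), x ≤ x' → y' ≤ y → cellV x' y' v ≤ cellV x y v := by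
    decide
  have key : ∀ j, hor I J w j ≤ hor I' J' w j → ver I' J' w j ≤ ver I J w j := by
    intro j hj i
    induction i with
    | zero => exact hJ j
    | succ i ih => exact cV _ (hj i) ih
  have hh : hor I J w j ≤ hor I' J' w j := by
    induction j with
    | zero => exact hI
    | succ j ih => exact fun i => cH _ (ih i) (key j ih i)
  exact ⟨hh, key j hh⟩

lemma hor_mono {I I' J J' : ℕ → Bool} (hI : I ≤ I') (hJ : J' ≤ J) (w : ℕ × ℕ → Bool) (j : ℕ) :
    hor I J w j ≤ hor I' J' w j := (hor_ver_mono hI hJ w j).1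

lemma ver_anti {I I' J J' : ℕ → Bool} (hI : I ≤ I') (hJ : J' ≤ J) (w : ℕ × ℕ → Bool) (j : ℕ) :
    ver I' J' w j ≤ ver I J w j := (hor_ver_mono hI hJ w j).2

/-- Increments along a row are monotone in the horizontal edges. -/
lemma lpt_add_le_of_hor_le {I I' J J' : ℕ → Bool} {w : ℕ × ℕ → Bool} {j : ℕ}
    (h : hor I J w j ≤ hor I' J' w j) {x y : ℕ} (hxy : x ≤ y) :
    lpt I J w j y + lpt I' J' w j x ≤ lpt I' J' w j y + lpt I J w j x := by
  induction y, hxy using Nat.le_induction with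
  | base => omega
  | succ y _ ih =>
    rw [lpt_succ_right, lpt_succ_right]
    have := Bool.toNat_le_toNat (h y)
    omega

/-! ### Restarting at a column -/

/-- The weights seen from column `k`. -/
def shiftWeights (w : ℕ × ℕ → Bool) (k : ℕ) : ℕ × ℕ → Bool := fun z => w (z.1, k + z.2)

/-- The dynamics is local: the quadrant to the right of column `k` sees the past only through the
vertical edges in that column, which act as its sinks. -/
lemma hor_restart (I J : ℕ → Bool) (w : ℕ × ℕ → Bool) (k j : ℕ) :
    (∀ i, hor (fun i => I (k + i)) (fun j => ver I J w j k) (shiftWeights w k) j i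
      = hor I J w j (k + i)) ∧
    ∀ i, ver (fun i => I (k + i)) (fun j => ver I J w j k) (shiftWeights w k) j i
      = ver I J w j (k + i) := by
  have key : ∀ j, (∀ i, hor (fun i => I (k + i)) (fun j => ver I J w j k) (shiftWeights w k) j i
      = hor I J w j (k + i)) →
      ∀ i, ver (fun i => I (k + i)) (fun j => ver I J w j k) (shiftWeights w k) j i
      = ver I J w j (k + i) := by
    intro j hj i
    induction i with
    | zero => rfl
    | succ i ih => rw [ver_succ, hj, ih, ← add_assoc, ver_succ]; rfl
  have hh : ∀ i, hor (fun i => I (k + i)) (fun j => ver I J w j k) (shiftWeights w k) j i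
      = hor I J w j (k + i) := by
    induction j with
    | zero => exact fun i => rfl
    | succ j ih => intro i; rw [hor_succ, ih, key j ih, hor_succ]; rfl
  exact ⟨hh, key j hh⟩

lemma lpt_restart (I J : ℕ → Bool) (w : ℕ × ℕ → Bool) (k j i : ℕ) :
    lpt I J w j (k + i) = count I k +
      lpt (fun i => I (k + i)) (fun j => ver I J w j k) (shiftWeights w k) j i := by
  have h1 : lpt I J w j (k + i) = lpt I J w j k + count (fun i => hor I J w j (k + i)) i := by
    rw [lpt, lpt, count_add, add_assoc]
  rw [h1, lpt_eq_count_add, lpt, add_assoc]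
  congr 2
  exact count_congr fun i' _ => ((hor_restart I J w k j).1 i').symm

/-- The horizontal edges to the left of column `k` and the vertical edges up to column `k`
are determined by the sources to the left of column `k`. -/
lemma hor_ver_congr {I I' : ℕ → Bool} (J : ℕ → Bool) (w : ℕ × ℕ → Bool) {k : ℕ}
    (h : ∀ i < k, I i = I' i) (j : ℕ) :
    (∀ i < k, hor I J w j i = hor I' J w j i) ∧ ∀ i ≤ k, ver I J w j i = ver I' J w j i := by
  have key : ∀ j, (∀ i < k, hor I J w j i = hor I' J w j i) →
      ∀ i ≤ k, ver I J w j i = ver I' J w j i := by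
    intro j hj i
    induction i with
    | zero => exact fun _ => rfl
    | succ i ih => intro hi; rw [ver_succ, ver_succ, hj i (by omega), ih (by omega)]
  have hh : ∀ i < k, hor I J w j i = hor I' J w j i := by
    induction j with
    | zero => exact h
    | succ j ih => intro i hi; rw [hor_succ, hor_succ, ih i hi, key j ih i hi.le]
  exact ⟨hh, key j hh⟩

/-! ### Exits through the sources -/

/-- The best path to `(T, M)` may be taken to use all sources to the left of column `k`. -/
def ExitAfter (I J : ℕ → Bool) (w : ℕ × ℕ → Bool) (T M k : ℕ) : Prop :=
  lpt noPoints (fun j => ver I J w j k) (shiftWeights w k) T (M - k)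
    ≤ lpt (fun i => I (k + i)) noPoints (shiftWeights w k) T (M - k)

/-- By `ver_anti`, more sources and fewer sinks leave fewer vertical edges in column `k`, which
lowers the left side; the additional sources raise the right side. -/
lemma ExitAfter.mono {I I' J J' : ℕ → Bool} {w : ℕ × ℕ → Bool} {T M k : ℕ}
    (h : ExitAfter I J w T M k) (hI : I ≤ I') (hJ : J' ≤ J) : ExitAfter I' J' w T M k :=
  (lpt_mono le_rfl (fun j => ver_anti hI hJ w j k) _ _ _).trans
    (h.trans (lpt_mono (fun i => hI (k + i)) le_rfl _ _ _))

lemma ExitAfter.lpt_eq {I J : ℕ → Bool} {w : ℕ × ℕ → Bool} {T M k : ℕ}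
    (h : ExitAfter I J w T M k) (hk : k ≤ M) :
    lpt I J w T M =
      count I k + lpt (fun i => I (k + i)) noPoints (shiftWeights w k) T (M - k) := by
  conv_lhs => rw [← Nat.add_sub_of_le hk]
  rw [lpt_restart, lpt_eq_max, max_eq_left h]

/-- The optimal path that stays on the axis up to column `k` remains available with the sources `I'`
and gains all the extra sources before `k`. The sinks `J'` are arbitrary because only a lower bound
for the new time is needed. -/
lemma ExitAfter.count_add_le {I I' J J' : ℕ → Bool} {w : ℕ × ℕ → Bool} {T M k : ℕ}
    (h : ExitAfter I J w T M k) (hk : k ≤ M) (hI : I ≤ I') :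
    count I' k + lpt I J w T M ≤ count I k + lpt I' J' w T M := by
  have h1 : count I' k + lpt (fun i => I' (k + i)) noPoints (shiftWeights w k) T (M - k)
      ≤ lpt I' J' w T M := by
    conv_rhs => rw [← Nat.add_sub_of_le hk]
    rw [lpt_restart]
    exact Nat.add_le_add_left (lpt_mono le_rfl (fun _ => Bool.false_le _) _ _ _) _
  have h2 : lpt (fun i => I (k + i)) noPoints (shiftWeights w k) T (M - k)
      ≤ lpt (fun i => I' (k + i)) noPoints (shiftWeights w k) T (M - k) :=
    lpt_mono (fun i => hI (k + i)) le_rfl _ _ _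
  rw [h.lpt_eq hk]
  omega

lemma shiftWeights_zero (w : ℕ × ℕ → Bool) : shiftWeights w 0 = w := by
  funext z; simp [shiftWeights]

lemma exitAfter_zero_iff {I J : ℕ → Bool} {w : ℕ × ℕ → Bool} {T M : ℕ} :
    ExitAfter I J w T M 0 ↔ lpt noPoints J w T M ≤ lpt I noPoints w T M := by
  simp [ExitAfter, shiftWeights_zero, ver_zero]

/-- A source that makes a difference is used by some best path. -/
lemma lpt_update_source (I J : ℕ → Bool) (w : ℕ × ℕ → Bool) (T : ℕ) {M k : ℕ} (hk : k < M) :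
    lpt (Function.update I k false) J w T M ≤ lpt (Function.update I k true) J w T M ∧
    lpt (Function.update I k true) J w T M ≤ lpt (Function.update I k false) J w T M + 1 ∧
    (lpt (Function.update I k false) J w T M < lpt (Function.update I k true) J w T M →
      ExitAfter I J w T M k) := by
  set I0 := Function.update I k false with hI0
  set I1 := Function.update I k true with hI1
  have h01 : I0 ≤ I1 := by
    intro i
    by_cases hi : i = k
    · subst hi; simp [hI0]
    · simp [hI0, hI1, hi]
  have h0 : I0 ≤ I := fun i => by
    by_cases hi : i = k
    · subst hi; simp [hI0]
    · simp [hI0, hi]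
  have hc : ∀ m, count I1 m ≤ count I0 m + 1 := by
    intro m
    have hb : ∀ m ≤ k, count I1 m = count I0 m := fun m hm => count_congr fun i hi => by
      simp [hI0, hI1, (hi.trans_le hm).ne]
    rcases Nat.lt_or_ge k m with hm | hm
    · obtain ⟨d, rfl⟩ := Nat.exists_eq_add_of_lt hm
      rw [show k + d + 1 = k + 1 + d by ring, count_add I1 (k + 1), count_add I0 (k + 1),
        count_succ I1, count_succ I0, hb k le_rfl]
      have : count (fun i => I1 (k + 1 + i)) d = count (fun i => I0 (k + 1 + i)) d :=
        count_congr fun i _ => by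
          have hne : k + 1 + i ≠ k := by omega
          simp [hI0, hI1, hne]
      have := Bool.toNat_le (I1 k)
      omega
    · rw [hb m hm]; omega
  have hle : lpt I1 J w T M ≤ lpt I0 J w T M + 1 :=
    (isLastPassage_lpt I1 J w).le_add (isLastPassage_lpt I0 J w) 1 (T := T) (M := M)
      (fun i _ => by simpa [lpt_zero_left] using hc i)
      (fun j _ => by simp [lpt_zero_right]) T le_rfl M le_rfl
  refine ⟨lpt_mono h01 le_rfl w T M, hle, fun hlt => ?_⟩
  have hv : ∀ I', (∀ i < k, I i = I' i) →
      (fun j => ver I' J w j k) = fun j => ver I J w j k := fun I' h => by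
    funext j; exact ((hor_ver_congr J w h j).2 k le_rfl).symm
  -- After the restart both times are the same constant plus `max A₀ B` and `max A₁ B`, where the
  -- sink term `B` does not see source `k` and `A₀ ≤ A₁ ≤ A₀ + 1`. A strict increase forces `B < A₁
  -- ≤ A₀ + 1`, hence `B ≤ A₀`, which is the exit event for `I0` and so for `I`.
  have e0 := lpt_restart I0 J w k T (M - k)
  have e1 := lpt_restart I1 J w k T (M - k)
  rw [Nat.add_sub_of_le hk.le, lpt_eq_max (fun i => I0 (k + i)),
    hv _ fun i hi => by simp [hI0, hi.ne]] at e0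
  rw [Nat.add_sub_of_le hk.le, lpt_eq_max (fun i => I1 (k + i)),
    hv _ fun i hi => by simp [hI1, hi.ne]] at e1
  have ec : count I1 k = count I0 k := count_congr fun i hi => by simp [hI0, hI1, hi.ne]
  have hsh : lpt (fun i => I1 (k + i)) noPoints (shiftWeights w k) T (M - k)
      ≤ lpt (fun i => I0 (k + i)) noPoints (shiftWeights w k) T (M - k) + 1 :=
    (isLastPassage_lpt _ _ _).le_add (isLastPassage_lpt _ _ _) 1 (T := T) (M := M - k)
      (fun i _ => by
        have b := hc (k + i)
        rw [count_add, count_add, ec] at b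
        simp only [lpt_zero_left]; omega)
      (fun j _ => by simp [lpt_zero_right]) T le_rfl (M - k) le_rfl
  have hfin : lpt (fun i => I0 (k + i)) noPoints (shiftWeights w k) T (M - k)
      ≤ lpt (fun i => I (k + i)) noPoints (shiftWeights w k) T (M - k) :=
    lpt_mono (fun i => h0 (k + i)) le_rfl _ _ _
  unfold ExitAfter
  omega

/-! ### Local comparison -/

/-- If a best path to `(T, x)` exits through the sources, the increments to the right of `x`
dominate those without sources and sinks. -/
lemma lpt_add_le_of_exit {I J : ℕ → Bool} {w : ℕ × ℕ → Bool} {T x₀ x y : ℕ}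
    (h : lpt noPoints J w T x₀ ≤ lpt I noPoints w T x₀) (hx : x₀ ≤ x) (hxy : x ≤ y) :
    lpt noPoints noPoints w T y + lpt I J w T x ≤ lpt I J w T y + lpt noPoints noPoints w T x := by
  have nI : noPoints ≤ I := fun _ => Bool.false_le _
  have nJ : noPoints ≤ J := fun _ => Bool.false_le _
  have a1 := lpt_add_le_of_hor_le (hor_mono nI le_rfl w T : hor noPoints noPoints w T ≤ _) hxy
  have a2 := lpt_add_le_of_hor_le (hor_mono le_rfl nJ w T : hor I J w T ≤ hor I noPoints w T) hx
  have a3 : lpt I noPoints w T y ≤ lpt I J w T y := lpt_mono le_rfl nJ w T y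
  have a4 : lpt I noPoints w T x ≤ lpt I J w T x := lpt_mono le_rfl nJ w T x
  -- At `x₀` the sinks do not matter. Since sinks only decrease horizontal increments (`a2`), they
  -- do not matter at `x` either, and `a1` may be read with the sinks put back.
  have e := lpt_eq_max I J w T x₀
  rw [max_eq_left h] at e
  omega

/-- If a best path to `(T, y₀)` exits through the sinks, the increments to the left of `y₀`
are dominated by those without sources and sinks. -/
lemma le_lpt_add_of_exit {I J : ℕ → Bool} {w : ℕ × ℕ → Bool} {T y₀ x y : ℕ}
    (h : lpt I noPoints w T y₀ ≤ lpt noPoints J w T y₀) (hy : y ≤ y₀) (hxy : x ≤ y) :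
    lpt I J w T y + lpt noPoints noPoints w T x ≤ lpt noPoints noPoints w T y + lpt I J w T x := by
  have nI : noPoints ≤ I := fun _ => Bool.false_le _
  have nJ : noPoints ≤ J := fun _ => Bool.false_le _
  have a1 := lpt_add_le_of_hor_le (hor_mono le_rfl nJ w T : hor noPoints J w T ≤ _) hxy
  have a2 := lpt_add_le_of_hor_le (hor_mono nI le_rfl w T : hor noPoints J w T ≤ hor I J w T) hy
  have a3 : lpt noPoints J w T x ≤ lpt I J w T x := lpt_mono nI le_rfl w T x
  have a4 : lpt noPoints J w T y ≤ lpt I J w T y := lpt_mono nI le_rfl w T y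
  have e := lpt_eq_max I J w T y₀
  rw [max_eq_right h] at e
  omega
/-! ### Product measures -/

/-- Resampling one coordinate. It serves to isolate the fresh weight of a cell in Burke's theorem
and a single source level in the covariance formula. -/
lemma measurePreserving_update_infinitePi {ι X : Type*} [DecidableEq ι] [MeasurableSpace X]
    (ν : Measure X) [IsProbabilityMeasure ν] (k : ι) :
    MeasurePreserving (fun z : (ι → X) × X => Function.update z.1 k z.2)
      ((Measure.infinitePi fun _ : ι => ν).prod ν) (Measure.infinitePi fun _ : ι => ν) := by
  have hm : Measurable (fun z : (ι → X) × X => Function.update z.1 k z.2) := measurable_update'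
  refine ⟨hm, Measure.eq_infinitePi _ fun s t ht => ?_⟩
  have hs : ∀ s : Finset ι, MeasurableSet (Set.pi (s : Set ι) t) := fun s =>
    MeasurableSet.pi s.countable_toSet fun i _ => ht i
  rw [Measure.map_apply hm (hs s)]
  by_cases hk : k ∈ s
  · have : (fun z : (ι → X) × X => Function.update z.1 k z.2) ⁻¹' Set.pi (s : Set ι) t
        = Set.pi ((s.erase k : Finset ι) : Set ι) t ×ˢ t k := by
      ext ⟨f, x⟩
      simp only [mem_preimage, Set.mem_pi, Finset.mem_coe, mem_prod, Finset.mem_erase]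
      constructor
      · intro h
        exact ⟨fun i hi => by simpa [hi.1] using h i hi.2, by simpa using h k hk⟩
      · rintro ⟨h1, h2⟩ i hi
        by_cases hik : i = k
        · subst hik; simpa using h2
        · simpa [hik] using h1 i ⟨hik, hi⟩
    rw [this, Measure.prod_prod, Measure.infinitePi_pi _ (fun i _ => ht i), mul_comm,
      Finset.mul_prod_erase s (fun i => ν (t i)) hk]
  · have : (fun z : (ι → X) × X => Function.update z.1 k z.2) ⁻¹' Set.pi (s : Set ι) t
        = Set.pi (s : Set ι) t ×ˢ univ := by
      ext ⟨f, x⟩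
      simp only [mem_preimage, Set.mem_pi, Finset.mem_coe, mem_prod, mem_univ, and_true]
      refine forall₂_congr fun i hi => ?_
      rw [Function.update_of_ne (by rintro rfl; exact hk hi)]
    rw [this, Measure.prod_prod, Measure.infinitePi_pi _ (fun i _ => ht i), measure_univ, mul_one]

lemma lintegral_update_infinitePi {ι X : Type*} [DecidableEq ι] [MeasurableSpace X]
    (ν : Measure X) [IsProbabilityMeasure ν] (k : ι) {F : (ι → X) → ℝ≥0∞} (hF : Measurable F) :
    ∫⁻ f, F f ∂(Measure.infinitePi fun _ : ι => ν)
      = ∫⁻ f, ∫⁻ x, F (Function.update f k x) ∂ν ∂(Measure.infinitePi fun _ : ι => ν) := by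
  rw [← (measurePreserving_update_infinitePi ν k).lintegral_comp hF, lintegral_prod]
  exact (hF.comp measurable_update').aemeasurable

/-! ### Uniform and Bernoulli variables -/

/-- The uniform distribution on the unit interval. -/
def unif : Measure ℝ := volume.restrict (Icc 0 1)

instance : IsProbabilityMeasure unif := ⟨by simp [unif]⟩

lemma unif_Iio {a : ℝ} (h1 : a ≤ 1) : unif (Iio a) = ENNReal.ofReal a := by
  rw [unif, Measure.restrict_apply measurableSet_Iio]
  have : Iio a ∩ Icc 0 1 = Ico 0 a := by
    ext x; simp only [mem_inter_iff, mem_Iio, mem_Icc, mem_Ico]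
    constructor
    · rintro ⟨h, h', -⟩; exact ⟨h', h⟩
    · rintro ⟨h, h'⟩; exact ⟨h', h, by linarith⟩
  rw [this]; simp

/-- The threshold function at level `a`. -/
def belowLevel (a u : ℝ) : Bool := decide (u < a)

lemma measurable_belowLevel (a : ℝ) : Measurable (belowLevel a) := by
  refine measurable_to_bool ?_
  have : belowLevel a ⁻¹' {true} = Iio a := by ext; simp [belowLevel]
  rw [this]; exact measurableSet_Iio

lemma belowLevel_mono {a a' : ℝ} (h : a ≤ a') (u : ℝ) : belowLevel a u ≤ belowLevel a' u := by
  unfold belowLevel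
  by_cases hu : u < a
  · simp [hu, hu.trans_le h]
  · simp [hu]

/-- The Bernoulli distribution on `Bool` with parameter `a ∈ [0, 1]`. -/
def ber (a : ℝ) : Measure Bool := unif.map (belowLevel a)

instance (a : ℝ) : IsProbabilityMeasure (ber a) :=
  Measure.isProbabilityMeasure_map (measurable_belowLevel a).aemeasurable

lemma ber_true {a : ℝ} (h1 : a ≤ 1) : ber a {true} = ENNReal.ofReal a := by
  rw [ber, Measure.map_apply (measurable_belowLevel a) (by measurability), ← unif_Iio h1]
  congr 1; ext; simp [belowLevel]

lemma ber_false {a : ℝ} (h0 : 0 ≤ a) (h1 : a ≤ 1) : ber a {false} = ENNReal.ofReal (1 - a) := by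
  have h := prob_compl_eq_one_sub (μ := ber a) (s := {true}) (by measurability)
  rw [ber_true h1, show ({true}ᶜ : Set Bool) = {false} by ext b; cases b <;> simp] at h
  rw [h, ENNReal.ofReal_sub _ h0, ENNReal.ofReal_one]

lemma eq_ber {ν : Measure Bool} [IsProbabilityMeasure ν] {a : ℝ} (h0 : 0 ≤ a) (h1 : a ≤ 1)
    (h : ν {true} = ENNReal.ofReal a) : ν = ber a := by
  refine Measure.ext_of_singleton fun b => ?_
  cases b
  · have h' := prob_compl_eq_one_sub (μ := ν) (s := {true}) (by measurability)
    rw [h, show ({true}ᶜ : Set Bool) = {false} by ext b; cases b <;> simp] at h'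
    rw [h', ber_false h0 h1, ENNReal.ofReal_sub _ h0, ENNReal.ofReal_one]
  · rw [h, ber_true h1]

lemma lintegral_ber {a : ℝ} (h0 : 0 ≤ a) (h1 : a ≤ 1) (F : Bool → ℝ≥0∞) :
    ∫⁻ b, F b ∂(ber a) = ENNReal.ofReal a * F true + ENNReal.ofReal (1 - a) * F false := by
  rw [lintegral_fintype, Fintype.sum_bool, ber_true h1, ber_false h0 h1, mul_comm (F true),
    mul_comm (F false)]

lemma integral_ber {E : Type*} [NormedAddCommGroup E] [NormedSpace ℝ E] [CompleteSpace E] {a : ℝ}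
    (h0 : 0 ≤ a) (h1 : a ≤ 1) (F : Bool → E) : ∫ b, F b ∂(ber a) = a • F true + (1 - a) • F false := by
  rw [integral_fintype .of_finite, Fintype.sum_bool, measureReal_def, measureReal_def,
    ber_true h1, ber_false h0 h1, ENNReal.toReal_ofReal h0, ENNReal.toReal_ofReal (by linarith)]

/-- Independent Bernoulli variables. -/
def berSeq (ι : Type*) (a : ℝ) : Measure (ι → Bool) := Measure.infinitePi fun _ => ber a

instance (ι : Type*) (a : ℝ) : IsProbabilityMeasure (berSeq ι a) := by
  unfold berSeq; infer_instance

lemma lintegral_update_berSeq {ι : Type*} [DecidableEq ι] (a : ℝ) (k : ι)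
    {F : (ι → Bool) → ℝ≥0∞} (hF : Measurable F) :
    ∫⁻ f, F f ∂(berSeq ι a) = ∫⁻ f, ∫⁻ x, F (Function.update f k x) ∂(ber a) ∂(berSeq ι a) :=
  lintegral_update_infinitePi (ber a) k hF

/-! ### Burke's theorem for the discrete model -/

/-- The parameters of sources, sinks and weights for which the discrete model is stationary. -/
structure Balanced (a b p : ℝ) : Prop where
  a_nonneg : 0 ≤ a
  a_le : a ≤ 1
  b_nonneg : 0 ≤ b
  b_le : b ≤ 1
  p_nonneg : 0 ≤ p
  p_le : p ≤ 1
  balance : (1 - a) * (1 - b) * p = a * b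

/-- The output with both edges present arises only from two absent edges and an occupied cell, of
mass `(1 - a) * (1 - b) * p`; two present edges, of mass `a * b`, give two absent ones. The balance
equation says that these masses agree, and a single edge passes straight through. -/
lemma Balanced.lintegral_cell {a b p : ℝ} (h : Balanced a b p) (F : Bool → Bool → ℝ≥0∞) :
    ∫⁻ x, ∫⁻ y, ∫⁻ c, F (cellH x y c) (cellV x y c) ∂(ber p) ∂(ber b) ∂(ber a)
      = ∫⁻ x, ∫⁻ y, F x y ∂(ber b) ∂(ber a) := by
  obtain ⟨a0, a1, b0, b1, p0, p1, hb⟩ := h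
  simp only [lintegral_ber a0 a1, lintegral_ber b0 b1, lintegral_ber p0 p1]
  simp only [cellH, cellV, Bool.not_true, Bool.not_false, Bool.or_true, Bool.and_true,
    Bool.and_false, Bool.or_false]
  have hP : ENNReal.ofReal p + ENNReal.ofReal (1 - p) = 1 := by
    rw [← ENNReal.ofReal_add p0 (by linarith)]; simp
  have e1 : ENNReal.ofReal (1 - a) * ENNReal.ofReal (1 - b) * ENNReal.ofReal p
      = ENNReal.ofReal a * ENNReal.ofReal b := by
    rw [← ENNReal.ofReal_mul (by linarith),
      ← ENNReal.ofReal_mul (mul_nonneg (by linarith) (by linarith)), hb, ENNReal.ofReal_mul a0]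
  generalize ENNReal.ofReal p = P at *
  generalize ENNReal.ofReal (1 - p) = P' at *
  generalize ENNReal.ofReal a = A at *
  generalize ENNReal.ofReal (1 - a) = A' at *
  generalize ENNReal.ofReal b = B at *
  generalize ENNReal.ofReal (1 - b) = B' at *
  -- Masses in `ℝ≥0∞` cannot be subtracted, so the terms are only regrouped with `e1` and `hP`.
  calc _ = (A' * B' * P) * F true true + A * B * (P + P') * F false false
        + A' * B' * P' * F false false
        + (P + P') * (A * B') * F true false + (P + P') * (A' * B) * F false true := by ring
    _ = A * B * F true true + (A' * B' * P) * F false false + A' * B' * P' * F false false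
        + A * B' * F true false + A' * B * F false true := by rw [e1, hP]; ring
    _ = A * B * F true true + A' * B' * (P + P') * F false false
        + A * B' * F true false + A' * B * F false true := by ring
    _ = _ := by rw [hP]; ring

/-- Processing the cell `c` of weight `b`: replace its lower and left edges by its upper and right
edges. -/
def step (c : ℕ × ℕ) (b : Bool) (x : (ℕ → Bool) × (ℕ → Bool)) : (ℕ → Bool) × (ℕ → Bool) :=
  (Function.update x.1 c.2 (cellH (x.1 c.2) (x.2 c.1) b),
    Function.update x.2 c.1 (cellV (x.1 c.2) (x.2 c.1) b))

/-- Processing the cells in a list. -/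
def run : List (ℕ × ℕ) → (ℕ × ℕ → Bool) → (ℕ → Bool) × (ℕ → Bool) → (ℕ → Bool) × (ℕ → Bool)
  | [], _, x => x
  | c :: l, w, x => run l w (step c (w c) x)

lemma measurable_cellH {α : Type*} [MeasurableSpace α] {f g h : α → Bool} (hf : Measurable f)
    (hg : Measurable g) (hh : Measurable h) : Measurable fun z => cellH (f z) (g z) (h z) :=
  (Measurable.of_discrete (f := fun q : Bool × Bool × Bool => cellH q.1 q.2.1 q.2.2)).comp
    (hf.prodMk (hg.prodMk hh))

lemma measurable_cellV {α : Type*} [MeasurableSpace α] {f g h : α → Bool} (hf : Measurable f)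
    (hg : Measurable g) (hh : Measurable h) : Measurable fun z => cellV (f z) (g z) (h z) :=
  (Measurable.of_discrete (f := fun q : Bool × Bool × Bool => cellV q.1 q.2.1 q.2.2)).comp
    (hf.prodMk (hg.prodMk hh))

lemma Measurable.step {α : Type*} [MeasurableSpace α] (c : ℕ × ℕ) {b : α → Bool}
    {x : α → (ℕ → Bool) × (ℕ → Bool)} (hb : Measurable b) (hx : Measurable x) :
    Measurable fun z => step c (b z) (x z) := by
  have m1 : Measurable fun z => (x z).1 c.2 := (measurable_pi_apply c.2).comp hx.fst
  have m2 : Measurable fun z => (x z).2 c.1 := (measurable_pi_apply c.1).comp hx.snd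
  exact (measurable_update'.comp (hx.fst.prodMk (measurable_cellH m1 m2 hb))).prodMk
    (measurable_update'.comp (hx.snd.prodMk (measurable_cellV m1 m2 hb)))

lemma Measurable.run {α : Type*} [MeasurableSpace α] (l : List (ℕ × ℕ))
    {w : α → ℕ × ℕ → Bool} {x : α → (ℕ → Bool) × (ℕ → Bool)} (hw : Measurable w)
    (hx : Measurable x) : Measurable fun z => run l (w z) (x z) := by
  induction l generalizing x with
  | nil => exact hx
  | cons c l ih => exact ih (Measurable.step c ((measurable_pi_apply c).comp hw) hx)

lemma run_append (l l' : List (ℕ × ℕ)) (w : ℕ × ℕ → Bool) (x : (ℕ → Bool) × (ℕ → Bool)) :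
    run (l ++ l') w x = run l' w (run l w x) := by
  induction l generalizing x with
  | nil => rfl
  | cons c l ih => exact ih _

lemma run_update {l : List (ℕ × ℕ)} {c : ℕ × ℕ} (hc : c ∉ l) (w : ℕ × ℕ → Bool) (b : Bool)
    (x : (ℕ → Bool) × (ℕ → Bool)) : run l (Function.update w c b) x = run l w x := by
  induction l generalizing x with
  | nil => rfl
  | cons d l ih =>
    rw [List.mem_cons, not_or] at hc
    rw [run, run, Function.update_of_ne (Ne.symm hc.1), ih hc.2]

section Burke

variable {a b p : ℝ}

/-- A step touches one entry of each sequence. Integrating these two entries separately from the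
others reduces the claim to a single cell. -/
lemma Balanced.lintegral_step (h : Balanced a b p) (c : ℕ × ℕ)
    {F : (ℕ → Bool) × (ℕ → Bool) → ℝ≥0∞} (hF : Measurable F) :
    ∫⁻ x, ∫⁻ v, F (step c v x) ∂(ber p) ∂((berSeq ℕ a).prod (berSeq ℕ b))
      = ∫⁻ x, F x ∂((berSeq ℕ a).prod (berSeq ℕ b)) := by
  have mstep : Measurable fun z : ((ℕ → Bool) × (ℕ → Bool)) × Bool => F (step c z.2 z.1) :=
    hF.comp (Measurable.step c measurable_snd measurable_fst)
  have expand : ∀ G : (ℕ → Bool) × (ℕ → Bool) → ℝ≥0∞, Measurable G →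
      ∫⁻ x, G x ∂((berSeq ℕ a).prod (berSeq ℕ b)) = ∫⁻ f, ∫⁻ g, ∫⁻ x, ∫⁻ y,
        G (Function.update f c.2 x, Function.update g c.1 y) ∂(ber b) ∂(ber a) ∂(berSeq ℕ b)
          ∂(berSeq ℕ a) := by
    intro G hG
    have m1 : Measurable fun z : (((ℕ → Bool) × (ℕ → Bool)) × Bool) × Bool =>
        G (Function.update z.1.1.1 c.2 z.1.2, Function.update z.1.1.2 c.1 z.2) :=
      hG.comp ((measurable_update'.comp ((measurable_fst.comp
        (measurable_fst.comp measurable_fst)).prodMk (measurable_snd.comp measurable_fst))).prodMk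
        (measurable_update'.comp ((measurable_snd.comp
        (measurable_fst.comp measurable_fst)).prodMk measurable_snd)))
    have m2 : Measurable fun z : ((ℕ → Bool) × (ℕ → Bool)) × Bool =>
        G (Function.update z.1.1 c.2 z.2, z.1.2) :=
      hG.comp ((measurable_update'.comp ((measurable_fst.comp measurable_fst).prodMk
        measurable_snd)).prodMk (measurable_snd.comp measurable_fst))
    rw [lintegral_prod _ hG.aemeasurable,
      lintegral_update_berSeq a c.2 hG.lintegral_prod_right']
    refine lintegral_congr fun f => ?_
    have m3 : Measurable fun z : Bool × (ℕ → Bool) => G (Function.update f c.2 z.1, z.2) :=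
      m2.comp ((measurable_const.prodMk measurable_snd).prodMk measurable_fst)
    rw [lintegral_lintegral_swap m3.aemeasurable,
      lintegral_update_berSeq b c.1 m3.lintegral_prod_left']
    refine lintegral_congr fun g => ?_
    have m4 : Measurable fun z : Bool × Bool =>
        G (Function.update f c.2 z.2, Function.update g c.1 z.1) := .of_discrete
    exact lintegral_lintegral_swap m4.aemeasurable
  rw [expand _ mstep.lintegral_prod_right', expand _ hF]
  refine lintegral_congr fun f => lintegral_congr fun g => ?_
  rw [← h.lintegral_cell fun x y => F (Function.update f c.2 x, Function.update g c.1 y)]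
  simp [step]

/-- Induction over the cells: as no cell recurs, the weight of the first one is independent of the
rest of the run, so processing it preserves the product law of the edges. -/
lemma Balanced.lintegral_run (h : Balanced a b p) {l : List (ℕ × ℕ)} (hl : l.Nodup)
    {F : (ℕ → Bool) × (ℕ → Bool) → ℝ≥0∞} (hF : Measurable F) :
    ∫⁻ w, ∫⁻ x, F (run l w x) ∂((berSeq ℕ a).prod (berSeq ℕ b)) ∂(berSeq (ℕ × ℕ) p)
      = ∫⁻ x, F x ∂((berSeq ℕ a).prod (berSeq ℕ b)) := by
  induction l with
  | nil => simp [run]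
  | cons c l ih =>
    obtain ⟨hc, hl⟩ := List.nodup_cons.1 hl
    have m1 : Measurable fun z : (ℕ × ℕ → Bool) × ((ℕ → Bool) × (ℕ → Bool)) =>
        F (run (c :: l) z.1 z.2) := hF.comp (Measurable.run _ measurable_fst measurable_snd)
    rw [lintegral_update_berSeq p c m1.lintegral_prod_right', ← ih hl]
    refine lintegral_congr fun w => ?_
    have m2 : Measurable fun z : Bool × ((ℕ → Bool) × (ℕ → Bool)) =>
        F (run l w (step c z.1 z.2)) :=
      hF.comp (Measurable.run _ measurable_const (Measurable.step c measurable_fst measurable_snd))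
    simp only [run, Function.update_self, run_update hc]
    rw [lintegral_lintegral_swap m2.aemeasurable]
    exact h.lintegral_step c (F := fun x => F (run l w x))
      (hF.comp (Measurable.run _ measurable_const measurable_id))

end Burke

/-- The cells of a rectangle, row by row. -/
def cells (T M : ℕ) : List (ℕ × ℕ) :=
  (List.range T).flatMap fun j => (List.range M).map fun i => (j, i)

lemma nodup_cells (T M : ℕ) : (cells T M).Nodup := by
  have : cells T M = List.product (List.range T) (List.range M) := rfl
  rw [this]
  exact List.Nodup.product List.nodup_range List.nodup_range

/-- While row `j` is processed, entry `j` of the second sequence holds the left edge of the next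
cell and is overwritten at every step. -/
lemma run_row (I J : ℕ → Bool) (w : ℕ × ℕ → Bool) (j M : ℕ)
    (x : (ℕ → Bool) × (ℕ → Bool)) (hx : ∀ i < M, x.1 i = hor I J w j i) (hy : x.2 j = J j) :
    ∀ m ≤ M, run ((List.range m).map fun i => (j, i)) w x
      = (fun i => if i < m then hor I J w (j + 1) i else x.1 i,
          Function.update x.2 j (ver I J w j m)) := by
  intro m
  induction m with
  | zero => intro _; simp [run, ver_zero, ← hy]
  | succ m ih =>
    intro hm
    rw [List.range_succ, List.map_append, run_append, ih (by omega)]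
    simp only [List.map_cons, List.map_nil, run, step, lt_irrefl, if_false, Function.update_self,
      Function.update_idem, hx m (by omega)]
    refine Prod.ext (funext fun i => ?_) rfl
    simp only [Function.update_apply]
    by_cases hi : i = m
    · subst hi; simp [hor_succ]
    · simp [hi, Nat.le_iff_lt_or_eq]

lemma run_cells (I J : ℕ → Bool) (w : ℕ × ℕ → Bool) (T M : ℕ) :
    run (cells T M) w (I, J) = (fun i => if i < M then hor I J w T i else I i,
      fun j => if j < T then ver I J w j M else J j) := by
  induction T with
  | zero => simp [cells, run, hor_zero]
  | succ T ih =>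
    have : cells (T + 1) M = cells T M ++ (List.range M).map fun i => (T, i) := by
      simp [cells, List.range_succ]
    rw [this, run_append, ih, run_row I J w T M _ (fun i hi => by simp [hi]) (by simp) M le_rfl]
    refine Prod.ext (funext fun i => ?_) (funext fun j => ?_)
    · by_cases hi : i < M <;> simp [hi]
    · simp only [Function.update_apply]
      by_cases hj : j = T
      · subst hj; simp
      · simp [hj, Nat.le_iff_lt_or_eq]
/-! ### Measurability -/

section Measurability

variable {α : Type*} [MeasurableSpace α] {I J : α → ℕ → Bool} {w : α → ℕ × ℕ → Bool}

lemma measurable_hor_ver (hI : Measurable I) (hJ : Measurable J) (hw : Measurable w) (j : ℕ) :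
    (∀ i, Measurable fun z => hor (I z) (J z) (w z) j i) ∧
      ∀ i, Measurable fun z => ver (I z) (J z) (w z) j i := by
  have key : ∀ j, (∀ i, Measurable fun z => hor (I z) (J z) (w z) j i) →
      ∀ i, Measurable fun z => ver (I z) (J z) (w z) j i := by
    intro j hj i
    induction i with
    | zero => exact (measurable_pi_apply j).comp hJ
    | succ i ih => exact measurable_cellV (hj i) ih ((measurable_pi_apply (j, i)).comp hw)
  have hh : ∀ i, Measurable fun z => hor (I z) (J z) (w z) j i := by
    induction j with
    | zero => exact fun i => (measurable_pi_apply i).comp hI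
    | succ j ih =>
      exact fun i => measurable_cellH (ih i) (key j ih i) ((measurable_pi_apply (j, i)).comp hw)
  exact ⟨hh, key j hh⟩

lemma measurable_count {x : α → ℕ → Bool} (hx : ∀ i, Measurable fun z => x z i) (n : ℕ) :
    Measurable fun z => count (x z) n :=
  Finset.measurable_sum _ fun i _ => (Measurable.of_discrete (f := Bool.toNat)).comp (hx i)

lemma measurable_lpt (hI : Measurable I) (hJ : Measurable J) (hw : Measurable w) (j i : ℕ) :
    Measurable fun z => lpt (I z) (J z) (w z) j i :=
  (measurable_count (fun i => (measurable_pi_apply i).comp hJ) j).add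
    (measurable_count (measurable_hor_ver hI hJ hw j).1 i)

lemma measurableSet_exitAfter (hI : Measurable I) (hJ : Measurable J) (hw : Measurable w)
    (T M k : ℕ) : MeasurableSet {z | ExitAfter (I z) (J z) (w z) T M k} := by
  have hs : Measurable fun z => shiftWeights (w z) k :=
    measurable_pi_iff.2 fun c => (measurable_pi_apply _).comp hw
  exact measurableSet_le
    (measurable_lpt measurable_const
      (measurable_pi_iff.2 fun j => (measurable_hor_ver hI hJ hw j).2 k) hs _ _)
    (measurable_lpt (measurable_pi_iff.2 fun i => (measurable_pi_apply _).comp hI)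
      measurable_const hs _ _)

end Measurability

/-! ### The probability space of the discrete model -/

/-- Levels of sources and sinks, and weights. -/
abbrev Base : Type := (ℕ → ℝ) × (ℕ → ℝ) × (ℕ × ℕ → Bool)

/-- Independent uniform levels. -/
def unifSeq : Measure (ℕ → ℝ) := Measure.infinitePi fun _ => unif

instance : IsProbabilityMeasure unifSeq := by unfold unifSeq; infer_instance

/-- Uniform levels and independent Bernoulli weights. -/
def base (p : ℝ) : Measure Base := unifSeq.prod (unifSeq.prod (berSeq (ℕ × ℕ) p))

instance (p : ℝ) : IsProbabilityMeasure (base p) := by unfold base; infer_instance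

/-- The boundary points of density `a` obtained from the levels `u`. -/
def points (a : ℝ) (u : ℕ → ℝ) : ℕ → Bool := fun i => belowLevel a (u i)

lemma points_mono {a a' : ℝ} (h : a ≤ a') (u : ℕ → ℝ) : points a u ≤ points a' u :=
  fun _ => belowLevel_mono h _

lemma measurable_points (a : ℝ) : Measurable (points a) :=
  measurable_pi_iff.2 fun i => (measurable_belowLevel a).comp (measurable_pi_apply i)

lemma measurePreserving_points (a : ℝ) : MeasurePreserving (points a) unifSeq (berSeq ℕ a) :=
  ⟨measurable_points a, Measure.infinitePi_map_pi _ fun _ => measurable_belowLevel a⟩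

/-- The last-passage time with sources of density `a` and sinks of density `b`. -/
def lptBase (a b : ℝ) (T M : ℕ) (z : Base) : ℕ := lpt (points a z.1) (points b z.2.1) z.2.2 T M

/-- The exit event with sources of density `a` and sinks of density `b`. -/
def exitSet (a b : ℝ) (T M k : ℕ) : Set Base :=
  {z | ExitAfter (points a z.1) (points b z.2.1) z.2.2 T M k}

lemma measurable_sources (a : ℝ) : Measurable fun z : Base => points a z.1 :=
  (measurable_points a).comp measurable_fst

lemma measurable_sinks (b : ℝ) : Measurable fun z : Base => points b z.2.1 :=
  (measurable_points b).comp (measurable_fst.comp measurable_snd)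

lemma measurable_weights : Measurable fun z : Base => z.2.2 := measurable_snd.comp measurable_snd

lemma measurable_lptBase (a b : ℝ) (T M : ℕ) : Measurable (lptBase a b T M) :=
  measurable_lpt (measurable_sources a) (measurable_sinks b) measurable_weights T M

lemma measurableSet_exitSet (a b : ℝ) (T M k : ℕ) : MeasurableSet (exitSet a b T M k) :=
  measurableSet_exitAfter (measurable_sources a) (measurable_sinks b) measurable_weights T M k

/-- The outgoing edges of the rectangle with `T` rows and `M` columns, completed by the boundary
points outside of the rectangle. -/
def outgoing (a b : ℝ) (T M : ℕ) (z : Base) : (ℕ → Bool) × (ℕ → Bool) :=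
  run (cells T M) z.2.2 (points a z.1, points b z.2.1)

/-- Burke's theorem: the outgoing edges are independent Bernoulli variables. -/
lemma Balanced.measurePreserving_outgoing {a b p : ℝ} (h : Balanced a b p) (T M : ℕ) :
    MeasurePreserving (outgoing a b T M) (base p) ((berSeq ℕ a).prod (berSeq ℕ b)) := by
  have m0 : Measurable (outgoing a b T M) :=
    Measurable.run _ measurable_weights ((measurable_sources a).prodMk (measurable_sinks b))
  refine ⟨m0, Measure.ext_of_lintegral _ fun F hF => ?_⟩
  have m1 : Measurable fun q : ((ℕ → Bool) × (ℕ → Bool)) × (ℕ × ℕ → Bool) =>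
      F (run (cells T M) q.2 q.1) := hF.comp (Measurable.run _ measurable_snd measurable_fst)
  have h1 : MeasurePreserving (fun z : Base => ((points a z.1, points b z.2.1), z.2.2)) (base p)
      (((berSeq ℕ a).prod (berSeq ℕ b)).prod (berSeq (ℕ × ℕ) p)) :=
    ((measurePreserving_prodAssoc _ _ _).symm MeasurableEquiv.prodAssoc).comp
      ((measurePreserving_points a).prod ((measurePreserving_points b).prod
        (MeasurePreserving.id _)))
  rw [lintegral_map hF m0, ← h.lintegral_run (nodup_cells T M) hF,
    show (fun z => F (outgoing a b T M z)) = fun z : Base =>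
      (fun q : ((ℕ → Bool) × (ℕ → Bool)) × (ℕ × ℕ → Bool) => F (run (cells T M) q.2 q.1))
        ((points a z.1, points b z.2.1), z.2.2) from rfl,
    h1.lintegral_comp m1, lintegral_prod_symm _ m1.aemeasurable]

lemma count_outgoing_fst (a b : ℝ) (T M : ℕ) (z : Base) {m : ℕ} (hm : m ≤ M) :
    count (outgoing a b T M z).1 m
      = count (hor (points a z.1) (points b z.2.1) z.2.2 T) m := by
  rw [outgoing, run_cells]
  exact count_congr fun i hi => by simp [hi.trans_le hm]

lemma count_outgoing_snd (a b : ℝ) (T M : ℕ) (z : Base) :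
    count (outgoing a b T M z).2 T
      = count (fun j => ver (points a z.1) (points b z.2.1) z.2.2 j M) T := by
  rw [outgoing, run_cells]
  exact count_congr fun i hi => by simp [hi]

lemma lptBase_eq_sinks_add (a b : ℝ) (T M : ℕ) (z : Base) :
    lptBase a b T M z = count (points b z.2.1) T + count (outgoing a b T M z).1 M := by
  rw [count_outgoing_fst _ _ _ _ _ le_rfl]; rfl

lemma lptBase_eq_sources_add (a b : ℝ) (T M : ℕ) (z : Base) :
    lptBase a b T M z = count (points a z.1) M + count (outgoing a b T M z).2 T := by
  rw [count_outgoing_snd]; exact lpt_eq_count_add _ _ _ _ _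

/-! ### Moments of counts -/

lemma hasLaw_apply_berSeq (a : ℝ) (i : ℕ) : HasLaw (fun x : ℕ → Bool => x i) (ber a) (berSeq ℕ a) :=
  (measurePreserving_eval_infinitePi (fun _ => ber a) i).hasLaw

lemma memLp_toNat {α : Type*} [MeasurableSpace α] {μ : Measure α} [IsFiniteMeasure μ]
    {f : α → Bool} (hf : Measurable f) (q : ℝ≥0∞) :
    MemLp (fun z => ((f z).toNat : ℝ)) q μ := by
  refine MemLp.of_bound ((Measurable.of_discrete (f := fun b : Bool => (b.toNat : ℝ))).comp
    hf).aestronglyMeasurable 1 (ae_of_all _ fun z => ?_)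
  cases f z <;> simp

lemma memLp_of_nat_le {α : Type*} [MeasurableSpace α] {μ : Measure α} [IsFiniteMeasure μ]
    {f : α → ℕ} (hf : Measurable f) {n : ℕ} (h : ∀ z, f z ≤ n) (q : ℝ≥0∞) :
    MemLp (fun z => (f z : ℝ)) q μ := by
  refine MemLp.of_bound ((Measurable.of_discrete (f := fun m : ℕ => (m : ℝ))).comp
    hf).aestronglyMeasurable n (ae_of_all _ fun z => ?_)
  simpa using h z

lemma iIndepFun_berSeq (a : ℝ) : iIndepFun (fun i (x : ℕ → Bool) => x i) (berSeq ℕ a) :=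
  iIndepFun_infinitePi (X := fun _ b => b) fun _ => measurable_id

lemma integral_toNat_berSeq {a : ℝ} (h0 : 0 ≤ a) (h1 : a ≤ 1) (i : ℕ) :
    ∫ x, ((x i).toNat : ℝ) ∂(berSeq ℕ a) = a := by
  have h := (hasLaw_apply_berSeq a i).integral_comp (f := fun b : Bool => (b.toNat : ℝ))
    .of_discrete
  simp only [Function.comp_def] at h
  rw [h, integral_ber h0 h1]
  simp

lemma variance_toNat_berSeq {a : ℝ} (h0 : 0 ≤ a) (h1 : a ≤ 1) (i : ℕ) :
    Var[fun x => ((x i).toNat : ℝ); berSeq ℕ a] = a * (1 - a) := by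
  rw [variance_eq_sub (memLp_toNat (measurable_pi_apply i) 2), integral_toNat_berSeq h0 h1]
  have : ((fun x : ℕ → Bool => ((x i).toNat : ℝ)) ^ 2) = fun x => ((x i).toNat : ℝ) := by
    funext x; simp only [Pi.pow_apply]; cases x i <;> simp
  rw [this, integral_toNat_berSeq h0 h1]; ring

lemma integral_count_berSeq {a : ℝ} (h0 : 0 ≤ a) (h1 : a ≤ 1) (n : ℕ) :
    ∫ x, (count x n : ℝ) ∂(berSeq ℕ a) = n * a := by
  simp only [count, Nat.cast_sum]
  rw [integral_finsetSum _ fun i _ =>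
    (memLp_toNat (measurable_pi_apply i) 1).integrable le_rfl]
  simp [integral_toNat_berSeq h0 h1]

lemma variance_count_berSeq {a : ℝ} (h0 : 0 ≤ a) (h1 : a ≤ 1) (n : ℕ) :
    Var[fun x => (count x n : ℝ); berSeq ℕ a] = n * (a * (1 - a)) := by
  have : (fun x : ℕ → Bool => (count x n : ℝ))
      = ∑ i ∈ Finset.range n, fun x : ℕ → Bool => ((x i).toNat : ℝ) := by
    funext x; simp [count]
  rw [this, IndepFun.variance_sum (fun i _ => memLp_toNat (measurable_pi_apply i) 2)
    fun i _ j _ hij => ((iIndepFun_berSeq a).indepFun hij).comp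
      (φ := fun b : Bool => (b.toNat : ℝ)) (ψ := fun b : Bool => (b.toNat : ℝ))
      .of_discrete .of_discrete]
  simp [variance_toNat_berSeq h0 h1]
/-! ### The variance of the last-passage time -/

section Variance

variable {a b p : ℝ}

lemma memLp_sources (a p : ℝ) (M : ℕ) :
    MemLp (fun z : Base => (count (points a z.1) M : ℝ)) 2 (base p) :=
  memLp_of_nat_le (measurable_count (fun i => (measurable_pi_apply i).comp
    (measurable_sources a)) M) (fun _ => count_le _ _) 2

lemma memLp_sinks (b p : ℝ) (T : ℕ) :
    MemLp (fun z : Base => (count (points b z.2.1) T : ℝ)) 2 (base p) :=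
  memLp_of_nat_le (measurable_count (fun i => (measurable_pi_apply i).comp
    (measurable_sinks b)) T) (fun _ => count_le _ _) 2

lemma lptBase_le (a b : ℝ) (T M : ℕ) (z : Base) : lptBase a b T M z ≤ T + M :=
  Nat.add_le_add (count_le _ _) (count_le _ _)

lemma memLp_lptBase (a b p : ℝ) (T M : ℕ) :
    MemLp (fun z : Base => (lptBase a b T M z : ℝ)) 2 (base p) :=
  memLp_of_nat_le (measurable_lptBase a b T M) (lptBase_le a b T M) 2

lemma hasLaw_sources (a p : ℝ) : HasLaw (fun z : Base => points a z.1) (berSeq ℕ a) (base p) :=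
  ((measurePreserving_points a).comp measurePreserving_fst).hasLaw

lemma hasLaw_sinks (b p : ℝ) : HasLaw (fun z : Base => points b z.2.1) (berSeq ℕ b) (base p) :=
  ((measurePreserving_points b).comp (measurePreserving_fst.comp measurePreserving_snd)).hasLaw

lemma measurable_count_id (n : ℕ) : Measurable fun x : ℕ → Bool => (count x n : ℝ) :=
  (Measurable.of_discrete (f := fun m : ℕ => (m : ℝ))).comp
    (measurable_count (fun i => measurable_pi_apply i) n)

lemma variance_count_of_hasLaw {α : Type*} [MeasurableSpace α] {μ : Measure α}
    {X : α → ℕ → Bool} (hX : HasLaw X (berSeq ℕ a) μ) (h0 : 0 ≤ a) (h1 : a ≤ 1) (n : ℕ) :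
    Var[fun z => (count (X z) n : ℝ); μ] = n * (a * (1 - a)) := by
  have : IsProbabilityMeasure μ := hX.isProbabilityMeasure
  rw [← variance_count_berSeq h0 h1 n, ← covariance_self, ← covariance_self]
  · exact hX.covariance_comp (measurable_count_id n).aemeasurable
      (measurable_count_id n).aemeasurable
  · exact (measurable_count_id n).aemeasurable
  · exact (measurable_count_id n).comp_aemeasurable hX.aemeasurable

lemma integral_count_of_hasLaw {α : Type*} [MeasurableSpace α] {μ : Measure α}
    {X : α → ℕ → Bool} (hX : HasLaw X (berSeq ℕ a) μ) (h0 : 0 ≤ a) (h1 : a ≤ 1) (n : ℕ) :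
    ∫ z, (count (X z) n : ℝ) ∂μ = n * a := by
  rw [← integral_count_berSeq h0 h1 n]
  exact hX.integral_comp (measurable_count_id n).aestronglyMeasurable

lemma Balanced.hasLaw_top (h : Balanced a b p) (T M : ℕ) :
    HasLaw (fun z => (outgoing a b T M z).1) (berSeq ℕ a) (base p) :=
  (measurePreserving_fst.comp (h.measurePreserving_outgoing T M)).hasLaw

lemma Balanced.integral_lptBase (h : Balanced a b p) (T M : ℕ) :
    ∫ z, (lptBase a b T M z : ℝ) ∂(base p) = T * b + M * a := by
  simp only [lptBase_eq_sinks_add, Nat.cast_add]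
  rw [integral_add, integral_count_of_hasLaw (hasLaw_sinks b p) h.b_nonneg h.b_le,
    integral_count_of_hasLaw (h.hasLaw_top T M) h.a_nonneg h.a_le]
  · exact (memLp_sinks b p T).integrable (by norm_num)
  · exact (memLp_of_nat_le (measurable_count (fun i => (measurable_pi_apply i).comp
      (h.measurePreserving_outgoing T M).measurable.fst) M)
      (fun _ => count_le _ _) 2).integrable (by norm_num)

/-- With `S`, `W`, `N`, `E` the counts on the lower, left, upper and right sides, the time is `W + N
= S + E`, where `S` is independent of `W` and, by Burke, `N` of `E`. Hence the covariance of `W` and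
`N` is that of `S` and `N` minus the variance of `N`, and the covariance of `S` and `N` is that of
`S` and the time. -/
lemma Balanced.variance_lptBase (h : Balanced a b p) (T M : ℕ) :
    Var[fun z => (lptBase a b T M z : ℝ); base p] = T * (b * (1 - b)) - M * (a * (1 - a))
      + 2 * cov[fun z => (count (points a z.1) M : ℝ), fun z => (lptBase a b T M z : ℝ);
        base p] := by
  have hout := h.measurePreserving_outgoing T M
  set S : Base → ℝ := fun z => (count (points a z.1) M : ℝ) with hS
  set W : Base → ℝ := fun z => (count (points b z.2.1) T : ℝ) with hW
  set N : Base → ℝ := fun z => (count (outgoing a b T M z).1 M : ℝ) with hN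
  set E : Base → ℝ := fun z => (count (outgoing a b T M z).2 T : ℝ) with hE
  have mS : MemLp S 2 (base p) := memLp_sources a p M
  have mW : MemLp W 2 (base p) := memLp_sinks b p T
  have mN : MemLp N 2 (base p) := memLp_of_nat_le (measurable_count
    (fun i => (measurable_pi_apply i).comp hout.measurable.fst) M) (fun _ => count_le _ _) 2
  have mE : MemLp E 2 (base p) := memLp_of_nat_le (measurable_count
    (fun i => (measurable_pi_apply i).comp hout.measurable.snd) T) (fun _ => count_le _ _) 2
  have hL : (fun z => (lptBase a b T M z : ℝ)) = W + N := by
    funext z; simp [hW, hN, lptBase_eq_sinks_add]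
  have hWN : W + N = S + E := by
    rw [← hL]; funext z; simp [hS, hE, lptBase_eq_sources_add]
  have iSW : cov[S, W; base p] = 0 := by
    refine IndepFun.covariance_eq_zero ?_ mS mW
    exact indepFun_prod (X := fun u : ℕ → ℝ => (count (points a u) M : ℝ))
      (Y := fun z : (ℕ → ℝ) × (ℕ × ℕ → Bool) => (count (points b z.1) T : ℝ))
      ((measurable_count_id M).comp (measurable_points a))
      ((measurable_count_id T).comp ((measurable_points b).comp measurable_fst))
  have iNE : cov[E, N; base p] = 0 := by
    have h1 : IndepFun (fun q : (ℕ → Bool) × (ℕ → Bool) => (count q.2 T : ℝ))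
        (fun q => (count q.1 M : ℝ)) ((berSeq ℕ a).prod (berSeq ℕ b)) :=
      (indepFun_prod (measurable_count_id M) (measurable_count_id T)).symm
    have h2 : cov[E, N; base p] = _ := hout.hasLaw.covariance_comp
      (f := fun q : (ℕ → Bool) × (ℕ → Bool) => (count q.2 T : ℝ))
      (g := fun q : (ℕ → Bool) × (ℕ → Bool) => (count q.1 M : ℝ))
      ((measurable_count_id T).comp measurable_snd).aemeasurable
      ((measurable_count_id M).comp measurable_fst).aemeasurable
    rw [h2]
    refine h1.covariance_eq_zero ?_ ?_
    · exact memLp_of_nat_le (measurable_count (fun i => (measurable_pi_apply i).comp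
        measurable_snd) T) (fun _ => count_le _ _) 2
    · exact memLp_of_nat_le (measurable_count (fun i => (measurable_pi_apply i).comp
        measurable_fst) M) (fun _ => count_le _ _) 2
  have vW : Var[W; base p] = T * (b * (1 - b)) :=
    variance_count_of_hasLaw (hasLaw_sinks b p) h.b_nonneg h.b_le T
  have vN : Var[N; base p] = M * (a * (1 - a)) :=
    variance_count_of_hasLaw (h.hasLaw_top T M) h.a_nonneg h.a_le M
  have e1 : cov[W + N, N; base p] = cov[S + E, N; base p] := by rw [hWN]
  rw [covariance_add_left mW mN mN, covariance_add_left mS mE mN, iNE,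
    covariance_self mN.aemeasurable, vN] at e1
  rw [hL, variance_add mW mN, covariance_add_right mS mW mN, iSW, vW, vN]
  linarith

lemma points_update (a : ℝ) (u : ℕ → ℝ) (k : ℕ) (x : ℝ) :
    points a (Function.update u k x) = Function.update (points a u) k (belowLevel a x) := by
  funext i
  by_cases hi : i = k
  · subst hi; simp [points]
  · simp [points, hi]

/-- The covariance of a source with the last-passage time. -/
lemma covariance_source_le (h0 : 0 ≤ a) (h1 : a ≤ 1) (b p : ℝ) (T : ℕ) {M k : ℕ} (hk : k < M) :
    cov[fun z => ((points a z.1 k).toNat : ℝ), fun z => (lptBase a b T M z : ℝ); base p]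
      ≤ a * (1 - a) * (base p).real (exitSet a b T M k) := by
  have mI : MemLp (fun z : Base => ((points a z.1 k).toNat : ℝ)) 2 (base p) :=
    memLp_toNat ((measurable_pi_apply k).comp (measurable_sources a)) 2
  have mL := memLp_lptBase a b p T M
  have hI : ∫ z : Base, ((points a z.1 k).toNat : ℝ) ∂(base p) = a := by
    exact ((hasLaw_sources a p).integral_comp (f := fun x : ℕ → Bool => ((x k).toNat : ℝ))
      (memLp_toNat (measurable_pi_apply k) 1).aestronglyMeasurable).trans
      (integral_toNat_berSeq h0 h1 k)
  rw [covariance_eq_sub mI mL, hI]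
  have iIL : Integrable (fun z : Base => ((points a z.1 k).toNat : ℝ) * (lptBase a b T M z : ℝ))
      (base p) := mI.integrable_mul mL
  have iL : Integrable (fun z : Base => (lptBase a b T M z : ℝ)) (base p) :=
    mL.integrable (by norm_num)
  have e1 : ∫ z : Base, ((fun z : Base => ((points a z.1 k).toNat : ℝ)) *
      fun z => (lptBase a b T M z : ℝ)) z ∂(base p) - a * ∫ z, (lptBase a b T M z : ℝ) ∂(base p)
      = ∫ z : Base, (((points a z.1 k).toNat : ℝ) - a) * (lptBase a b T M z : ℝ) ∂(base p) := by
    rw [← integral_const_mul]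
    refine (integral_sub iIL (iL.const_mul a)).symm.trans ?_
    refine integral_congr_ae (ae_of_all _ fun z => ?_)
    ring
  -- The level of source `k` is resampled, so that it can be integrated out with everything else
  -- fixed.
  have hup : MeasurePreserving (fun q : Base × ℝ => ((Function.update q.1.1 k q.2, q.1.2) : Base))
      ((base p).prod unif) (base p) := by
    have e : MeasurePreserving (fun q : Base × ℝ => (((q.1.1, q.2), q.1.2) :
        ((ℕ → ℝ) × ℝ) × ((ℕ → ℝ) × (ℕ × ℕ → Bool))))
        ((base p).prod unif) ((unifSeq.prod unif).prod (unifSeq.prod (berSeq (ℕ × ℕ) p))) := by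
      have s1 := measurePreserving_prodAssoc unifSeq (unifSeq.prod (berSeq (ℕ × ℕ) p)) unif
      have s2 := (MeasurePreserving.id unifSeq).prod (Measure.measurePreserving_swap
        (μ := unifSeq.prod (berSeq (ℕ × ℕ) p)) (ν := unif))
      have s3 := (measurePreserving_prodAssoc unifSeq unif
        (unifSeq.prod (berSeq (ℕ × ℕ) p))).symm MeasurableEquiv.prodAssoc
      exact s3.comp (s2.comp s1)
    exact ((measurePreserving_update_infinitePi unif k).prod
      (MeasurePreserving.id (unifSeq.prod (berSeq (ℕ × ℕ) p)))).comp e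
  have iG : Integrable (fun z : Base => (((points a z.1 k).toNat : ℝ) - a) *
      (lptBase a b T M z : ℝ)) (base p) := by
    refine (iIL.sub (iL.const_mul a)).congr (ae_of_all _ fun z => ?_)
    simp only [Pi.sub_apply]; ring
  -- The inner integral is `a * (1 - a)` times the effect of switching source `k` on, which is `0`
  -- or `1`, and is `0` off the exit event by `lpt_update_source`.
  have hin : ∀ z : Base, ∫ u, (((points a (Function.update z.1 k u) k).toNat : ℝ) - a) *
      (lptBase a b T M (Function.update z.1 k u, z.2) : ℝ) ∂unif
      ≤ (exitSet a b T M k).indicator (fun _ => a * (1 - a)) z := by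
    intro z
    have h2 : ∫ u, (((points a (Function.update z.1 k u) k).toNat : ℝ) - a) *
        (lptBase a b T M (Function.update z.1 k u, z.2) : ℝ) ∂unif
        = ∫ c : Bool, ((c.toNat : ℝ) - a) *
          (lpt (Function.update (points a z.1) k c) (points b z.2.1) z.2.2 T M : ℝ) ∂(ber a) := by
      rw [ber, integral_map (measurable_belowLevel a).aemeasurable .of_discrete]
      simp only [lptBase, points_update, Function.update_self]
    rw [h2, integral_ber h0 h1]
    obtain ⟨l1, l2, l3⟩ := lpt_update_source (points a z.1) (points b z.2.1) z.2.2 T hk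
    have ha : 0 ≤ a * (1 - a) := mul_nonneg h0 (by linarith)
    simp only [Bool.toNat_true, Bool.toNat_false, smul_eq_mul, Nat.cast_one, Nat.cast_zero]
    by_cases hz : z ∈ exitSet a b T M k
    · rw [indicator_of_mem hz]
      have l2' : (lpt (Function.update (points a z.1) k true) (points b z.2.1) z.2.2 T M : ℝ)
        ≤ lpt (Function.update (points a z.1) k false) (points b z.2.1) z.2.2 T M + 1 := by
        exact_mod_cast l2
      nlinarith [mul_le_mul_of_nonneg_left l2' ha]
    · rw [indicator_of_notMem hz, le_antisymm (not_lt.1 fun hlt => hz (l3 hlt)) l1]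
      exact le_of_eq (by ring)
  rw [e1, ← hup.hasLaw.integral_comp iG.aestronglyMeasurable,
    integral_prod _ (hup.integrable_comp_of_integrable iG)]
  refine (integral_mono (hup.integrable_comp_of_integrable iG).integral_prod_left
    ((integrable_const _).indicator (measurableSet_exitSet a b T M k)) hin).trans (le_of_eq ?_)
  rw [integral_indicator_const _ (measurableSet_exitSet a b T M k), smul_eq_mul, mul_comm]

/-- The expected number of columns such that some best path exits after them. -/
def meanExit (p a b : ℝ) (T M : ℕ) : ℝ :=
  ∑ k ∈ Finset.range M, (base p).real (exitSet a b T M k)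

lemma meanExit_nonneg (p a b : ℝ) (T M : ℕ) : 0 ≤ meanExit p a b T M :=
  Finset.sum_nonneg fun _ _ => measureReal_nonneg

/-- All densities are read off the same levels, so the exit events are nested. -/
lemma meanExit_mono {p a a' b b' : ℝ} (ha : a ≤ a') (hb : b' ≤ b) (T M : ℕ) :
    meanExit p a b T M ≤ meanExit p a' b' T M :=
  Finset.sum_le_sum fun _ _ => measureReal_mono fun z hz =>
    ExitAfter.mono hz (points_mono ha z.1) (points_mono hb z.2.1)

/-- Summing the covariances of the individual sources with the last-passage time produces the mean
exit point. -/
lemma Balanced.variance_le (h : Balanced a b p) (T M : ℕ) :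
    Var[fun z => (lptBase a b T M z : ℝ); base p] ≤ T * (b * (1 - b)) - M * (a * (1 - a))
      + 2 * (a * (1 - a)) * meanExit p a b T M := by
  rw [h.variance_lptBase T M]
  have e : (fun z : Base => (count (points a z.1) M : ℝ))
      = fun z => ∑ k ∈ Finset.range M, ((points a z.1 k).toNat : ℝ) := by
    funext z; simp [count]
  have hI : ∀ k, MemLp (fun z : Base => ((points a z.1 k).toNat : ℝ)) 2 (base p) := fun k =>
    memLp_toNat (f := fun z : Base => points a z.1 k)
      ((measurable_pi_apply k).comp (measurable_sources a)) 2
  rw [e, covariance_fun_sum_left' (fun k _ => hI k) (memLp_lptBase a b p T M)]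
  have hs := Finset.sum_le_sum (s := Finset.range M) fun k hk =>
    covariance_source_le h.a_nonneg h.a_le b p T (Finset.mem_range.1 hk)
  rw [← Finset.mul_sum, ← meanExit] at hs
  linarith

/-! ### Symmetry between sources and sinks. -/

/-- Exchanging the roles of rows and columns. -/
def transposeBase (z : Base) : Base := (z.2.1, z.1, fun c => z.2.2 c.swap)

lemma measurePreserving_transposeBase (p : ℝ) :
    MeasurePreserving transposeBase (base p) (base p) := by
  have h1 : MeasurePreserving (fun (w : ℕ × ℕ → Bool) (c : ℕ × ℕ) => w c.swap)
      (berSeq (ℕ × ℕ) p) (berSeq (ℕ × ℕ) p) := by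
    have hm : Measurable (fun (w : ℕ × ℕ → Bool) (c : ℕ × ℕ) => w c.swap) :=
      measurable_pi_iff.2 fun c => measurable_pi_apply _
    refine ⟨hm, ?_⟩
    have hf : (fun (w : ℕ × ℕ → Bool) (c : ℕ × ℕ) => w c.swap)
        = MeasurableEquiv.piCongrLeft (fun _ => Bool) (Equiv.prodComm ℕ ℕ) := by
      funext w c; rfl
    rw [hf]
    exact Measure.infinitePi_map_piCongrLeft (fun _ : ℕ × ℕ => ber p) (Equiv.prodComm ℕ ℕ)
  have e : MeasurePreserving (fun z : Base => ((z.2.1, z.1, z.2.2) : Base)) (base p) (base p) := by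
    have s1 := (measurePreserving_prodAssoc unifSeq unifSeq (berSeq (ℕ × ℕ) p))
    have s2 := (Measure.measurePreserving_swap (μ := unifSeq) (ν := unifSeq)).prod
      (MeasurePreserving.id (berSeq (ℕ × ℕ) p))
    have s3 := (measurePreserving_prodAssoc unifSeq unifSeq (berSeq (ℕ × ℕ) p)).symm
      MeasurableEquiv.prodAssoc
    exact s1.comp (s2.comp s3)
  exact ((MeasurePreserving.id unifSeq).prod ((MeasurePreserving.id unifSeq).prod h1)).comp e

lemma lptBase_transpose (a b : ℝ) (T M : ℕ) (z : Base) :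
    lptBase b a M T (transposeBase z) = lptBase a b T M z :=
  lpt_transpose _ _ _ _ _

lemma Balanced.symm (h : Balanced a b p) : Balanced b a p :=
  ⟨h.b_nonneg, h.b_le, h.a_nonneg, h.a_le, h.p_nonneg, h.p_le, by linarith [h.balance]⟩

lemma variance_lptBase_transpose (a b p : ℝ) (T M : ℕ) :
    Var[fun z => (lptBase b a M T z : ℝ); base p] = Var[fun z => (lptBase a b T M z : ℝ); base p] :=
    by
  have m1 : AEMeasurable (fun z => (lptBase b a M T z : ℝ)) (base p) :=
    (memLp_lptBase b a p M T).aemeasurable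
  have m2 : AEMeasurable (fun z => (lptBase a b T M z : ℝ)) (base p) :=
    (memLp_lptBase a b p T M).aemeasurable
  rw [← covariance_self m1, ← covariance_self m2,
    ← (measurePreserving_transposeBase p).hasLaw.covariance_comp m1 m1]
  simp only [Function.comp_def, lptBase_transpose]

/-- The mirror image of `Balanced.variance_le`: the same variance is controlled by exits through the
sinks. Having both versions is what closes the bootstrap. -/
lemma Balanced.variance_le' (h : Balanced a b p) (T M : ℕ) :
    Var[fun z => (lptBase a b T M z : ℝ); base p] ≤ M * (a * (1 - a)) - T * (b * (1 - b))
      + 2 * (b * (1 - b)) * meanExit p b a M T := by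
  rw [← variance_lptBase_transpose]
  exact h.symm.variance_le M T

end Variance
/-! ### Exit probabilities -/

lemma measureReal_ge_le_variance {α : Type*} [MeasurableSpace α] {μ : Measure α}
    [IsProbabilityMeasure μ] {X : α → ℝ} (hX : MemLp X 2 μ) {c d m : ℝ} (hd : 0 < d)
    (hm : ∫ z, X z ∂μ ≤ m) (hc : m + d ≤ c) : μ.real {z | c ≤ X z} ≤ Var[X; μ] / d ^ 2 := by
  have h := meas_ge_le_variance_div_sq hX hd
  refine ENNReal.toReal_le_of_le_ofReal (div_nonneg (variance_nonneg _ _) (sq_nonneg _))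
    ((measure_mono fun z hz => ?_).trans h)
  simp only [mem_ofPred_eq] at hz ⊢
  exact le_trans (by linarith) (le_abs_self _)

lemma variance_sub_le {α : Type*} [MeasurableSpace α] {μ : Measure α} [IsProbabilityMeasure μ]
    {X Y : α → ℝ} (hX : MemLp X 2 μ) (hY : MemLp Y 2 μ) :
    Var[X - Y; μ] ≤ 2 * (Var[X; μ] + Var[Y; μ]) := by
  have h1 := variance_add hX hY
  have h2 := variance_sub hX hY
  have h3 := variance_nonneg (X + Y) μ
  linarith

section Exit

variable {a b a' b' p : ℝ}

lemma iIndepFun_unifSeq : iIndepFun (fun (i : ℕ) (u : ℕ → ℝ) => u i) unifSeq :=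
  iIndepFun_infinitePi (X := fun _ x => x) fun _ => measurable_id

/-- Extra sources obtained by raising the density. -/
lemma measureReal_count_sub_le (h0 : 0 ≤ a) (h : a < a') (h1 : a' ≤ 1) (p : ℝ) {k : ℕ}
    (hk : 0 < k) :
    (base p).real {z | (count (points a' z.1) k : ℝ) - count (points a z.1) k ≤ (a' - a) * k / 2}
      ≤ 4 / ((a' - a) * k) := by
  set X : ℕ → (ℕ → ℝ) → ℝ := fun i u =>
    ((belowLevel a' (u i)).toNat : ℝ) - ((belowLevel a (u i)).toNat : ℝ) with hX
  set Y : (ℕ → ℝ) → ℝ := fun u => (count (points a' u) k : ℝ) - count (points a u) k with hY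
  have hYX : Y = ∑ i ∈ Finset.range k, X i := by
    funext u; simp [hX, hY, count, points, Finset.sum_sub_distrib]
  have m1 : ∀ c i, MemLp (fun u : ℕ → ℝ => ((belowLevel c (u i)).toNat : ℝ)) 2 unifSeq :=
    fun c i => memLp_toNat (f := fun u : ℕ → ℝ => belowLevel c (u i))
      ((measurable_belowLevel c).comp (measurable_pi_apply i)) 2
  have mX : ∀ i, MemLp (X i) 2 unifSeq := fun i => (m1 a' i).sub (m1 a i)
  have e1 : ∀ c i, 0 ≤ c → c ≤ 1 →
      ∫ u : ℕ → ℝ, ((belowLevel c (u i)).toNat : ℝ) ∂unifSeq = c := fun c i c0 c1 =>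
    ((measurePreserving_points c).hasLaw.integral_comp
      (f := fun x : ℕ → Bool => ((x i).toNat : ℝ))
      (memLp_toNat (measurable_pi_apply i) 1).aestronglyMeasurable).trans
      (integral_toNat_berSeq c0 c1 i)
  have eX : ∀ i, ∫ u, X i u ∂unifSeq = a' - a := fun i => by
    rw [hX, integral_sub ((m1 a' i).integrable (by norm_num)) ((m1 a i).integrable (by norm_num)),
      e1 a' i (h0.trans h.le) h1, e1 a i h0 (h.le.trans h1)]
  have hmono : ∀ x, (belowLevel a x).toNat ≤ (belowLevel a' x).toNat := fun x =>
    Bool.toNat_le_toNat (belowLevel_mono h.le x)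
  -- Under the coupling each difference is `0` or `1`, so its variance is at most its mean.
  have sqX : ∀ i u, X i u ^ 2 = X i u := fun i u => by
    have := hmono (u i)
    simp only [hX]
    generalize belowLevel a (u i) = c at *
    generalize belowLevel a' (u i) = c' at *
    cases c <;> cases c' <;> simp_all
  have vX : ∀ i, Var[X i; unifSeq] ≤ a' - a := fun i => by
    rw [variance_eq_sub (mX i), show (X i) ^ 2 = X i from funext (sqX i), eX]
    nlinarith [sq_nonneg (a' - a)]
  have eY : ∫ u, Y u ∂unifSeq = (a' - a) * k := by
    rw [hYX]
    simp only [Finset.sum_apply]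
    rw [integral_finsetSum _ fun i _ => (mX i).integrable (by norm_num)]
    simp only [eX, Finset.sum_const, Finset.card_range, nsmul_eq_mul]; ring
  have mY : MemLp Y 2 unifSeq := by rw [hYX]; exact memLp_finsetSum' _ fun i _ => mX i
  have vY : Var[Y; unifSeq] ≤ (a' - a) * k := by
    rw [hYX, IndepFun.variance_sum (fun i _ => mX i) fun i _ j _ hij =>
      (iIndepFun_unifSeq.indepFun hij).comp
        (φ := fun x => ((belowLevel a' x).toNat : ℝ) - ((belowLevel a x).toNat : ℝ))
        (ψ := fun x => ((belowLevel a' x).toNat : ℝ) - ((belowLevel a x).toNat : ℝ)) ?_ ?_]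
    · refine (Finset.sum_le_sum fun i _ => vX i).trans (le_of_eq ?_)
      rw [Finset.sum_const, Finset.card_range, nsmul_eq_mul]; ring
    all_goals
      exact ((Measurable.of_discrete (f := fun c : Bool => (c.toNat : ℝ))).comp
        (measurable_belowLevel a')).sub
        ((Measurable.of_discrete (f := fun c : Bool => (c.toNat : ℝ))).comp (measurable_belowLevel a))
  have hpos : 0 < (a' - a) * k := mul_pos (by linarith) (by exact_mod_cast hk)
  have hmp : MeasurePreserving (Prod.fst : Base → ℕ → ℝ) (base p) unifSeq := measurePreserving_fst
  have key := measureReal_ge_le_variance (μ := unifSeq) mY.neg (c := -((a' - a) * k / 2))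
    (d := (a' - a) * k / 2) (m := -((a' - a) * k)) (by linarith)
    (by simp only [Pi.neg_apply]; rw [integral_neg, eY]) (by linarith)
  have hset : {z : Base | (count (points a' z.1) k : ℝ) - count (points a z.1) k ≤ (a' - a) * k / 2}
      = Prod.fst ⁻¹' {u | -((a' - a) * k / 2) ≤ (-Y) u} := by
    ext z
    simp only [hY, mem_preimage, mem_ofPred_eq, Pi.neg_apply, neg_le_neg_iff]
  have hms : MeasurableSet {u : ℕ → ℝ | -((a' - a) * k / 2) ≤ (-Y) u} := by
    refine measurableSet_le measurable_const ?_
    exact (((measurable_count_id k).comp (measurable_points a')).sub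
      ((measurable_count_id k).comp (measurable_points a))).neg
  rw [hset, hmp.measureReal_preimage hms.nullMeasurableSet]
  refine key.trans ?_
  rw [variance_neg]
  rw [div_le_div_iff₀ (by positivity) hpos]
  nlinarith

/-- The exit probability in terms of the fluctuations at two densities. -/
lemma exit_le_of_mean_le (h : Balanced a b p) (h' : Balanced a' b' p) (ha : a < a')
    {T M k : ℕ} (hk : 0 < k) (hkM : k ≤ M)
    (hmean : (T * b' + M * a') - (T * b + M * a) ≤ (a' - a) * k / 4) :
    (base p).real (exitSet a b T M k) ≤ 4 / ((a' - a) * k)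
      + 32 * (Var[fun z => (lptBase a b T M z : ℝ); base p]
        + Var[fun z => (lptBase a' b' T M z : ℝ); base p]) / ((a' - a) * k) ^ 2 := by
  have hpos : 0 < (a' - a) * k := mul_pos (by linarith) (by exact_mod_cast hk)
  have mL := memLp_lptBase a b p T M
  have mL' := memLp_lptBase a' b' p T M
  -- On the exit event the time grows by at least the number of new sources before `k`, typically
  -- `(a' - a) * k`. Either there are fewer than half as many, or the growth exceeds its mean by at
  -- least a quarter of that amount.
  have hsub : exitSet a b T M k ⊆
      {z | (count (points a' z.1) k : ℝ) - count (points a z.1) k ≤ (a' - a) * k / 2} ∪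
      {z | (a' - a) * k / 2 ≤ ((fun z => (lptBase a' b' T M z : ℝ))
        - fun z => (lptBase a b T M z : ℝ)) z} := by
    intro z hz
    have h1 := ExitAfter.count_add_le (J' := points b' z.2.1) hz hkM (points_mono ha.le z.1)
    have h2 : (count (points a' z.1) k : ℝ) + lptBase a b T M z
        ≤ count (points a z.1) k + lptBase a' b' T M z := by exact_mod_cast h1
    by_cases hc : (count (points a' z.1) k : ℝ) - count (points a z.1) k ≤ (a' - a) * k / 2
    · exact Or.inl hc
    · refine Or.inr ?_
      simp only [mem_ofPred_eq, Pi.sub_apply]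
      linarith
  refine (measureReal_mono hsub).trans ((measureReal_union_le _ _).trans (add_le_add
    (measureReal_count_sub_le h.a_nonneg ha h'.a_le p hk) ?_))
  refine (measureReal_ge_le_variance (mL'.sub mL) (d := (a' - a) * k / 4)
    (m := (a' - a) * k / 4) (by linarith) ?_ (by linarith)).trans ?_
  · simp only [Pi.sub_apply]
    rw [integral_sub (mL'.integrable (by norm_num)) (mL.integrable (by norm_num)),
      h.integral_lptBase, h'.integral_lptBase]
    exact hmean
  -- The factor `32` is `2 * 4 ^ 2`: a `2` from the variance of a difference, a `4 ^ 2` from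
  -- Chebyshev at a quarter of `(a' - a) * k`.
  · have hv := variance_sub_le mL' mL
    rw [div_le_div_iff₀ (by positivity) (by positivity)]
    nlinarith [mul_le_mul_of_nonneg_right hv (sq_nonneg ((a' - a) * k))]

/-- The probability of an exit through the sources, when the density of sources is so low that
raising it lowers the mean. -/
lemma exit_zero_le (h : Balanced a b p) (h' : Balanced a' b' p) (ha : a ≤ a')
    {T M : ℕ} {m : ℝ} (hm : 0 < m)
    (hmean : (T * b' + M * a') - (T * b + M * a) ≤ -m) :
    (base p).real (exitSet a b T M 0) ≤ 2 * (Var[fun z => (lptBase a b T M z : ℝ); base p]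
        + Var[fun z => (lptBase a' b' T M z : ℝ); base p]) / m ^ 2 := by
  have mL := memLp_lptBase a b p T M
  have mL' := memLp_lptBase a' b' p T M
  -- A path leaving through the sources is not hurt by raising their density, so the time cannot
  -- decrease although its mean does.
  have hsub : exitSet a b T M 0 ⊆
      {z | 0 ≤ ((fun z => (lptBase a' b' T M z : ℝ)) - fun z => (lptBase a b T M z : ℝ)) z} := by
    intro z hz
    have h1 := ExitAfter.count_add_le (J' := points b' z.2.1) hz (Nat.zero_le M)
      (points_mono ha z.1)
    rw [count_zero, count_zero, zero_add, zero_add] at h1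
    have h2 : (lptBase a b T M z : ℝ) ≤ lptBase a' b' T M z := by exact_mod_cast h1
    simp only [mem_ofPred_eq, Pi.sub_apply]
    linarith
  refine (measureReal_mono hsub).trans ((measureReal_ge_le_variance (mL'.sub mL) (d := m)
    (m := -m) hm ?_ (by linarith)).trans ?_)
  · simp only [Pi.sub_apply]
    rw [integral_sub (mL'.integrable (by norm_num)) (mL.integrable (by norm_num)),
      h.integral_lptBase, h'.integral_lptBase]
    exact hmean
  · have hv := variance_sub_le mL' mL
    gcongr
    linarith

end Exit
/-! ### The stationary densities -/

/-- The density of sources with rate `l` on a lattice of mesh `r`. -/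
def dens (r l : ℝ) : ℝ := l * r / (1 + l * r)

lemma dens_inv {r l : ℝ} (hr : 0 < r) (hl : 0 < l) : dens r l⁻¹ = r / (l + r) := by
  unfold dens
  field_simp

/-- The odds of sources and sinks are `l * r` and `r / l`, and the balance equation says that their
product is the weight probability. The rate `l` thus parametrises the stationary models for the
fixed weights `r ^ 2`. -/
lemma balanced_dens {r l : ℝ} (hr : 0 < r) (hr1 : r ≤ 1) (hl : 0 < l) :
    Balanced (dens r l) (dens r l⁻¹) (r ^ 2) := by
  have h1 : 0 < 1 + l * r := by positivity
  have h2 : 0 < l + r := by positivity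
  rw [dens_inv hr hl]
  refine ⟨by unfold dens; positivity, ?_, by positivity, ?_, by positivity, by nlinarith, ?_⟩
  · rw [dens, div_le_one h1]; linarith
  · rw [div_le_one h2]; linarith
  · unfold dens
    field_simp
    ring

lemma dens_le {r l : ℝ} (hr : 0 < r) (hl : 0 < l) : dens r l ≤ l * r :=
  div_le_self (by positivity) (by nlinarith [mul_pos hl hr])

lemma dens_sub {r l l' : ℝ} (hr : 0 < r) (hl : 0 < l) (hl' : 0 < l') :
    dens r l' - dens r l = r * (l' - l) / ((1 + l * r) * (1 + l' * r)) := by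
  have h1 : 0 < 1 + l * r := by positivity
  have h1' : 0 < 1 + l' * r := by positivity
  unfold dens
  field_simp
  ring

lemma dens_mono {r l l' : ℝ} (hr : 0 < r) (hl : 0 < l) (h : l ≤ l') : dens r l ≤ dens r l' := by
  have := dens_sub hr hl (hl.trans_le h)
  have h2 : 0 ≤ r * (l' - l) / ((1 + l * r) * (1 + l' * r)) := by
    have : 0 < l' := hl.trans_le h
    have : 0 ≤ l' - l := by linarith
    positivity
  linarith

/-- The square root of the ratio of the intensities of sinks and sources. -/
def slope (r l : ℝ) : ℝ := (1 + l * r) / (l + r)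

lemma slope_sub_one {r l : ℝ} (hr : 0 < r) (hl : 0 < l) :
    slope r l - 1 = (1 - l) * (1 - r) / (l + r) := by
  have h2 : 0 < l + r := by positivity
  unfold slope
  field_simp
  ring

lemma slope_pos {r l : ℝ} (hr : 0 < r) (hl : 0 < l) : 0 < slope r l := by
  unfold slope; positivity

lemma one_sub_le_slope {r l d : ℝ} (hr : 0 < r) (hr1 : r ≤ 1) (hl : 0 < l) (hd : 0 ≤ d)
    (h : l ≤ 1 + d) : 1 - d ≤ slope r l := by
  have h2 : 0 < l + r := by positivity
  rw [slope, le_div_iff₀ h2]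
  rcases le_total l 1 with hl1 | hl1
  · nlinarith [mul_nonneg (sub_nonneg.2 hl1) (sub_nonneg.2 hr1), mul_nonneg hd h2.le]
  · have h3 : (1 - d) * (l + r) ≤ (2 - l) * (l + r) :=
      mul_le_mul_of_nonneg_right (by linarith) h2.le
    nlinarith [sq_nonneg (l - 1), mul_nonneg hr.le (sub_nonneg.2 hl1)]

/-- A change of the source density changes the sink density by the negative of it times the product
of the slopes. The mean is therefore critical in the rate on the characteristic line `x = y * slope
^ 2`. -/
lemma mean_sub {r l l' : ℝ} (hr : 0 < r) (hl : 0 < l) (hl' : 0 < l') (x y : ℝ) :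
    (y * dens r l'⁻¹ + x * dens r l') - (y * dens r l⁻¹ + x * dens r l)
      = (dens r l' - dens r l) * (x - y * (slope r l * slope r l')) := by
  have h1 : 0 < 1 + l * r := by positivity
  have h1' : 0 < 1 + l' * r := by positivity
  have h2 : 0 < l + r := by positivity
  have h2' : 0 < l' + r := by positivity
  rw [dens_inv hr hl, dens_inv hr hl', slope, slope]
  unfold dens
  field_simp
  ring

/-- The part of the variance formula that does not come from exits vanishes on the same
characteristic line. -/
lemma variance_sub_eq {r l : ℝ} (hr : 0 < r) (hl : 0 < l) (x y : ℝ) :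
    x * (dens r l * (1 - dens r l)) - y * (dens r l⁻¹ * (1 - dens r l⁻¹))
      = l / (1 + l * r) ^ 2 * (x * r - y * r * slope r l ^ 2) := by
  have h1 : 0 < 1 + l * r := by positivity
  have h2 : 0 < l + r := by positivity
  rw [dens_inv hr hl, slope]
  unfold dens
  field_simp
  ring

lemma variance_dens_le {r l : ℝ} (hr : 0 < r) (hr1 : r ≤ 1) (hl : 0 < l) (hl2 : l ≤ 2)
    (hl3 : 1 / 2 ≤ l) (T M : ℕ) {c : ℝ} (hc : 0 ≤ c)
    (h : M * r - T * r * slope r l ^ 2 ≤ c) :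
    Var[fun z => (lptBase (dens r l) (dens r l⁻¹) T M z : ℝ); base (r ^ 2)]
      ≤ 2 * c + 4 * (r * meanExit (r ^ 2) (dens r l⁻¹) (dens r l) M T) := by
  have hb := balanced_dens hr hr1 hl
  have h1 := hb.variance_le' T M
  rw [variance_sub_eq hr hl] at h1
  have h2 : l / (1 + l * r) ^ 2 * (M * r - T * r * slope r l ^ 2) ≤ 2 * c := by
    have h3 : l / (1 + l * r) ^ 2 ≤ 2 := by
      refine (div_le_self hl.le ?_).trans hl2
      nlinarith [mul_pos hl hr]
    have h4 : 0 ≤ l / (1 + l * r) ^ 2 := by positivity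
    calc _ ≤ l / (1 + l * r) ^ 2 * c := mul_le_mul_of_nonneg_left h h4
      _ ≤ 2 * c := mul_le_mul_of_nonneg_right h3 hc
  have h5 : dens r l⁻¹ * (1 - dens r l⁻¹) ≤ 2 * r := by
    have h6 : dens r l⁻¹ ≤ 2 * r := by
      refine (dens_le hr (by positivity)).trans ?_
      have : l⁻¹ ≤ 2 := by
        rw [inv_le_comm₀ hl two_pos]; linarith
      nlinarith
    nlinarith [hb.b_nonneg, hb.b_le]
  have h6 := mul_le_mul_of_nonneg_right h5 (meanExit_nonneg (r ^ 2) (dens r l⁻¹) (dens r l) M T)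
  nlinarith

/-! ### Bootstrap for the exit points near the characteristic direction. -/

/-- A rectangle and a rate which are almost characteristic. -/
structure NearCharacteristic (r n ε l : ℝ) (T M : ℕ) : Prop where
  r_pos : 0 < r
  r_le : r ≤ 1 / 10
  ε_pos : 0 < ε
  ε_le : ε ≤ 1 / 16
  large : 10 ≤ ε ^ 3 * n
  le_rows : (1 - ε) * n ≤ T * r
  rows_le : T * r ≤ (1 + ε) * n
  le_columns : (1 - ε) * n ≤ M * r
  columns_le : M * r ≤ (1 + ε) * n
  le_rate : 1 - ε ≤ l
  rate_le : l * (1 - ε) ≤ 1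

namespace NearCharacteristic

variable {r n ε l : ℝ} {T M : ℕ}

lemma rate_pos (h : NearCharacteristic r n ε l T M) : 0 < l := by linarith [h.le_rate, h.ε_le]

lemma rate_le' (h : NearCharacteristic r n ε l T M) : l ≤ 1 + 2 * ε := by
  nlinarith [h.rate_le, h.ε_le, h.ε_pos, h.rate_pos]

lemma n_pos (h : NearCharacteristic r n ε l T M) : 0 < n := by
  have := pow_pos h.ε_pos 3
  nlinarith [h.large]

lemma symm (h : NearCharacteristic r n ε l T M) : NearCharacteristic r n ε l⁻¹ M T :=
  ⟨h.r_pos, h.r_le, h.ε_pos, h.ε_le, h.large, h.le_columns, h.columns_le, h.le_rows, h.rows_le,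
    by rw [le_inv_comm₀ (by linarith [h.ε_le]) h.rate_pos, ← one_div,
      le_div_iff₀ (by linarith [h.ε_le])]; exact h.rate_le,
    by rw [inv_mul_le_iff₀ h.rate_pos]; linarith [h.le_rate]⟩

/-- Raising the rate makes exits through the sinks rarer, so the mean exit at the unperturbed rate
also bounds the variance at rate `l + θ`. This is why the version with sinks is used here. -/
lemma variance_le (h : NearCharacteristic r n ε l T M) {θ : ℝ} (hθ : 0 ≤ θ) (hθ1 : θ ≤ 1 / 2) :
    Var[fun z => (lptBase (dens r (l + θ)) (dens r (l + θ)⁻¹) T M z : ℝ); base (r ^ 2)]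
      ≤ 2 * ((6 * ε + 2 * θ) * n) + 4 * (r * meanExit (r ^ 2) (dens r l⁻¹) (dens r l) M T) := by
  have hl := h.rate_pos
  have hl' := h.rate_le'
  have hn := h.n_pos
  have he := h.ε_pos
  have he1 := h.ε_le
  have hr := h.r_pos
  have hr1 := h.r_le
  have h1 := variance_dens_le hr (by linarith) (add_pos_of_pos_of_nonneg hl hθ)
    (by linarith) (by linarith [h.le_rate]) T M (c := (6 * ε + 2 * θ) * n) (by positivity) ?_
  · refine h1.trans (add_le_add le_rfl (mul_le_mul_of_nonneg_left (mul_le_mul_of_nonneg_left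
      (meanExit_mono ?_ ?_ _ _) hr.le) (by norm_num)))
    · refine dens_mono hr (by positivity) (inv_anti₀ hl (by linarith))
    · exact dens_mono hr hl (by linarith)
  · have hs := one_sub_le_slope hr (by linarith) (add_pos_of_pos_of_nonneg hl hθ)
      (d := 2 * ε + θ) (by linarith) (by linarith)
    have hs2 : 1 - 2 * (2 * ε + θ) ≤ slope r (l + θ) ^ 2 := by nlinarith [sq_nonneg (2 * ε + θ)]
    have h2 : (1 - ε) * n * (1 - 2 * (2 * ε + θ)) ≤ T * r * slope r (l + θ) ^ 2 := by
      calc (1 - ε) * n * (1 - 2 * (2 * ε + θ)) ≤ (1 - ε) * n * slope r (l + θ) ^ 2 :=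
            mul_le_mul_of_nonneg_left hs2 (mul_nonneg (by linarith) hn.le)
        _ ≤ _ := mul_le_mul_of_nonneg_right h.le_rows (sq_nonneg _)
    have h3 := h.columns_le
    have h4 : 0 ≤ n * (ε * (2 * (2 * ε + θ))) := by positivity
    nlinarith

/-- One exit probability in the bootstrap. -/
lemma exit_le (h : NearCharacteristic r n ε l T M) {k : ℕ} (hkM : k ≤ M)
    (hk : 48 * (ε * n) ≤ k * r) :
    (base (r ^ 2)).real (exitSet (dens r l) (dens r l⁻¹) T M k) ≤ 128 * n / (k * r) ^ 2
      + 32768 * n ^ 2 * (2 * (k * r)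
        + 8 * (r * meanExit (r ^ 2) (dens r l⁻¹) (dens r l) M T)) / (k * r) ^ 4 := by
  have hl := h.rate_pos
  have hl' := h.rate_le'
  have hn := h.n_pos
  have he := h.ε_pos
  have he1 := h.ε_le
  have hr := h.r_pos
  have hr1 := h.r_le
  have hx : 0 < k * r := lt_of_lt_of_le (by positivity) hk
  have hk0 : 0 < k := Nat.pos_of_ne_zero fun hk0 => by simp [hk0] at hx
  have hxn : k * r ≤ 2 * n := by
    have : (k : ℝ) ≤ M := by exact_mod_cast hkM
    nlinarith [h.columns_le]
  obtain ⟨x, hxdef⟩ : ∃ x, x = k * r := ⟨_, rfl⟩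
  rw [← hxdef] at hx hk hxn ⊢
  -- Raising the rate by `θ` yields about `θ * x` new sources before column `k`, while on the same
  -- scale the mean moves by at most `θ * (6 * ε + θ) * n`. With this `θ`, and `48 * ε * n ≤ x`, one
  -- has `(6 * ε + θ) * n ≤ x / 8 + x / 16 ≤ x / 4`, as `exit_le_of_mean_le` requires.
  obtain ⟨θ, hθdef⟩ : ∃ θ, θ = x / (16 * n) := ⟨_, rfl⟩
  have hθn : θ * n = x / 16 := by rw [hθdef]; field_simp
  have hθ : 0 < θ := by rw [hθdef]; positivity
  have hθ1 : θ ≤ 1 / 8 := by rw [hθdef, div_le_iff₀ (by positivity)]; linarith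
  have hlθ : 0 < l + θ := by positivity
  have hd := dens_sub hr hl hlθ
  have hden : (1 + l * r) * (1 + (l + θ) * r) ≤ 2 := by
    have b1 : l * r ≤ 6 / 5 * (1 / 10) := mul_le_mul (by linarith) hr1 hr.le (by norm_num)
    have b2 : (l + θ) * r ≤ 27 / 20 * (1 / 10) :=
      mul_le_mul (by linarith) hr1 hr.le (by norm_num)
    have b3 : 0 < l * r := by positivity
    nlinarith
  have hdpos : 0 < dens r (l + θ) - dens r l := by
    rw [hd]; have : 0 < l + θ - l := by linarith
    positivity
  have hdk : x ^ 2 / (32 * n) ≤ (dens r (l + θ) - dens r l) * k := by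
    have e1 : r * (l + θ - l) / ((1 + l * r) * (1 + (l + θ) * r)) * k
        = x * θ / ((1 + l * r) * (1 + (l + θ) * r)) := by rw [hxdef]; ring
    have e2 : x ^ 2 / (32 * n) = x * θ / 2 := by rw [hθdef]; field_simp; norm_num
    rw [hd, e1, e2]
    exact div_le_div_of_nonneg_left (by positivity) (by positivity) hden
  have hv0 := h.variance_le (θ := 0) le_rfl (by norm_num)
  have hv1 := h.variance_le hθ.le (by linarith)
  rw [add_zero] at hv0
  have hexit := exit_le_of_mean_le (balanced_dens hr (by linarith) hl)
    (balanced_dens hr (by linarith) hlθ) (by linarith) hk0 hkM (T := T) ?_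
  · set V := Var[fun z => (lptBase (dens r l) (dens r l⁻¹) T M z : ℝ); base (r ^ 2)]
    set V' := Var[fun z => (lptBase (dens r (l + θ)) (dens r (l + θ)⁻¹) T M z : ℝ); base (r ^ 2)]
    set e := r * meanExit (r ^ 2) (dens r l⁻¹) (dens r l) M T
    -- The terms free of exits add up to `24 * ε * n + 4 * θ * n`, at most `x / 2 + x / 4`.
    have hVV : V + V' ≤ 2 * x + 8 * e := by nlinarith
    have hVV0 : 0 ≤ V + V' := add_nonneg (variance_nonneg _ _) (variance_nonneg _ _)
    have hq : 0 < x ^ 2 / (32 * n) := by positivity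
    refine hexit.trans (add_le_add ?_ ?_)
    · calc 4 / ((dens r (l + θ) - dens r l) * k) ≤ 4 / (x ^ 2 / (32 * n)) :=
            div_le_div_of_nonneg_left (by norm_num) hq hdk
        _ = 128 * n / x ^ 2 := by field_simp; norm_num
    · calc 32 * (V + V') / ((dens r (l + θ) - dens r l) * k) ^ 2
          ≤ 32 * (V + V') / (x ^ 2 / (32 * n)) ^ 2 :=
            div_le_div_of_nonneg_left (by positivity) (by positivity)
              (pow_le_pow_left₀ hq.le hdk 2)
        _ ≤ 32 * (2 * x + 8 * e) / (x ^ 2 / (32 * n)) ^ 2 := by gcongr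
        _ = 32768 * n ^ 2 * (2 * x + 8 * e) / x ^ 4 := by field_simp; ring
  · rw [mean_sub hr hl hlθ]
    have hs := one_sub_le_slope hr (by linarith) hl (d := 2 * ε) (by linarith) hl'
    have hs' := one_sub_le_slope hr (by linarith) hlθ (d := 2 * ε + θ) (by linarith) (by linarith)
    have hss : 1 - 4 * ε - θ ≤ slope r l * slope r (l + θ) := by
      have h0 : 0 ≤ 1 - (2 * ε + θ) := by linarith
      calc 1 - 4 * ε - θ ≤ (1 - 2 * ε) * (1 - (2 * ε + θ)) := by nlinarith
        _ ≤ _ := mul_le_mul hs hs' h0 (slope_pos hr hl).le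
    have h2 : (1 - ε) * n * (1 - 4 * ε - θ) ≤ T * r * (slope r l * slope r (l + θ)) :=
      (mul_le_mul_of_nonneg_left hss (mul_nonneg (by linarith) hn.le)).trans
        (mul_le_mul_of_nonneg_right h.le_rows (mul_pos (slope_pos hr hl) (slope_pos hr hlθ)).le)
    have h4 : 0 ≤ n * (ε * (4 * ε + θ)) := by positivity
    have h5 : (M - T * (slope r l * slope r (l + θ))) * r ≤ k / 4 * r := by
      have := h.columns_le
      nlinarith
    have h6 := le_of_mul_le_mul_right h5 hr
    calc _ ≤ (dens r (l + θ) - dens r l) * (k / 4) := mul_le_mul_of_nonneg_left h6 hdpos.le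
      _ = _ := by ring

/-- Columns up to order `ε * n / r` are counted with probability at most `1`; beyond, the exit
probabilities are summable like `1 / k ^ 2`. The variance bound brings in exits through the other
axis, and the threshold `48` makes their coefficient at most `1 / 2`. -/
lemma mul_meanExit_le (h : NearCharacteristic r n ε l T M) :
    r * meanExit (r ^ 2) (dens r l) (dens r l⁻¹) T M ≤ 156 * (ε * n)
      + r * meanExit (r ^ 2) (dens r l⁻¹) (dens r l) M T / 2 := by
  have hn := h.n_pos
  have he := h.ε_pos
  have he1 := h.ε_le
  have hr := h.r_pos
  have hr1 := h.r_le
  obtain ⟨e, he0⟩ : ∃ e, e = r * meanExit (r ^ 2) (dens r l⁻¹) (dens r l) M T := ⟨_, rfl⟩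
  have hepos : 0 ≤ e := by rw [he0]; exact mul_nonneg hr.le (meanExit_nonneg _ _ _ _ _)
  obtain ⟨K, hK⟩ : ∃ K, K = 48 * (ε * n) := ⟨_, rfl⟩
  have hKpos : 0 < K := by rw [hK]; positivity
  -- Here `48 ^ 3 * 10 = 1105920`. This is where `ε ^ 3 * n ≥ 10` is decisive: `ε` may not be below
  -- the order `n ^ (-1/3)`. The constant `1048576` absorbs both quadratic terms of `A`.
  have hK3 : 1048576 * n ^ 2 ≤ K ^ 3 := by
    have : K ^ 3 = 110592 * (ε ^ 3 * n) * n ^ 2 := by rw [hK]; ring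
    rw [this]
    nlinarith [h.large, sq_nonneg n]
  set k₀ := ⌈K / r⌉₊ with hk₀
  have hk₀pos : 0 < k₀ := Nat.ceil_pos.2 (by positivity)
  have hk₀le : K / r ≤ k₀ := Nat.le_ceil _
  have hk₀lt : (k₀ : ℝ) < K / r + 1 := Nat.ceil_lt_add_one (by positivity)
  obtain ⟨A, hA⟩ : ∃ A, A = 128 * n + 65536 * n ^ 2 / K + 262144 * n ^ 2 * e / K ^ 2 := ⟨_, rfl⟩
  have hA0 : 0 ≤ A := by rw [hA]; positivity
  -- The second condition is written with `k₀ - 1` to match the open interval in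
  -- `sum_Ioo_inv_sq_le`.
  have hterm : ∀ k ∈ Finset.range M, (base (r ^ 2)).real (exitSet (dens r l) (dens r l⁻¹) T M k)
      ≤ (if k < k₀ then 1 else 0) + if k₀ - 1 < k then A / r ^ 2 * ((k : ℝ) ^ 2)⁻¹ else 0 := by
    intro k hk
    by_cases hkk : k < k₀
    · rw [if_pos hkk, if_neg (by omega), add_zero]; exact measureReal_le_one
    · rw [if_neg hkk, if_pos (by omega), zero_add]
      have hkr : K ≤ k * r := by
        have h1 : (k₀ : ℝ) ≤ k := by exact_mod_cast not_lt.1 hkk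
        rw [← div_le_iff₀ hr]; linarith
      refine (h.exit_le (Finset.mem_range.1 hk).le (hK ▸ hkr)).trans ?_
      rw [← he0]
      obtain ⟨x, hx⟩ : ∃ x, x = k * r := ⟨_, rfl⟩
      rw [← hx] at hkr ⊢
      have hx0 : 0 < x := hKpos.trans_le hkr
      have hk0 : (k : ℝ) ≠ 0 := by rintro h0; rw [hx, h0, zero_mul] at hx0; exact lt_irrefl _ hx0
      have e1 : A / r ^ 2 * ((k : ℝ) ^ 2)⁻¹ = A / x ^ 2 := by rw [hx]; field_simp
      have e2 : 128 * n / x ^ 2 + 32768 * n ^ 2 * (2 * x + 8 * e) / x ^ 4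
          = (128 * n + 65536 * n ^ 2 / x + 262144 * n ^ 2 * e / x ^ 2) / x ^ 2 := by
        field_simp; ring
      rw [e1, e2, hA]
      gcongr
  have hsum : meanExit (r ^ 2) (dens r l) (dens r l⁻¹) T M ≤ k₀ + A / r ^ 2 * (2 / k₀) := by
    refine (Finset.sum_le_sum hterm).trans ?_
    rw [Finset.sum_add_distrib]
    refine add_le_add ?_ ?_
    · rw [← Finset.sum_filter, Finset.sum_const, nsmul_eq_mul, mul_one]
      have : (Finset.range M).filter (· < k₀) ⊆ Finset.range k₀ := fun k hk => by
        simp only [Finset.mem_filter, Finset.mem_range] at hk ⊢; exact hk.2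
      exact_mod_cast (Finset.card_le_card this).trans (by simp)
    · rw [← Finset.sum_filter, ← Finset.mul_sum]
      have : (Finset.range M).filter (k₀ - 1 < ·) = Finset.Ioo (k₀ - 1) M := by
        ext k; simp [and_comm]
      rw [this]
      have h2 := sum_Ioo_inv_sq_le (α := ℝ) (k₀ - 1) M
      rw [Nat.cast_sub (by omega), Nat.cast_one, sub_add_cancel] at h2
      exact mul_le_mul_of_nonneg_left h2 (by positivity)
  have h3 : r * meanExit (r ^ 2) (dens r l) (dens r l⁻¹) T M ≤ K + r + 2 * A / K := by
    have h4 : A / r ^ 2 * (2 / k₀) ≤ A / r ^ 2 * (2 / (K / r)) := by gcongr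
    have h5 : r * (A / r ^ 2 * (2 / (K / r))) = 2 * A / K := by field_simp
    have h6 : r * (K / r + 1) = K + r := by field_simp
    nlinarith
  have h7 : 2 * A / K ≤ K / 8 + K / 8 + e / 2 := by
    rw [div_le_iff₀ hKpos]
    have hnK : 65536 * n ^ 2 / K ≤ K ^ 2 / 16 := by rw [div_le_iff₀ hKpos]; nlinarith
    have hnK2 : 262144 * n ^ 2 * e / K ^ 2 ≤ K * e / 4 := by
      rw [div_le_iff₀ (by positivity)]; nlinarith
    have hnK3 : 128 * n ≤ K ^ 2 / 16 := by
      have h8 : K ^ 2 = 2304 * ((ε ^ 2 * n) * n) := by rw [hK]; ring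
      have h9 : 10 ≤ ε ^ 2 * n := by
        have := h.large
        have h10 : 0 ≤ ε ^ 2 * n := by positivity
        nlinarith
      rw [h8]; nlinarith
    rw [hA]; nlinarith
  have h11 : r ≤ K := by
    rw [hK]
    have := h.large
    have h10 : 0 < ε * n := by positivity
    nlinarith [sq_nonneg ε, mul_le_mul he1 he1 he.le (by norm_num)]
  rw [← he0]
  rw [hK] at h3 h7 h11
  nlinarith

/-- The two mirror inequalities, each with coefficient `1 / 2`, form a contraction and can be solved
for either mean exit. -/
lemma meanExit_add_le (h : NearCharacteristic r n ε l T M) :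
    r * meanExit (r ^ 2) (dens r l⁻¹) (dens r l) M T ≤ 624 * (ε * n) := by
  have h1 := h.mul_meanExit_le
  have h2 := h.symm.mul_meanExit_le
  rw [inv_inv] at h2
  have := mul_nonneg h.r_pos.le (meanExit_nonneg (r ^ 2) (dens r l) (dens r l⁻¹) T M)
  linarith

lemma variance_le_const (h : NearCharacteristic r n ε l T M) :
    Var[fun z => (lptBase (dens r l) (dens r l⁻¹) T M z : ℝ); base (r ^ 2)]
      ≤ 2508 * (ε * n) := by
  have h1 := h.variance_le (θ := 0) le_rfl (by norm_num)
  have h2 := h.meanExit_add_le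
  rw [add_zero] at h1
  linarith

end NearCharacteristic

/-- With too low a rate of sources, exits through the sources are unlikely. -/
theorem exit_zero_dens_le {r η : ℝ} {T M : ℕ} (hr : 0 < r) (hr1 : r ≤ 1 / 10) (hη : 0 < η)
    (hη1 : η ≤ 1 / 32) (hlarge : 10 ≤ η ^ 3 * (T * r)) (hM : |(M : ℝ) - T| ≤ η / 4 * T) :
    (base (r ^ 2)).real (exitSet (dens r (1 - 2 * η)) (dens r (1 - 2 * η)⁻¹) T M 0)
      ≤ 20064 / (η ^ 3 * (T * r)) := by
  obtain ⟨n, hn⟩ : ∃ n, n = T * r := ⟨_, rfl⟩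
  rw [← hn] at hlarge ⊢
  have hn0 : 0 < n := by
    have := pow_pos hη 3
    by_contra hc
    nlinarith
  obtain ⟨hM1, hM2⟩ := abs_le.1 hM
  have hMr1 : (1 - η / 4) * n ≤ M * r := by rw [hn]; nlinarith
  have hMr2 : M * r ≤ (1 + η / 4) * n := by rw [hn]; nlinarith
  -- Both rates compared below, `1 - 2 * η` and `1 - η`, are near-characteristic with `ε = 2 * η`.
  have near : ∀ l, 1 - 2 * η ≤ l → l ≤ 1 → NearCharacteristic r n (2 * η) l T M := fun l h1 h2 =>
    ⟨hr, hr1, by linarith, by linarith, by nlinarith [pow_pos hη 3], by rw [← hn]; nlinarith,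
      by rw [← hn]; nlinarith, by nlinarith, by nlinarith, h1, by nlinarith⟩
  have hl : 0 < 1 - 2 * η := by linarith
  have hl' : 0 < 1 - η := by linarith
  have hv := (near (1 - 2 * η) le_rfl (by linarith)).variance_le_const
  have hv' := (near (1 - η) (by linarith) (by linarith)).variance_le_const
  have hd := dens_sub hr hl hl'
  have hden : (1 + (1 - 2 * η) * r) * (1 + (1 - η) * r) ≤ 2 := by
    have b1 : (1 - 2 * η) * r ≤ 1 * (1 / 10) :=
      mul_le_mul (by linarith) hr1 hr.le (by norm_num)
    have b2 : (1 - η) * r ≤ 1 * (1 / 10) := mul_le_mul (by linarith) hr1 hr.le (by norm_num)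
    have b3 : 0 < (1 - 2 * η) * r := by positivity
    nlinarith
  have hd2 : r * η / 2 ≤ dens r (1 - η) - dens r (1 - 2 * η) := by
    rw [hd, show 1 - η - (1 - 2 * η) = η by ring]
    exact div_le_div_of_nonneg_left (by positivity) (by positivity) hden
  have s1 : 1 + 8 / 5 * η ≤ slope r (1 - 2 * η) := by
    have := slope_sub_one hr hl
    have h2 : 8 / 5 * η ≤ (1 - (1 - 2 * η)) * (1 - r) / (1 - 2 * η + r) := by
      rw [le_div_iff₀ (by linarith)]; nlinarith
    linarith
  have s2 : 1 + 4 / 5 * η ≤ slope r (1 - η) := by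
    have := slope_sub_one hr hl'
    have h2 : 4 / 5 * η ≤ (1 - (1 - η)) * (1 - r) / (1 - η + r) := by
      rw [le_div_iff₀ (by linarith)]; nlinarith
    linarith
  have hss : 1 + 12 / 5 * η ≤ slope r (1 - 2 * η) * slope r (1 - η) :=
    calc 1 + 12 / 5 * η ≤ (1 + 8 / 5 * η) * (1 + 4 / 5 * η) := by nlinarith
      _ ≤ _ := mul_le_mul s1 s2 (by positivity) (slope_pos hr hl).le
  -- The density rises by at least `r * η / 2` and the deviation from the characteristic is at least
  -- `2 * η * n / r`, so the mean drops by at least `η ^ 2 * n`.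
  have hmean := exit_zero_le (balanced_dens hr (by linarith) hl)
    (balanced_dens hr (by linarith) hl') (by nlinarith) (T := T) (M := M) (m := η ^ 2 * n)
    (by positivity) ?_
  · refine hmean.trans ?_
    rw [div_le_div_iff₀ (by positivity) (by positivity)]
    -- Each variance is at most `2508 * 2 * η * n`; two of them, with the factor `2` from
    -- `exit_zero_le`, give `20064`.
    have e : 20064 * (η ^ 2 * n) ^ 2 = 2 * (5016 * (η * n) * 2) * (η ^ 3 * n) := by ring
    rw [e]
    refine mul_le_mul_of_nonneg_right ?_ (by positivity)
    linarith
  · rw [mean_sub hr hl hl']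
    have h5 : (M - T * (slope r (1 - 2 * η) * slope r (1 - η))) * r ≤ -(2 * η * n) := by
      have h6 : n * (1 + 12 / 5 * η) ≤ T * r * (slope r (1 - 2 * η) * slope r (1 - η)) := by
        rw [← hn]; exact mul_le_mul_of_nonneg_left hss hn0.le
      nlinarith
    have h7 : M - T * (slope r (1 - 2 * η) * slope r (1 - η)) ≤ -(2 * η * n) / r := by
      rw [le_div_iff₀ hr]; exact h5
    have h8 : 0 ≤ dens r (1 - η) - dens r (1 - 2 * η) := le_trans (by positivity) hd2
    have h9 : -(2 * η * n) / r ≤ 0 := div_nonpos_of_nonpos_of_nonneg (by nlinarith) hr.le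
    calc _ ≤ (dens r (1 - η) - dens r (1 - 2 * η)) * (-(2 * η * n) / r) :=
          mul_le_mul_of_nonneg_left h7 h8
      _ ≤ (r * η / 2) * (-(2 * η * n) / r) := mul_le_mul_of_nonpos_right hd2 h9
      _ = _ := by field_simp

/-! ### Sandwiching the increments between two stationary models -/

lemma mul_measureReal_ge_le {α : Type*} [MeasurableSpace α] {μ : Measure α} [IsFiniteMeasure μ]
    {f : α → ℝ} (hf : Integrable f μ) (h0 : ∀ z, 0 ≤ f z) {d : ℝ} (hd : 0 < d) :
    μ.real {z | d ≤ f z} ≤ (∫ z, f z ∂μ) / d := by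
  rw [le_div_iff₀ hd, mul_comm]
  exact mul_meas_ge_le_integral_of_nonneg (ae_of_all _ h0) hf d

/-- Off the exit event the best path to `y₀` leaves through the sinks, so stationary increments to
the left of `y₀` lie below those without boundary points. -/
lemma lower_sandwich {a b : ℝ} {T y₀ : ℕ} {z : Base} (hz : z ∉ exitSet a b T y₀ 0) {x y : ℕ}
    (hxy : x ≤ y) (hy : y ≤ y₀) :
    lptBase a b T y z + lpt noPoints noPoints z.2.2 T x
      ≤ lpt noPoints noPoints z.2.2 T y + lptBase a b T x z := by
  rw [exitSet, mem_ofPred_eq, exitAfter_zero_iff, not_le] at hz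
  exact le_lpt_add_of_exit hz.le hy hxy

/-- Transposition turns exits through the sinks into exits through the sources, so the event
excluded here is an exit through the sinks in the original model. -/
lemma upper_sandwich {a b : ℝ} {T x₀ : ℕ} {z : Base}
    (hz : z ∉ transposeBase ⁻¹' exitSet b a x₀ T 0) {x y : ℕ} (hx : x₀ ≤ x) (hxy : x ≤ y) :
    lpt noPoints noPoints z.2.2 T y + lptBase a b T x z
      ≤ lptBase a b T y z + lpt noPoints noPoints z.2.2 T x := by
  have h : ¬ lpt noPoints (points a z.1) (fun c => z.2.2 c.swap) x₀ T
      ≤ lpt (points b z.2.1) noPoints (fun c => z.2.2 c.swap) x₀ T := fun h =>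
    hz (exitAfter_zero_iff.2 h)
  rw [lpt_transpose, lpt_transpose, not_le] at h
  exact lpt_add_le_of_exit h.le hx hxy

lemma lptBase_increment_le {a b a' b' : ℝ} (ha : a ≤ a') (hb : b' ≤ b) (T : ℕ) (z : Base)
    {x y : ℕ} (hxy : x ≤ y) :
    lptBase a b T y z + lptBase a' b' T x z ≤ lptBase a' b' T y z + lptBase a b T x z :=
  lpt_add_le_of_hor_le (hor_mono (points_mono ha _) (points_mono hb _) _ T) hxy

/-- On a window `[x₋, x₊]` of columns, the increments of the last-passage time without boundary
points are close to those of a stationary model. -/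
lemma window_comparison {a b a' b' p : ℝ} (h : Balanced a b p) (h' : Balanced a' b' p)
    (ha : a ≤ a') (hb : b' ≤ b) {T x₁ x₀ x₂ : ℕ} (h10 : x₁ ≤ x₀) (h02 : x₀ ≤ x₂) {d : ℝ}
    (hd : 0 < d) :
    (base p).real {z | ∃ x, x₁ ≤ x ∧ x ≤ x₂ ∧ d ≤
        |((lpt noPoints noPoints z.2.2 T x : ℝ) - lpt noPoints noPoints z.2.2 T x₀)
          - ((count (outgoing a b T x₂ z).1 x : ℝ) - count (outgoing a b T x₂ z).1 x₀)|}
      ≤ (base p).real (exitSet a b T x₂ 0) + (base p).real (exitSet b' a' x₁ T 0)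
        + (a' - a) * (x₂ - x₁) / d := by
  -- The gap between the two stationary increments over the whole window; its mean is explicit by
  -- stationarity.
  let D : Base → ℝ := fun z => ((lptBase a' b' T x₂ z : ℝ) - lptBase a' b' T x₁ z)
    - ((lptBase a b T x₂ z : ℝ) - lptBase a b T x₁ z)
  have hI : ∀ a b M, Integrable (fun z => (lptBase a b T M z : ℝ)) (base p) := fun a b M =>
    (memLp_lptBase a b p T M).integrable (by norm_num)
  have hI' : ∀ a b, Integrable (fun z => (lptBase a b T x₂ z : ℝ) - lptBase a b T x₁ z) (base p) :=
    fun a b => (hI a b x₂).sub (hI a b x₁)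
  have hD : Integrable D (base p) := (hI' a' b').sub (hI' a b)
  have hD0 : ∀ z, 0 ≤ D z := fun z => by
    have := lptBase_increment_le ha hb T z (h10.trans h02)
    have : (lptBase a b T x₂ z : ℝ) + lptBase a' b' T x₁ z
        ≤ lptBase a' b' T x₂ z + lptBase a b T x₁ z := by exact_mod_cast this
    simp only [D]; linarith
  have hDI : ∫ z, D z ∂(base p) = (a' - a) * (x₂ - x₁) := by
    simp only [D]
    rw [integral_sub (hI' a' b') (hI' a b), integral_sub (hI _ _ _) (hI _ _ _), integral_sub (hI _ _ _) (hI _ _ _),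
      h.integral_lptBase, h.integral_lptBase, h'.integral_lptBase, h'.integral_lptBase]
    ring
  have hsub : {z | ∃ x, x₁ ≤ x ∧ x ≤ x₂ ∧ d ≤
        |((lpt noPoints noPoints z.2.2 T x : ℝ) - lpt noPoints noPoints z.2.2 T x₀)
          - ((count (outgoing a b T x₂ z).1 x : ℝ) - count (outgoing a b T x₂ z).1 x₀)|}
      ⊆ (exitSet a b T x₂ 0 ∪ transposeBase ⁻¹' exitSet b' a' x₁ T 0) ∪ {z | d ≤ D z} := by
    rintro z ⟨x, hx1, hx2, hdx⟩
    by_contra hz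
    rw [mem_union, mem_union, not_or, not_or] at hz
    obtain ⟨⟨hz1, hz2⟩, hz3⟩ := hz
    rw [mem_ofPred_eq, not_le] at hz3
    -- Off both exit events the increment without boundary points lies between the two stationary
    -- ones on every subinterval. As the horizontal edges are ordered, the gap over a subinterval is
    -- at most `D`, uniformly in the subinterval.
    have key : ∀ u v : ℕ, x₁ ≤ u → u ≤ v → v ≤ x₂ →
        |((lpt noPoints noPoints z.2.2 T v : ℝ) - lpt noPoints noPoints z.2.2 T u)
          - ((lptBase a b T v z : ℝ) - lptBase a b T u z)| ≤ D z := by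
      intro u v hu huv hv
      have e1 : (lptBase a b T v z : ℝ) + lpt noPoints noPoints z.2.2 T u
          ≤ lpt noPoints noPoints z.2.2 T v + lptBase a b T u z := by
        exact_mod_cast lower_sandwich hz1 huv hv
      have e2 : (lpt noPoints noPoints z.2.2 T v : ℝ) + lptBase a' b' T u z
          ≤ lptBase a' b' T v z + lpt noPoints noPoints z.2.2 T u := by
        exact_mod_cast upper_sandwich hz2 hu huv
      have e3 : (lptBase a b T u z : ℝ) + lptBase a' b' T x₁ z
          ≤ lptBase a' b' T u z + lptBase a b T x₁ z := by
        exact_mod_cast lptBase_increment_le ha hb T z hu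
      have e4 : (lptBase a b T x₂ z : ℝ) + lptBase a' b' T v z
          ≤ lptBase a' b' T x₂ z + lptBase a b T v z := by
        exact_mod_cast lptBase_increment_le ha hb T z hv
      rw [abs_le]
      simp only [D] at hz3 ⊢
      constructor <;> linarith
    have hc : ∀ x, x ≤ x₂ → (lptBase a b T x z : ℝ)
        = count (points b z.2.1) T + count (outgoing a b T x₂ z).1 x := fun x hx => by
      rw [count_outgoing_fst _ _ _ _ _ hx]; simp [lptBase, lpt]
    have : |((lpt noPoints noPoints z.2.2 T x : ℝ) - lpt noPoints noPoints z.2.2 T x₀)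
          - ((count (outgoing a b T x₂ z).1 x : ℝ) - count (outgoing a b T x₂ z).1 x₀)| ≤ D z := by
      rcases le_total x₀ x with h0x | hx0
      · have := key x₀ x h10 h0x hx2
        rw [hc x hx2, hc x₀ h02] at this
        convert this using 2; ring
      · have := key x x₀ hx1 hx0 h02
        rw [hc x hx2, hc x₀ h02, abs_sub_comm] at this
        convert this using 2; ring
    linarith
  calc _ ≤ (base p).real ((exitSet a b T x₂ 0 ∪ transposeBase ⁻¹' exitSet b' a' x₁ T 0)
        ∪ {z | d ≤ D z}) := measureReal_mono hsub
    _ ≤ (base p).real (exitSet a b T x₂ 0) + (base p).real (transposeBase ⁻¹' exitSet b' a' x₁ T 0)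
        + (base p).real {z | d ≤ D z} :=
      (measureReal_union_le _ _).trans (by gcongr; exact measureReal_union_le _ _)
    _ ≤ _ := by
      have h1 : (base p).real (transposeBase ⁻¹' exitSet b' a' x₁ T 0)
          = (base p).real (exitSet b' a' x₁ T 0) := by
        rw [measureReal_def, (measurePreserving_transposeBase p).measure_preimage
          (measurableSet_exitSet _ _ _ _ _).nullMeasurableSet]; rfl
      have h2 := mul_measureReal_ge_le hD hD0 hd
      rw [hDI] at h2
      rw [h1]; gcongr

/-- Inverting the rate exchanges sources and sinks, so `exit_zero_dens_le` at the single rate `1 - 2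
* η` controls both wrong exits: at the right end of the window directly, at the left end after
transposition. -/
lemma window_comparison_dens {r η : ℝ} {T x₁ x₀ x₂ : ℕ} (hr : 0 < r) (hr1 : r ≤ 1 / 10)
    (hη : 0 < η) (hη1 : η ≤ 1 / 32) (h10 : x₁ ≤ x₀) (h02 : x₀ ≤ x₂) {d : ℝ} (hd : 0 < d)
    (hT : 10 ≤ η ^ 3 * (T * r)) (hx₁ : 10 ≤ η ^ 3 * (x₁ * r))
    (hx₂ : |(x₂ : ℝ) - T| ≤ η / 4 * T) (hx₁' : |(T : ℝ) - x₁| ≤ η / 4 * x₁) :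
    (base (r ^ 2)).real {z | ∃ x, x₁ ≤ x ∧ x ≤ x₂ ∧ d ≤
        |((lpt noPoints noPoints z.2.2 T x : ℝ) - lpt noPoints noPoints z.2.2 T x₀)
          - ((count (outgoing (dens r (1 - 2 * η)) (dens r (1 - 2 * η)⁻¹) T x₂ z).1 x : ℝ)
            - count (outgoing (dens r (1 - 2 * η)) (dens r (1 - 2 * η)⁻¹) T x₂ z).1 x₀)|}
      ≤ 20064 / (η ^ 3 * (T * r)) + 20064 / (η ^ 3 * (x₁ * r)) + 5 * η * r * (x₂ - x₁) / d := by
  have hl : 0 < 1 - 2 * η := by linarith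
  have hli : 0 < (1 - 2 * η)⁻¹ := inv_pos.2 hl
  have hl1 : 1 ≤ (1 - 2 * η)⁻¹ := (one_le_inv₀ hl).2 (by linarith)
  have hle := dens_mono hr hl (by linarith : 1 - 2 * η ≤ (1 - 2 * η)⁻¹)
  have hB := balanced_dens hr (by linarith : r ≤ 1) hl
  refine (window_comparison hB hB.symm hle hle h10 h02 hd).trans ?_
  have hx : (x₁ : ℝ) ≤ x₂ := by exact_mod_cast h10.trans h02
  have hdiff : dens r (1 - 2 * η)⁻¹ - dens r (1 - 2 * η) ≤ 5 * η * r := by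
    rw [dens_sub hr hl hli]
    have h1 : (1 - 2 * η)⁻¹ - (1 - 2 * η) ≤ 5 * η := by
      have : (1 - 2 * η)⁻¹ ≤ 1 + 3 * η := by
        rw [inv_le_comm₀ hl (by positivity), inv_le_iff_one_le_mul₀ (by positivity)]
        nlinarith
      linarith
    have h2 : 1 ≤ (1 + (1 - 2 * η) * r) * (1 + (1 - 2 * η)⁻¹ * r) :=
      one_le_mul_of_one_le_of_one_le (by nlinarith) (by nlinarith)
    refine (div_le_self (mul_nonneg hr.le (by linarith)) h2).trans ?_
    nlinarith
  have h1 := exit_zero_dens_le hr hr1 hη hη1 hT hx₂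
  have h2 := exit_zero_dens_le hr hr1 hη hη1 hx₁ hx₁'
  gcongr

/-! ### The Skorokhod uniformity -/

lemma hasBasis_uniformity :
    (𝓤 CadlagPath).HasBasis (fun ε : ℝ => 0 < ε) skorokhodEntourage := by
  refine ⟨fun U => ?_⟩
  have h : U ∈ 𝓤 CadlagPath ↔ ∃ V ∈ skorokhodBasis, V ⊆ U := FilterBasis.mem_filter_iff _
  rw [h]
  constructor
  · rintro ⟨_, ⟨ε, hε, rfl⟩, hV⟩
    exact ⟨ε, hε, hV⟩
  · rintro ⟨ε, hε, hV⟩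
    exact ⟨_, ⟨ε, hε, rfl⟩, hV⟩

/-- This gives pseudometrizability, used for the Lipschitz criterion of weak convergence and for
limits of measurable maps. -/
instance : (𝓤 CadlagPath).IsCountablyGenerated := by
  have h : (𝓤 CadlagPath).HasBasis (fun _ : ℕ => True)
      fun k => skorokhodEntourage (1 / ((k : ℝ) + 1)) := by
    refine hasBasis_uniformity.to_hasBasis (fun ε hε => ?_) fun k _ =>
      ⟨_, Nat.one_div_pos_of_nat, subset_rfl⟩
    obtain ⟨k, hk⟩ := exists_nat_one_div_lt hε
    exact ⟨k, trivial, skorokhodEntourage_mono Nat.one_div_pos_of_nat hk.le⟩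
  exact h.isCountablyGenerated

instance : TopologicalSpace.PseudoMetrizableSpace CadlagPath :=
  UniformSpace.pseudoMetrizableSpace

lemma tendsto_iff_skorokhodEntourage {α : Type*} {l : Filter α} {u : α → CadlagPath}
    {f : CadlagPath} :
    Tendsto u l (𝓝 f) ↔ ∀ ε > 0, ∀ᶠ x in l, (f, u x) ∈ skorokhodEntourage ε := by
  rw [Uniform.tendsto_nhds_right, hasBasis_uniformity.tendsto_right_iff]

lemma mem_skorokhodEntourage_of_forall {f g : CadlagPath} {ε : ℝ} (hε : 0 ≤ ε)
    (h : ∀ t, |t| ≤ 1 / ε → |g t - f t| ≤ ε) : (f, g) ∈ skorokhodEntourage ε :=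
  ⟨OrderIso.refl ℝ, fun t => by simpa using hε, h⟩

/-- Weak convergence can be tested against bounded uniformly continuous functions. -/
lemma tendsto_of_forall_uniformContinuous {γ : Type*} {l : Filter γ} [l.IsCountablyGenerated]
    {μs : γ → ProbabilityMeasure CadlagPath} {μ : ProbabilityMeasure CadlagPath}
    (h : ∀ (F : CadlagPath → ℝ) (C : ℝ), (∀ f, |F f| ≤ C) → Continuous F →
      (∀ ε > 0, ∃ δ > 0, ∀ f g, (f, g) ∈ skorokhodEntourage δ → |F f - F g| ≤ ε) →
      Tendsto (fun i => ∫ f, F f ∂(μs i : Measure CadlagPath)) l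
        (𝓝 (∫ f, F f ∂(μ : Measure CadlagPath)))) :
    Tendsto μs l (𝓝 μ) := by
  let _ : PseudoMetricSpace CadlagPath := UniformSpace.pseudoMetricSpace CadlagPath
  refine tendsto_iff_forall_lipschitz_integral_tendsto.2 ?_
  rintro F ⟨C, hC⟩ ⟨L, hL⟩
  -- Boundedness of `F` is given as a bound on differences; a reference path turns it into a bound
  -- on values.
  have x₀ : CadlagPath := ⟨fun _ => 0, fun _ => continuousWithinAt_const, fun _ =>
    ⟨0, tendsto_const_nhds⟩⟩
  refine h F (|F x₀| + C) (fun f => ?_) hL.continuous fun ε hε => ?_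
  · have := hC f x₀
    rw [Real.dist_eq] at this
    have h2 := abs_add_le (F f - F x₀) (F x₀)
    rw [sub_add_cancel] at h2
    linarith
  · have hu := Metric.uniformContinuous_iff.1 hL.uniformContinuous ε hε
    obtain ⟨δ, hδ, hd⟩ := hu
    obtain ⟨δ', hδ', hsub⟩ := hasBasis_uniformity.mem_iff.1 (Metric.dist_mem_uniformity hδ)
    exact ⟨δ', hδ', fun f g hfg => (hd (hsub hfg)).le⟩

/-! ### Step paths -/

lemma eventually_floor_right (m : ℕ) (t : ℝ) : ∀ᶠ y : ℝ in 𝓝[≥] t, ⌊y * m⌋ = ⌊t * m⌋ := by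
  rcases m.eq_zero_or_pos with rfl | hm
  · simp
  have hm' : (0 : ℝ) < m := by exact_mod_cast hm
  have : t < (⌊t * m⌋ + 1) / m := by rw [lt_div_iff₀ hm']; exact Int.lt_floor_add_one _
  filter_upwards [Ico_mem_nhdsGE this] with y hy
  rw [Int.floor_eq_iff]
  refine ⟨(Int.floor_le _).trans (mul_le_mul_of_nonneg_right hy.1 hm'.le), ?_⟩
  have := hy.2
  rwa [lt_div_iff₀ hm'] at this

lemma eventually_floor_left (m : ℕ) (t : ℝ) : ∃ c : ℤ, ∀ᶠ y : ℝ in 𝓝[<] t, ⌊y * m⌋ = c := by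
  rcases m.eq_zero_or_pos with rfl | hm
  · simp
  have hm' : (0 : ℝ) < m := by exact_mod_cast hm
  have : ((⌈t * m⌉ : ℝ) - 1) / m < t := by
    rw [div_lt_iff₀ hm']; linarith [Int.ceil_lt_add_one (t * m)]
  refine ⟨⌈t * m⌉ - 1, ?_⟩
  filter_upwards [Ioo_mem_nhdsLT this] with y hy
  rw [Int.floor_eq_iff]
  push_cast
  refine ⟨((div_lt_iff₀ hm').1 hy.1).le, ?_⟩
  linarith [Int.le_ceil (t * m), mul_lt_mul_of_pos_right hy.2 hm']

/-- The sum of the first `q` coordinates. -/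
def partialSum {n : ℕ} (d : Fin n → ℝ) (q : ℕ) : ℝ := ∑ l : Fin n, if (l : ℕ) < q then d l else 0

lemma partialSum_eq {n : ℕ} (g : ℕ → ℝ) {q : ℕ} (hq : q ≤ n) :
    partialSum (fun l : Fin n => g (l + 1) - g l) q = g q - g 0 := by
  rw [partialSum, Fin.sum_univ_eq_sum_range (fun l => if l < q then g (l + 1) - g l else 0),
    ← Finset.sum_filter, ← Finset.sum_range_sub g q]
  congr 1
  ext l
  simp only [Finset.mem_filter, Finset.mem_range]
  omega

lemma abs_partialSum_sub_le {n : ℕ} (d d' : Fin n → ℝ) (q : ℕ) :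
    |partialSum d' q - partialSum d q| ≤ ∑ l, |d' l - d l| := by
  rw [partialSum, partialSum, ← Finset.sum_sub_distrib]
  refine (Finset.abs_sum_le_sum_abs _ _).trans (Finset.sum_le_sum fun l _ => ?_)
  split_ifs <;> simp

/-- The path with value `0` at `0`, constant on the intervals of a grid of mesh `1 / m` in
`[-m, m]`, with the prescribed jumps. -/
def stepPath (m : ℕ) (d : Fin (2 * m ^ 2) → ℝ) : CadlagPath where
  toFun t := partialSum d (⌊t * m⌋ + (m : ℤ) ^ 2).toNat - partialSum d (m ^ 2)
  rightCts t := by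
    refine (continuousWithinAt_const (b := partialSum d (⌊t * m⌋ + (m : ℤ) ^ 2).toNat
      - partialSum d (m ^ 2))).congr_of_eventuallyEq ?_ rfl
    filter_upwards [eventually_floor_right m t] with y hy
    rw [hy]
  leftLim t := by
    obtain ⟨c, hc⟩ := eventually_floor_left m t
    refine ⟨_, (tendsto_const_nhds (x := partialSum d (c + (m : ℤ) ^ 2).toNat
      - partialSum d (m ^ 2))).congr' ?_⟩
    filter_upwards [hc] with y hy
    rw [hy]

lemma continuous_stepPath (m : ℕ) : Continuous (stepPath m) := by
  refine continuous_iff_continuousAt.2 fun d => tendsto_iff_skorokhodEntourage.2 fun ε hε => ?_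
  have hc : Continuous fun d' : Fin (2 * m ^ 2) → ℝ => 2 * ∑ l, |d' l - d l| := by fun_prop
  have h0 := hc.tendsto d
  simp only [sub_self, abs_zero, Finset.sum_const_zero, mul_zero] at h0
  filter_upwards [h0.eventually (gt_mem_nhds hε)] with d' hd'
  refine mem_skorokhodEntourage_of_forall hε.le fun t _ => ?_
  have h1 := abs_partialSum_sub_le d d' (⌊t * m⌋ + (m : ℤ) ^ 2).toNat
  have h2 := abs_partialSum_sub_le d d' (m ^ 2)
  have h3 := abs_sub (partialSum d' (⌊t * m⌋ + (m : ℤ) ^ 2).toNat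
    - partialSum d (⌊t * m⌋ + (m : ℤ) ^ 2).toNat) (partialSum d' (m ^ 2) - partialSum d (m ^ 2))
  simp only [stepPath]
  rw [sub_sub_sub_comm]
  linarith

/-- The increments of a function over the grid of mesh `1 / m` in `[-m, m]`. -/
def gridIncr (m : ℕ) (f : ℝ → ℝ) (l : Fin (2 * m ^ 2)) : ℝ :=
  f ((((l : ℕ) + 1 : ℕ) - (m : ℝ) ^ 2) / m) - f (((l : ℕ) - (m : ℝ) ^ 2) / m)

lemma stepPath_gridIncr {m : ℕ} (hm : 0 < m) (f : ℝ → ℝ) {t : ℝ} (ht : |t| ≤ m) :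
    stepPath m (gridIncr m f) t = f (⌊t * m⌋ / m) - f 0 := by
  have hm' : (0 : ℝ) < m := by exact_mod_cast hm
  obtain ⟨h1, h2⟩ := abs_le.1 ht
  have h3 : -((m : ℤ) ^ 2) ≤ ⌊t * m⌋ := by
    rw [Int.le_floor]; push_cast; nlinarith
  have h4 : ⌊t * m⌋ ≤ (m : ℤ) ^ 2 := by
    have : (⌊t * m⌋ : ℝ) ≤ (m : ℝ) ^ 2 := (Int.floor_le _).trans (by nlinarith)
    exact_mod_cast this
  have hg : gridIncr m f = fun l : Fin (2 * m ^ 2) =>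
    (fun q : ℕ => f ((q - (m : ℝ) ^ 2) / m)) (l + 1)
      - (fun q : ℕ => f ((q - (m : ℝ) ^ 2) / m)) l := rfl
  have h5 : (((⌊t * m⌋ + (m : ℤ) ^ 2).toNat : ℕ) : ℝ) = ⌊t * m⌋ + (m : ℝ) ^ 2 := by
    have : (((⌊t * m⌋ + (m : ℤ) ^ 2).toNat : ℕ) : ℤ) = ⌊t * m⌋ + (m : ℤ) ^ 2 :=
      Int.toNat_of_nonneg (by linarith)
    exact_mod_cast this
  simp only [stepPath]
  rw [hg, partialSum_eq (fun q : ℕ => f ((q - (m : ℝ) ^ 2) / m)),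
    partialSum_eq (fun q : ℕ => f ((q - (m : ℝ) ^ 2) / m))]
  · simp only [h5]
    push_cast
    simp
  · omega
  · have : 2 * m ^ 2 = ((2 * (m : ℤ) ^ 2).toNat) := by norm_cast
    rw [this]
    exact Int.toNat_le_toNat (by linarith)

/-! ### Oscillations of cadlag functions -/

/-- Near `t` a cadlag path is almost constant on each side; only pairs straddling `t` see the jump.
-/
lemma CadlagPath.exists_local (f : CadlagPath) {ε : ℝ} (hε : 0 < ε) (t : ℝ) :
    ∃ r > 0, ∀ x y, t - r < x → x ≤ y → y < t + r → ¬ (x < t ∧ t ≤ y) → |f x - f y| ≤ ε := by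
  obtain ⟨l, hl⟩ := f.leftLim t
  have h1 := Metric.tendsto_nhds.1 hl (ε / 2) (by positivity)
  have h2 := Metric.tendsto_nhds.1 (f.rightCts t) (ε / 2) (by positivity)
  obtain ⟨a, ha, hsa⟩ := (mem_nhdsLT_iff_exists_Ioo_subset' (sub_one_lt t)).1 h1
  obtain ⟨b, hb, hsb⟩ := (mem_nhdsGE_iff_exists_Ico_subset' (lt_add_one t)).1 h2
  rw [mem_Iio] at ha
  rw [mem_Ioi] at hb
  refine ⟨min (t - a) (b - t), lt_min (by linarith) (by linarith), fun x y hx hxy hy hn => ?_⟩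
  have hr1 := min_le_left (t - a) (b - t)
  have hr2 := min_le_right (t - a) (b - t)
  have tri : ∀ c, dist (f x) c < ε / 2 → dist (f y) c < ε / 2 → |f x - f y| ≤ ε := fun c h h' => by
    rw [← Real.dist_eq]
    linarith [dist_triangle_right (f x) (f y) c]
  by_cases hxt : x < t
  · have hyt : y < t := by by_contra hc; exact hn ⟨hxt, not_lt.1 hc⟩
    exact tri l (hsa ⟨by linarith, hxt⟩) (hsa ⟨by linarith, hyt⟩)
  · rw [not_lt] at hxt
    exact tri (f t) (hsb ⟨hxt, by linarith⟩) (hsb ⟨by linarith, by linarith⟩)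

lemma CadlagPath.exists_partition (f : CadlagPath) {ε : ℝ} (hε : 0 < ε) (K : ℝ) :
    ∃ F : Finset ℝ, ∀ x y, -K ≤ x → x ≤ y → y ≤ K → (∀ p ∈ F, ¬ (x < p ∧ p ≤ y)) →
      |f x - f y| ≤ ε := by
  classical
  choose r hr hosc using f.exists_local hε
  obtain ⟨F, -, hF⟩ := isCompact_Icc.elim_nhds_subcover (s := Icc (-K) K)
    (fun t => Ioo (t - r t) (t + r t))
    fun t _ => Ioo_mem_nhds (by linarith [hr t]) (by linarith [hr t])
  -- The centres separate the two sides of each neighbourhood. The right ends are added so that an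
  -- interval starting in a neighbourhood and avoiding all these points cannot leave it.
  refine ⟨F ∪ F.image fun t => t + r t, fun x y hx hxy hy hno => ?_⟩
  obtain ⟨t, htF, htx⟩ := mem_iUnion₂.1 (hF ⟨hx, hxy.trans hy⟩)
  refine hosc t x y htx.1 hxy ?_ (hno t (Finset.mem_union_left _ htF))
  by_contra hc
  exact hno _ (Finset.mem_union_right _ (Finset.mem_image_of_mem _ htF)) ⟨htx.2, not_lt.1 hc⟩

/-- A function of height `1` at `p`, supported in `(p - d, p + d)`. -/
def tent (p d t : ℝ) : ℝ := max 0 (1 - |t - p| / d)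

lemma abs_tent_sub_le {d : ℝ} (hd : 0 < d) (p s t : ℝ) :
    |tent p d s - tent p d t| ≤ |s - t| / d := by
  refine (abs_max_sub_max_le_max _ _ _ _).trans ?_
  rw [sub_self, abs_zero, max_eq_right (abs_nonneg _), sub_sub_sub_cancel_left, ← sub_div, abs_div,
    abs_of_pos hd]
  refine div_le_div_of_nonneg_right ?_ hd.le
  rw [abs_sub_comm s t]
  simpa using abs_abs_sub_abs_le_abs_sub (t - p) (s - p)

lemma tent_nonneg (p d t : ℝ) : 0 ≤ tent p d t := le_max_left _ _

lemma tent_le_one {d : ℝ} (hd : 0 < d) (p t : ℝ) : tent p d t ≤ 1 :=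
  max_le zero_le_one (by linarith [div_nonneg (abs_nonneg (t - p)) hd.le])

lemma tent_self (p d : ℝ) : tent p d p = 1 := by simp [tent]

lemma tent_eq_zero {p d t : ℝ} (hd : 0 < d) (h : d ≤ |t - p|) : tent p d t = 0 :=
  max_eq_left (by rw [sub_nonpos, one_le_div hd]; exact h)

lemma continuous_tent (p d : ℝ) : Continuous (tent p d) := by unfold tent; fun_prop

/-- A finite set of points can be moved to nearby prescribed places by an increasing
homeomorphism close to the identity. -/
lemma exists_orderIso_of_shift (F : Finset ℝ) {ε : ℝ} (hε : 0 < ε) :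
    ∃ κ > 0, ∀ c : ℝ → ℝ, (∀ p ∈ F, |c p| ≤ κ) →
      ∃ τ : ℝ ≃o ℝ, (∀ t, |τ t - t| ≤ ε) ∧ ∀ p ∈ F, τ p = p + c p := by
  classical
  obtain ⟨d, hd, hsep⟩ : ∃ d > 0, ∀ p ∈ F, ∀ q ∈ F, p ≠ q → d ≤ |q - p| := by
    rcases (F.offDiag).eq_empty_or_nonempty with h | h
    · refine ⟨1, one_pos, fun p hp q hq hpq => ?_⟩
      have : (p, q) ∈ F.offDiag := Finset.mem_offDiag.2 ⟨hp, hq, hpq⟩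
      rw [h] at this; simp at this
    · obtain ⟨z, hz, hmin⟩ := Finset.exists_min_image F.offDiag (fun z => |z.2 - z.1|) h
      refine ⟨|z.2 - z.1|, abs_pos.2 (sub_ne_zero.2 (Finset.mem_offDiag.1 hz).2.2.symm),
        fun p hp q hq hpq => hmin (p, q) (Finset.mem_offDiag.2 ⟨hp, hq, hpq⟩)⟩
  have hn : (0 : ℝ) < F.card + 1 := by positivity
  refine ⟨min (ε / (F.card + 1)) (d / (F.card + 1)), lt_min (by positivity) (by positivity),
    fun c hc => ?_⟩
  have hc1 : ∀ p ∈ F, |c p| ≤ ε / (F.card + 1) := fun p hp => (hc p hp).trans (min_le_left _ _)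
  have hc2 : ∀ p ∈ F, |c p| ≤ d / (F.card + 1) := fun p hp => (hc p hp).trans (min_le_right _ _)
  -- The points of `F` are at mutual distance at least `d`, so the tent at one of them vanishes at
  -- the others. The total slope is below `1`, which keeps `t + g t` strictly increasing.
  let g : ℝ → ℝ := fun t => ∑ p ∈ F, c p * tent p d t
  have hcard : (F.card : ℝ) / (F.card + 1) < 1 := by rw [div_lt_one hn]; linarith
  have hg : ∀ t, |g t| ≤ ε := fun t => by
    calc |g t| ≤ ∑ p ∈ F, |c p * tent p d t| := Finset.abs_sum_le_sum_abs _ _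
      _ ≤ ∑ _p ∈ F, ε / (F.card + 1) := Finset.sum_le_sum fun p hp => by
        rw [abs_mul, abs_of_nonneg (tent_nonneg _ _ _)]
        exact (mul_le_of_le_one_right (abs_nonneg _) (tent_le_one hd _ _)).trans (hc1 p hp)
      _ = ε * (F.card / (F.card + 1)) := by rw [Finset.sum_const, nsmul_eq_mul]; ring
      _ ≤ ε := mul_le_of_le_one_right hε.le hcard.le
  have hlip : ∀ s t, s < t → |g s - g t| < t - s := fun s t hst => by
    calc |g s - g t| = |∑ p ∈ F, c p * (tent p d s - tent p d t)| := by
          simp only [g, ← Finset.sum_sub_distrib, mul_sub]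
      _ ≤ ∑ p ∈ F, |c p * (tent p d s - tent p d t)| := Finset.abs_sum_le_sum_abs _ _
      _ ≤ ∑ _p ∈ F, d / (F.card + 1) * ((t - s) / d) := Finset.sum_le_sum fun p hp => by
        rw [abs_mul]
        have := abs_tent_sub_le hd p s t
        rw [abs_sub_comm s t, abs_of_pos (sub_pos.2 hst)] at this
        exact mul_le_mul (hc2 p hp) this (abs_nonneg _) (by positivity)
      _ = (t - s) * (F.card / (F.card + 1)) := by
        rw [Finset.sum_const, nsmul_eq_mul]; field_simp
      _ < t - s := mul_lt_of_lt_one_right (by linarith) hcard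
  have hmono : StrictMono fun t => t + g t := fun s t hst => by
    have := (abs_lt.1 (hlip s t hst)).2
    simp only; linarith
  have hcont : Continuous fun t => t + g t :=
    continuous_id.add (continuous_finsetSum _ fun p _ => (continuous_tent p d).const_mul _)
  have hsurj : Function.Surjective fun t => t + g t := by
    refine hcont.surjective ?_ ?_
    · exact tendsto_atTop_mono (fun t => by simp only [id]; linarith [(abs_le.1 (hg t)).1])
        (tendsto_atTop_add_const_right _ (-ε) tendsto_id)
    · exact tendsto_atBot_mono (fun t => by simp only [id]; linarith [(abs_le.1 (hg t)).2])
        (tendsto_atBot_add_const_right _ ε tendsto_id)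
  refine ⟨hmono.orderIsoOfSurjective _ hsurj, fun t => ?_, fun p hp => ?_⟩
  · simpa using hg t
  · have : g p = c p := by
      simp only [g]
      rw [Finset.sum_eq_single p, tent_self, mul_one]
      · intro q hq hqp
        rw [tent_eq_zero hd (hsep q hq p hp hqp), mul_zero]
      · exact fun h => absurd hp h
    simp [this]

/-- Step approximations along finer and finer grids converge in Skorokhod's topology. -/
lemma tendsto_stepPath_gridIncr (f : CadlagPath) (h0 : f 0 = 0) :
    Tendsto (fun m => stepPath m (gridIncr m f)) atTop (𝓝 f) := by
  refine tendsto_iff_skorokhodEntourage.2 fun ε hε => ?_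
  obtain ⟨F, hF⟩ := f.exists_partition hε (1 / ε + ε + 1)
  obtain ⟨κ, hκ, hτ⟩ := exists_orderIso_of_shift F hε
  have e1 : ∀ᶠ m : ℕ in atTop, 1 / ε + ε + 1 ≤ (m : ℝ) :=
    tendsto_natCast_atTop_atTop.eventually_ge_atTop _
  have e2 : ∀ᶠ m : ℕ in atTop, 1 / κ ≤ (m : ℝ) :=
    tendsto_natCast_atTop_atTop.eventually_ge_atTop _
  filter_upwards [e1, e2] with m hm hmκ
  have hm1 : (1 : ℝ) ≤ m := by
    have : 0 < 1 / ε := by positivity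
    linarith
  have hm0 : (0 : ℝ) < m := by linarith
  have hm0' : 0 < m := by exact_mod_cast hm0
  -- Every partition point is moved to the first grid point not to the left of it, where the step
  -- path registers the jump.
  obtain ⟨τ, hτ1, hτ2⟩ := hτ (fun p => ⌈p * m⌉ / m - p) fun p _ => by
    have h1 : p ≤ ⌈p * m⌉ / m := by rw [le_div_iff₀ hm0]; exact Int.le_ceil _
    have h2 : (⌈p * m⌉ : ℝ) / m ≤ p + 1 / m := by
      rw [div_le_iff₀ hm0, add_mul, div_mul_cancel₀ _ hm0.ne']; exact (Int.ceil_lt_add_one _).le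
    have h3 : 1 / (m : ℝ) ≤ κ := by
      rw [div_le_iff₀ hm0]; rw [div_le_iff₀ hκ] at hmκ; linarith
    rw [abs_le]; constructor <;> linarith
  simp only [add_sub_cancel] at hτ2
  refine ⟨τ, hτ1, fun t ht => ?_⟩
  obtain ⟨a1, a2⟩ := abs_le.1 (hτ1 t)
  obtain ⟨b1, b2⟩ := abs_le.1 ht
  have q1 : (⌊τ t * m⌋ : ℝ) / m ≤ τ t := by rw [div_le_iff₀ hm0]; exact Int.floor_le _
  have q2 : τ t - 1 ≤ (⌊τ t * m⌋ : ℝ) / m := by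
    rw [le_div_iff₀ hm0]; nlinarith [Int.lt_floor_add_one (τ t * m)]
  have q3 : (⌊τ t * m⌋ : ℝ) / m * m = ⌊τ t * m⌋ := div_mul_cancel₀ _ hm0.ne'
  rw [stepPath_gridIncr hm0' _ (abs_le.2 ⟨by linarith, by linarith⟩), h0, sub_zero]
  -- No partition point separates `t` from the grid point below `τ t`, because `τ` maps partition
  -- points to grid points and preserves order.
  rcases le_total t ((⌊τ t * m⌋ : ℝ) / m) with h | h
  · rw [abs_sub_comm]
    refine hF _ _ (by linarith) h (by linarith) fun p hp ⟨hp1, hp2⟩ => ?_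
    have c1 : p * m ≤ ⌊τ t * m⌋ := by rw [← q3]; exact mul_le_mul_of_nonneg_right hp2 hm0.le
    have c2 : (⌈p * m⌉ : ℝ) ≤ ⌊τ t * m⌋ := by exact_mod_cast Int.ceil_le.2 c1
    have c3 : τ p ≤ (⌊τ t * m⌋ : ℝ) / m := by
      rw [hτ2 p hp]; exact div_le_div_of_nonneg_right c2 hm0.le
    linarith [τ.strictMono hp1]
  · refine hF _ _ (by linarith) h (by linarith) fun p hp ⟨hp1, hp2⟩ => ?_
    have c1 : (⌈p * m⌉ : ℝ) ≤ τ t * m := by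
      have := τ.monotone hp2
      rwa [hτ2 p hp, div_le_iff₀ hm0] at this
    have c2 : (⌈p * m⌉ : ℝ) ≤ ⌊τ t * m⌋ := by exact_mod_cast Int.le_floor.2 c1
    have c3 : p ≤ (⌊τ t * m⌋ : ℝ) / m := by
      rw [le_div_iff₀ hm0]; exact (Int.le_ceil _).trans c2
    linarith

lemma aemeasurable_gridIncr {α : Type*} [MeasurableSpace α] {μ : Measure α} {Y : α → CadlagPath}
    (hY : ∀ t, AEMeasurable (fun ω => Y ω t) μ) (m : ℕ) :
    AEMeasurable (fun ω => gridIncr m (Y ω)) μ :=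
  aemeasurable_pi_iff.2 fun _ => (hY _).sub (hY _)

/-- A random path which vanishes at `0` is measurable when its values are. -/
lemma aemeasurable_of_coordinates {α : Type*} [MeasurableSpace α] {μ : Measure α}
    {Y : α → CadlagPath} (hY : ∀ t, AEMeasurable (fun ω => Y ω t) μ) (h0 : ∀ᵐ ω ∂μ, Y ω 0 = 0) :
    AEMeasurable Y μ := by
  refine aemeasurable_of_tendsto_metrizable_ae atTop
    (f := fun m ω => stepPath m (gridIncr m (Y ω)))
    (fun m => (continuous_stepPath m).measurable.comp_aemeasurable (aemeasurable_gridIncr hY m)) ?_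
  filter_upwards [h0] with ω hω using tendsto_stepPath_gridIncr (Y ω) hω

/-! ### Sums of small independent centred variables -/

/-- Independent centred variables bounded by `1` with variance at most `v`. -/
structure IsNoise {Ω : Type*} [MeasurableSpace Ω] (X : ℕ → Ω → ℝ) (v : ℝ) (μ : Measure Ω) :
    Prop where
  measurable : ∀ i, Measurable (X i)
  indep : iIndepFun X μ
  abs_le : ∀ i ω, |X i ω| ≤ 1
  mean : ∀ i, ∫ ω, X i ω ∂μ = 0
  sq_le : ∀ i, ∫ ω, X i ω ^ 2 ∂μ ≤ v

/-- Partial sums. -/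
def psum {Ω : Type*} (X : ℕ → Ω → ℝ) (k : ℕ) (ω : Ω) : ℝ := ∑ i ∈ Finset.range k, X i ω

lemma integrable_of_abs_le {Ω : Type*} [MeasurableSpace Ω] {μ : Measure Ω} [IsFiniteMeasure μ]
    {f : Ω → ℝ} (hf : Measurable f) {C : ℝ} (h : ∀ ω, |f ω| ≤ C) : Integrable f μ :=
  Integrable.of_bound hf.aestronglyMeasurable C (ae_of_all _ h)

namespace IsNoise

variable {Ω : Type*} [MeasurableSpace Ω] {X : ℕ → Ω → ℝ} {v : ℝ} {μ : Measure Ω}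

lemma measurable_psum (h : IsNoise X v μ) (k : ℕ) : Measurable (psum X k) :=
  Finset.measurable_sum _ fun i _ => h.measurable i

lemma abs_psum_le (h : IsNoise X v μ) (k : ℕ) (ω : Ω) : |psum X k ω| ≤ k := by
  refine (Finset.abs_sum_le_sum_abs _ _).trans ?_
  refine (Finset.sum_le_sum fun i _ => h.abs_le i ω).trans ?_
  simp

lemma shift (h : IsNoise X v μ) (l : ℕ) : IsNoise (fun i => X (l + i)) v μ :=
  ⟨fun _ => h.measurable _, h.indep.precomp (add_right_injective l), fun _ => h.abs_le _,
    fun _ => h.mean _, fun _ => h.sq_le _⟩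

lemma integrable_pow_mul_pow [IsProbabilityMeasure μ] (h : IsNoise X v μ) (k p q : ℕ) :
    Integrable (fun ω => psum X k ω ^ p * X k ω ^ q) μ := by
  refine integrable_of_abs_le (C := (k : ℝ) ^ p * 1 ^ q)
    (((h.measurable_psum k).pow_const p).mul ((h.measurable k).pow_const q)) fun ω => ?_
  rw [abs_mul, abs_pow, abs_pow]
  exact mul_le_mul (pow_le_pow_left₀ (abs_nonneg _) (h.abs_psum_le k ω) _)
    (pow_le_pow_left₀ (abs_nonneg _) (h.abs_le k ω) _) (by positivity) (by positivity)

lemma integral_pow_mul_pow (h : IsNoise X v μ) (k p q : ℕ) :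
    ∫ ω, psum X k ω ^ p * X k ω ^ q ∂μ = (∫ ω, psum X k ω ^ p ∂μ) * ∫ ω, X k ω ^ q ∂μ := by
  have hi : IndepFun (psum X k) (X k) μ := by
    have := h.indep.indepFun_sum_range_succ h.measurable k
    have e : (∑ j ∈ Finset.range k, X j) = psum X k := by ext ω; simp [psum]
    rwa [e] at this
  exact (hi.comp (φ := fun x : ℝ => x ^ p) (ψ := fun x : ℝ => x ^ q) (by fun_prop)
    (by fun_prop)).integral_fun_mul_eq_mul_integral
    ((h.measurable_psum k).pow_const p).aestronglyMeasurable
    ((h.measurable k).pow_const q).aestronglyMeasurable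

lemma integrable_pow [IsProbabilityMeasure μ] (h : IsNoise X v μ) (k p : ℕ) : Integrable (fun ω => psum X k ω ^ p) μ := by
  simpa using h.integrable_pow_mul_pow k p 0

lemma variance_nonneg (h : IsNoise X v μ) : 0 ≤ v :=
  (integral_nonneg fun ω => sq_nonneg (X 0 ω)).trans (h.sq_le 0)

lemma integral_psum [IsProbabilityMeasure μ] (h : IsNoise X v μ) (k : ℕ) : ∫ ω, psum X k ω ∂μ = 0 := by
  simp only [psum]
  rw [integral_finsetSum _ fun i _ => integrable_of_abs_le (h.measurable i) (h.abs_le i)]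
  exact Finset.sum_eq_zero fun i _ => h.mean i

lemma integral_psum_succ_pow [IsProbabilityMeasure μ] (h : IsNoise X v μ) (k p : ℕ) :
    ∫ ω, psum X (k + 1) ω ^ p ∂μ = ∑ m ∈ Finset.range (p + 1),
      (∫ ω, psum X k ω ^ m ∂μ) * (∫ ω, X k ω ^ (p - m) ∂μ) * p.choose m := by
  have e : ∀ ω, psum X (k + 1) ω ^ p = ∑ m ∈ Finset.range (p + 1),
      psum X k ω ^ m * X k ω ^ (p - m) * p.choose m := fun ω => by
    rw [psum, Finset.sum_range_succ, add_pow]; rfl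
  simp only [e]
  rw [integral_finsetSum _ fun m _ => (h.integrable_pow_mul_pow k m (p - m)).mul_const _]
  refine Finset.sum_congr rfl fun m _ => ?_
  rw [integral_mul_const, h.integral_pow_mul_pow]

lemma integral_psum_sq_le [IsProbabilityMeasure μ] (h : IsNoise X v μ) (k : ℕ) :
    ∫ ω, psum X k ω ^ 2 ∂μ ≤ k * v := by
  induction k with
  | zero => simp [psum]
  | succ k ih =>
    rw [h.integral_psum_succ_pow]
    simp [Finset.sum_range_succ, h.mean]
    linarith [h.sq_le k]

/-- Expanding the fourth power, the terms linear in a centred factor vanish; `6 * (k * v) * v` from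
the middle term fits into the growth of `3 * (k * v) ^ 2`, and the fourth moment of one variable is
at most `v`. -/
lemma integral_psum_pow_four_le [IsProbabilityMeasure μ] (h : IsNoise X v μ) (k : ℕ) :
    ∫ ω, psum X k ω ^ 4 ∂μ ≤ 3 * (k * v) ^ 2 + k * v := by
  induction k with
  | zero => simp [psum]
  | succ k ih =>
    have h2 : ∫ ω, X k ω ^ 4 ∂μ ≤ v := by
      refine le_trans (integral_mono ?_ ?_ fun ω => ?_) (h.sq_le k)
      · simpa using h.integrable_pow_mul_pow k 0 4
      · simpa using h.integrable_pow_mul_pow k 0 2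
      · have h1 : X k ω ^ 2 ≤ 1 := by
          rw [sq_le_one_iff_abs_le_one]; exact h.abs_le k ω
        simp only
        nlinarith [sq_nonneg (X k ω)]
    have h3 : (∫ ω, psum X k ω ^ 2 ∂μ) * ∫ ω, X k ω ^ 2 ∂μ ≤ k * v * v :=
      mul_le_mul (h.integral_psum_sq_le k) (h.sq_le k) (integral_nonneg fun ω => sq_nonneg _)
        (mul_nonneg (Nat.cast_nonneg _) h.variance_nonneg)
    rw [h.integral_psum_succ_pow]
    simp [Finset.sum_range_succ, h.mean, h.integral_psum, Nat.choose]
    nlinarith [sq_nonneg v]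

/-- The first time at which the partial sums reach `c` in absolute value is `k`. -/
def firstPassage (X : ℕ → Ω → ℝ) (c : ℝ) (k : ℕ) : Set Ω :=
  {ω | c ≤ |psum X k ω| ∧ ∀ j < k, |psum X j ω| < c}

/-- First passage at `k` depends on the variables before `k`, the later increment on the remaining
ones, and the latter is centred. -/
lemma integral_firstPassage_mul (h : IsNoise X v μ) (c : ℝ) {k N : ℕ} (hk : k ≤ N) :
    ∫ ω, (firstPassage X c k).indicator (fun ω => psum X k ω ^ 3) ω
      * (psum X N ω - psum X k ω) ∂μ = 0 := by
  classical
  have hprob : IsProbabilityMeasure μ := h.indep.isProbabilityMeasure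
  let mk (S : Set ℕ) : MeasurableSpace Ω := ⨆ i ∈ S, MeasurableSpace.comap (X i) inferInstance
  have hX : ∀ (S : Set ℕ), ∀ i ∈ S, Measurable[mk S] (X i) := fun S i hi =>
    (comap_measurable (X i)).mono (le_biSup (fun i => MeasurableSpace.comap (X i) inferInstance) hi)
      le_rfl
  have hS : ∀ j ≤ k, Measurable[mk (Iio k)] (psum X j) := fun j hj =>
    Finset.measurable_sum _ fun i hi => hX _ i ((Finset.mem_range.1 hi).trans_le hj)
  have hA : MeasurableSet[mk (Iio k)] (firstPassage X c k) := by
    refine MeasurableSet.inter ?_ ?_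
    · exact measurableSet_le measurable_const
        (continuous_abs.measurable.comp (hS k le_rfl))
    · have : {ω | ∀ j < k, |psum X j ω| < c} = ⋂ j ∈ Finset.range k, {ω | |psum X j ω| < c} := by
        ext ω; simp
      change MeasurableSet[mk (Iio k)] {ω | ∀ j < k, |psum X j ω| < c}
      rw [this]
      exact Finset.measurableSet_biInter _ fun j hj => measurableSet_lt
        (continuous_abs.measurable.comp (hS j (Finset.mem_range.1 hj).le)) measurable_const
  have hf : Measurable[mk (Iio k)] ((firstPassage X c k).indicator fun ω => psum X k ω ^ 3) :=
    Measurable.indicator ((hS k le_rfl).pow_const 3) hA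
  have hdiff : (fun ω => psum X N ω - psum X k ω) = fun ω => ∑ i ∈ Finset.Ico k N, X i ω := by
    ext ω; rw [Finset.sum_Ico_eq_sub _ hk]; rfl
  have hg : Measurable[mk (Ici k)] fun ω => psum X N ω - psum X k ω := by
    rw [hdiff]
    exact Finset.measurable_sum _ fun i hi => hX _ i (Finset.mem_Ico.1 hi).1
  have hle : ∀ S, mk S ≤ ‹MeasurableSpace Ω› := fun S =>
    iSup₂_le fun i _ => (h.measurable i).comap_le
  have hind : Indep (mk (Iio k)) (mk (Ici k)) μ := indep_iSup_of_disjoint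
    (fun i => (h.measurable i).comap_le) h.indep
    (Set.disjoint_left.2 fun i (h1 : i < k) h2 => absurd h1 (not_lt.2 h2))
  have hindf : IndepFun ((firstPassage X c k).indicator fun ω => psum X k ω ^ 3)
      (fun ω => psum X N ω - psum X k ω) μ :=
    indep_of_indep_of_le_left (indep_of_indep_of_le_right hind hg.comap_le) hf.comap_le
  rw [hindf.integral_fun_mul_eq_mul_integral (hf.mono (hle _) le_rfl).aestronglyMeasurable
    (hg.mono (hle _) le_rfl).aestronglyMeasurable]
  have : ∫ ω, (psum X N ω - psum X k ω) ∂μ = 0 := by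
    rw [hdiff, integral_finsetSum _ fun i _ => integrable_of_abs_le (h.measurable i) (h.abs_le i)]
    exact Finset.sum_eq_zero fun i _ => h.mean i
  rw [this, mul_zero]

lemma measurableSet_firstPassage (h : IsNoise X v μ) (c : ℝ) (k : ℕ) :
    MeasurableSet (firstPassage X c k) := by
  have : firstPassage X c k = {ω | c ≤ |psum X k ω|} ∩ ⋂ j ∈ Finset.range k,
      {ω | |psum X j ω| < c} := by
    ext ω; simp [firstPassage]
  rw [this]
  exact (measurableSet_le measurable_const (continuous_abs.measurable.comp
    (h.measurable_psum k))).inter (Finset.measurableSet_biInter _ fun j _ =>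
      measurableSet_lt (continuous_abs.measurable.comp (h.measurable_psum j)) measurable_const)

/-- A maximal inequality with fourth moments. -/
lemma measureReal_exists_le [IsProbabilityMeasure μ] (h : IsNoise X v μ) {c : ℝ} (hc : 0 < c) (N : ℕ) :
    μ.real {ω | ∃ k ≤ N, c ≤ |psum X k ω|} ≤ (3 * (N * v) ^ 2 + N * v) / c ^ 4 := by
  classical
  have hsub : {ω | ∃ k ≤ N, c ≤ |psum X k ω|} ⊆ ⋃ k ∈ Finset.range (N + 1), firstPassage X c k := by
    rintro ω ⟨k, hk, hck⟩
    have hex : ∃ k, c ≤ |psum X k ω| := ⟨k, hck⟩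
    refine mem_iUnion₂.2 ⟨Nat.find hex, Finset.mem_range.2 ?_, Nat.find_spec hex, fun j hj =>
      not_le.1 (Nat.find_min hex hj)⟩
    exact Nat.lt_succ_of_le ((Nat.find_min' hex hck).trans hk)
  -- The tangent of `x ^ 4` at `psum X k` bounds `psum X N ^ 4` from below; on first passage at `k`
  -- the constant term is at least `c ^ 4`, and the linear term has mean zero. The first-passage
  -- events are disjoint, so these lower bounds may be added.
  let G : ℕ → Ω → ℝ := fun k ω => (firstPassage X c k).indicator (fun _ => c ^ 4) ω
    + 4 * ((firstPassage X c k).indicator (fun ω => psum X k ω ^ 3) ω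
      * (psum X N ω - psum X k ω))
  have hi1 : ∀ k, Integrable ((firstPassage X c k).indicator fun _ => c ^ 4) μ := fun k =>
    (integrable_const _).indicator (h.measurableSet_firstPassage c k)
  have hi2 : ∀ k, Integrable (fun ω => (firstPassage X c k).indicator (fun ω => psum X k ω ^ 3) ω
      * (psum X N ω - psum X k ω)) μ := fun k => by
    refine integrable_of_abs_le (C := (k : ℝ) ^ 3 * (N + k))
      ((((h.measurable_psum k).pow_const 3).indicator (h.measurableSet_firstPassage c k)).mul
      ((h.measurable_psum N).sub (h.measurable_psum k))) fun ω => ?_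
    rw [abs_mul]
    refine mul_le_mul ?_ ?_ (abs_nonneg _) (by positivity)
    · rw [← Real.norm_eq_abs]
      refine (norm_indicator_le_norm_self _ _).trans ?_
      rw [Real.norm_eq_abs, abs_pow]
      exact pow_le_pow_left₀ (abs_nonneg _) (h.abs_psum_le k ω) _
    · exact (abs_sub _ _).trans (add_le_add (h.abs_psum_le N ω) (h.abs_psum_le k ω))
  have hG : ∀ k, Integrable (G k) μ := fun k => (hi1 k).add ((hi2 k).const_mul 4)
  have hGI : ∀ k ∈ Finset.range (N + 1), ∫ ω, G k ω ∂μ = c ^ 4 * μ.real (firstPassage X c k) := by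
    intro k hk
    simp only [G]
    rw [integral_add (hi1 k) ((hi2 k).const_mul 4), integral_const_mul,
      h.integral_firstPassage_mul c (Nat.le_of_lt_succ (Finset.mem_range.1 hk)),
      integral_indicator (h.measurableSet_firstPassage c k), setIntegral_const, smul_eq_mul]
    ring
  have hpt : ∀ ω, ∑ k ∈ Finset.range (N + 1), G k ω ≤ psum X N ω ^ 4 := by
    intro ω
    have hone : ∀ k, ω ∉ firstPassage X c k → G k ω = 0 := fun k hk => by simp [G, hk]
    by_cases hex : ∃ k ∈ Finset.range (N + 1), ω ∈ firstPassage X c k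
    · obtain ⟨k, hk, hω⟩ := hex
      rw [Finset.sum_eq_single_of_mem k hk]
      · simp only [G, indicator_of_mem hω]
        have h4 : c ^ 4 ≤ psum X k ω ^ 4 := by
          have := pow_le_pow_left₀ hc.le hω.1 4
          rwa [Even.pow_abs (by decide)] at this
        -- The identity behind this is `y ^ 4 - x ^ 4 - 4 * x ^ 3 * (y - x) = (y - x) ^ 2 * ((y + x)
        -- ^ 2 + 2 * x ^ 2)`.
        nlinarith [mul_nonneg (sq_nonneg (psum X N ω - psum X k ω))
          (add_nonneg (sq_nonneg (psum X N ω + psum X k ω))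
            (mul_nonneg zero_le_two (sq_nonneg (psum X k ω))))]
      · intro j _ hjk
        refine hone j fun hj => ?_
        rcases lt_or_gt_of_ne hjk with hlt | hlt
        · exact absurd (hω.2 j hlt) (not_lt.2 hj.1)
        · exact absurd (hj.2 k hlt) (not_lt.2 hω.1)
    · push Not at hex
      rw [Finset.sum_eq_zero fun k hk => hone k (hex k hk)]
      positivity
  have hint : c ^ 4 * ∑ k ∈ Finset.range (N + 1), μ.real (firstPassage X c k)
      ≤ 3 * (N * v) ^ 2 + N * v := by
    rw [Finset.mul_sum, ← Finset.sum_congr rfl hGI, ← integral_finsetSum _ fun k _ => hG k]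
    exact (integral_mono (integrable_finsetSum _ fun k _ => hG k) (h.integrable_pow N 4) hpt).trans
      (h.integral_psum_pow_four_le N)
  rw [le_div_iff₀ (by positivity), mul_comm]
  refine le_trans (mul_le_mul_of_nonneg_left ?_ (by positivity)) hint
  exact (measureReal_mono hsub (measure_ne_top μ _)).trans (measureReal_biUnion_finset_le _ _)

end IsNoise

/-! ### Characteristic functions of block sums -/

open Complex in
lemma integral_cexp_sum {Ω : Type*} [MeasurableSpace Ω] {μ : Measure Ω} {X : ℕ → Ω → ℝ}
    (hm : ∀ i, AEMeasurable (X i) μ) (h : iIndepFun X μ) (κ : ℕ → ℝ) (N : ℕ) :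
    ∫ ω, cexp (((∑ i ∈ Finset.range N, κ i * X i ω : ℝ) : ℂ) * I) ∂μ
      = ∏ i ∈ Finset.range N, ∫ ω, cexp (((κ i * X i ω : ℝ) : ℂ) * I) ∂μ := by
  have hY : iIndepFun (fun i ω => κ i * X i ω) μ :=
    h.comp (fun i x => κ i * x) fun i => by fun_prop
  have hYm : ∀ i, AEMeasurable (fun ω => κ i * X i ω) μ := fun i => (hm i).const_mul _
  have key := congrFun ((hY.restrict (Finset.range N)).charFun_map_fun_finsetSum_eq_prod
    fun i _ => hYm i) 1
  rw [Finset.prod_apply] at key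
  simp only [charFun_apply_real] at key
  rw [integral_map (Finset.aemeasurable_fun_sum _ fun i _ => hYm i) (by fun_prop)] at key
  simp only [ofReal_one, one_mul] at key
  rw [key]
  refine Finset.prod_congr rfl fun i _ => ?_
  rw [integral_map (hYm i) (by fun_prop)]

lemma IsNoise.integral_cexp_blocks {Ω : Type*} [MeasurableSpace Ω] {μ : Measure Ω} {X : ℕ → Ω → ℝ}
    {v : ℝ} (h : IsNoise X v μ) {φ : ℝ → ℂ}
    (hφ : ∀ i θ, ∫ ω, Complex.exp (((θ * X i ω : ℝ) : ℂ) * Complex.I) ∂μ = φ θ) (t : ℕ → ℝ)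
    {e : ℕ → ℕ} (he : Monotone e) (n : ℕ) :
    ∫ ω, Complex.exp (((∑ l ∈ Finset.range n, t l * (psum X (e (l + 1)) ω - psum X (e l) ω) : ℝ)
      : ℂ) * Complex.I) ∂μ = ∏ l ∈ Finset.range n, φ (t l) ^ (e (l + 1) - e l) := by
  have hμ : IsProbabilityMeasure μ := h.indep.isProbabilityMeasure
  have hφ0 : φ 0 = 1 := by rw [← hφ 0 0]; simp
  obtain ⟨κ, hκ1, hκ2⟩ : ∃ κ : ℕ → ℝ,
      (∀ ω, ∑ l ∈ Finset.range n, t l * (psum X (e (l + 1)) ω - psum X (e l) ω)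
        = ∑ i ∈ Finset.range (e n), κ i * X i ω) ∧
      ∏ i ∈ Finset.range (e n), φ (κ i)
        = ∏ l ∈ Finset.range n, φ (t l) ^ (e (l + 1) - e l) := by
    induction n with
    -- Variables before `e 0` belong to no block; they get weight `0` and contribute the factor `φ 0
    -- = 1`.
    | zero => exact ⟨fun _ => 0, by simp, by simp [hφ0]⟩
    | succ n ih =>
      obtain ⟨κ, h1, h2⟩ := ih
      refine ⟨fun i => if i < e n then κ i else t n, fun ω => ?_, ?_⟩
      · rw [Finset.sum_range_succ, h1, ← Finset.sum_range_add_sum_Ico _ (he n.le_succ)]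
        congr 1
        · exact Finset.sum_congr rfl fun i hi => by beta_reduce; rw [if_pos (Finset.mem_range.1 hi)]
        · rw [psum, psum, ← Finset.sum_Ico_eq_sub _ (he n.le_succ), Finset.mul_sum]
          exact Finset.sum_congr rfl fun i hi => by
            beta_reduce; rw [if_neg (not_lt.2 (Finset.mem_Ico.1 hi).1)]
      · rw [Finset.prod_range_succ, ← h2, ← Finset.prod_range_mul_prod_Ico _ (he n.le_succ)]
        congr 1
        · exact Finset.prod_congr rfl fun i hi => by beta_reduce; rw [if_pos (Finset.mem_range.1 hi)]
        · rw [Finset.prod_congr rfl (g := fun _ => φ (t n)) fun i hi => by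
            beta_reduce; rw [if_neg (not_lt.2 (Finset.mem_Ico.1 hi).1)]]
          simp
  simp only [hκ1]
  rw [integral_cexp_sum (fun i => (h.measurable i).aemeasurable) h.indep, ← hκ2]
  exact Finset.prod_congr rfl fun i _ => hφ i _

/-- Second-order Taylor expansion of the exponential; `|X| ≤ 1` turns the cubic remainder into a
multiple of the variance, which keeps the error small for sparse variables. -/
lemma norm_integral_cexp_sub_le {Ω : Type*} [MeasurableSpace Ω] {μ : Measure Ω}
    [IsProbabilityMeasure μ] {X : Ω → ℝ} (hm : Measurable X) (hb : ∀ ω, |X ω| ≤ 1)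
    (h0 : ∫ ω, X ω ∂μ = 0) {θ : ℝ} (hθ : |θ| ≤ 1) :
    ‖∫ ω, Complex.exp (((θ * X ω : ℝ) : ℂ) * Complex.I) ∂μ
      - ((1 - (∫ ω, X ω ^ 2 ∂μ) * θ ^ 2 / 2 : ℝ) : ℂ)‖ ≤ |θ| ^ 3 * ∫ ω, X ω ^ 2 ∂μ := by
  have hi1 : Integrable X μ := integrable_of_abs_le hm hb
  have hi2 : Integrable (fun ω => X ω ^ 2) μ :=
    integrable_of_abs_le (C := 1) (hm.pow_const 2) fun ω => by
      rw [abs_pow]; exact pow_le_one₀ (abs_nonneg _) (hb ω)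
  have hie : Integrable (fun ω => Complex.exp (((θ * X ω : ℝ) : ℂ) * Complex.I)) μ :=
    Integrable.of_bound (by fun_prop) 1 (ae_of_all _ fun ω => by
      rw [Complex.norm_exp_ofReal_mul_I])
  let p : Ω → ℂ := fun ω => 1 + ((θ * X ω : ℝ) : ℂ) * Complex.I - ((θ ^ 2 / 2 * X ω ^ 2 : ℝ) : ℂ)
  have hj1 : Integrable (fun ω => ((θ * X ω : ℝ) : ℂ) * Complex.I) μ :=
    ((hi1.const_mul θ).ofReal).mul_const _
  have hj2 : Integrable (fun ω => ((θ ^ 2 / 2 * X ω ^ 2 : ℝ) : ℂ)) μ := (hi2.const_mul _).ofReal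
  have hp : Integrable p μ := ((integrable_const 1).add hj1).sub hj2
  have hpI : ∫ ω, p ω ∂μ = ((1 - (∫ ω, X ω ^ 2 ∂μ) * θ ^ 2 / 2 : ℝ) : ℂ) := by
    have e1 : ∫ ω, p ω ∂μ = ∫ ω, (1 + ((θ * X ω : ℝ) : ℂ) * Complex.I) ∂μ
        - ∫ ω, ((θ ^ 2 / 2 * X ω ^ 2 : ℝ) : ℂ) ∂μ := integral_sub ((integrable_const 1).add hj1) hj2
    rw [e1, integral_add (integrable_const 1) hj1, integral_mul_const,
      integral_complex_ofReal, integral_complex_ofReal, integral_const_mul, integral_const_mul, h0]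
    simp
    ring
  rw [← hpI, ← integral_sub hie hp, ← integral_const_mul]
  refine norm_integral_le_of_norm_le (hi2.const_mul _) (ae_of_all _ fun ω => ?_)
  have hx : ‖((θ * X ω : ℝ) : ℂ) * Complex.I‖ = |θ| * |X ω| := by
    rw [norm_mul, Complex.norm_I, mul_one, Complex.norm_real, Real.norm_eq_abs, abs_mul]
  have hx1 : ‖((θ * X ω : ℝ) : ℂ) * Complex.I‖ ≤ 1 := by
    rw [hx]; exact mul_le_one₀ hθ (abs_nonneg _) (hb ω)
  have hb3 := Complex.exp_bound hx1 (n := 3) (by norm_num)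
  have e : ∑ m ∈ Finset.range 3, (((θ * X ω : ℝ) : ℂ) * Complex.I) ^ m / (m.factorial : ℂ)
      = p ω := by
    simp only [p, Finset.sum_range_succ, Finset.sum_range_zero, mul_pow, Complex.I_sq]
    simp [Nat.factorial]
    ring
  rw [e, hx] at hb3
  refine hb3.trans ?_
  have h3 : |X ω| ^ 3 ≤ X ω ^ 2 := by
    have e3 : |X ω| ^ 3 = X ω ^ 2 * |X ω| := by rw [pow_succ, sq_abs]
    rw [e3]
    exact mul_le_of_le_one_right (sq_nonneg _) (hb ω)
  calc (|θ| * |X ω|) ^ 3 * ((Nat.succ 3 : ℝ) * ((Nat.factorial 3) * (3 : ℕ) : ℝ)⁻¹)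
      ≤ (|θ| * |X ω|) ^ 3 * 1 := by
        refine mul_le_mul_of_nonneg_left ?_ (by positivity)
        norm_num [Nat.factorial]
    _ = |θ| ^ 3 * |X ω| ^ 3 := by ring
    _ ≤ |θ| ^ 3 * X ω ^ 2 := mul_le_mul_of_nonneg_left h3 (by positivity)

lemma norm_pow_sub_pow_le_mul {z w : ℂ} (hz : ‖z‖ ≤ 1) (hw : ‖w‖ ≤ 1) (n : ℕ) :
    ‖z ^ n - w ^ n‖ ≤ n * ‖z - w‖ := by
  induction n with
  | zero => simp
  | succ n ih =>
    have e : z ^ (n + 1) - w ^ (n + 1) = z * (z ^ n - w ^ n) + (z - w) * w ^ n := by ring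
    rw [e]
    refine (norm_add_le _ _).trans ?_
    rw [norm_mul, norm_mul, norm_pow]
    have h1 : ‖z‖ * ‖z ^ n - w ^ n‖ ≤ n * ‖z - w‖ :=
      (mul_le_of_le_one_left (norm_nonneg _) hz).trans ih
    have h2 : ‖z - w‖ * ‖w‖ ^ n ≤ ‖z - w‖ :=
      mul_le_of_le_one_right (norm_nonneg _) (pow_le_one₀ (norm_nonneg _) hw)
    push_cast
    linarith

/-- The characteristic function of a centred Bernoulli variable. -/
def berChar (a θ : ℝ) : ℂ :=
  ∫ b, Complex.exp (((θ * ((b.toNat : ℝ) - a) : ℝ) : ℂ) * Complex.I) ∂(ber a)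

lemma norm_berChar_le (a θ : ℝ) : ‖berChar a θ‖ ≤ 1 := by
  refine (norm_integral_le_of_norm_le_const (C := 1) (ae_of_all _ fun b => ?_)).trans ?_
  · rw [Complex.norm_exp_ofReal_mul_I]
  · simp

lemma norm_berChar_pow_sub_le {a θ : ℝ} (h0 : 0 ≤ a) (h1 : a ≤ 1) (hθ : |θ| ≤ 1) (N : ℕ) :
    ‖berChar a θ ^ N - Complex.exp ((-(N * (a * (1 - a)) * θ ^ 2 / 2) : ℝ) : ℂ)‖
      ≤ N * (|θ| ^ 3 * a + a ^ 2 * θ ^ 4) := by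
  have hw0 : 0 ≤ a * (1 - a) := mul_nonneg h0 (by linarith)
  have hw1 : a * (1 - a) ≤ a := by nlinarith
  have hb : ∀ b : Bool, |(b.toNat : ℝ) - a| ≤ 1 := fun b => by
    rw [abs_le]; cases b <;> constructor <;> norm_num <;> linarith
  have hq := norm_integral_cexp_sub_le (μ := ber a) (X := fun b : Bool => (b.toNat : ℝ) - a)
    .of_discrete hb (by rw [integral_ber h0 h1]; simp; ring) hθ
  have hsq : ∫ b : Bool, ((b.toNat : ℝ) - a) ^ 2 ∂(ber a) = a * (1 - a) := by
    rw [integral_ber h0 h1]; simp; ring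
  rw [hsq] at hq
  have hθ2 : θ ^ 2 ≤ 1 := by rwa [sq_le_one_iff_abs_le_one]
  have hx : |(-(a * (1 - a) * θ ^ 2 / 2))| ≤ 1 := by
    rw [abs_neg, abs_of_nonneg (by positivity)]
    nlinarith [mul_le_mul hw1 hθ2 (sq_nonneg _) h0]
  have he := Real.abs_exp_sub_one_sub_id_le hx
  have hex : Complex.exp ((-(N * (a * (1 - a)) * θ ^ 2 / 2) : ℝ) : ℂ)
      = ((Real.exp (-(a * (1 - a) * θ ^ 2 / 2)) : ℝ) : ℂ) ^ N := by
    rw [Complex.ofReal_exp, ← Complex.exp_nat_mul]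
    congr 1; push_cast; ring
  rw [hex]
  refine (norm_pow_sub_pow_le_mul (norm_berChar_le a θ) ?_ N).trans ?_
  · rw [Complex.norm_real, Real.norm_eq_abs, Real.abs_exp, Real.exp_le_one_iff]
    have : 0 ≤ a * (1 - a) * θ ^ 2 / 2 := by positivity
    linarith
  · refine mul_le_mul_of_nonneg_left ?_ (Nat.cast_nonneg _)
    have e2 : ‖((1 - a * (1 - a) * θ ^ 2 / 2 : ℝ) : ℂ)
        - ((Real.exp (-(a * (1 - a) * θ ^ 2 / 2)) : ℝ) : ℂ)‖ ≤ a ^ 2 * θ ^ 4 := by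
      rw [← Complex.ofReal_sub, Complex.norm_real, Real.norm_eq_abs, abs_sub_comm]
      have e3 : Real.exp (-(a * (1 - a) * θ ^ 2 / 2)) - (1 - a * (1 - a) * θ ^ 2 / 2)
          = Real.exp (-(a * (1 - a) * θ ^ 2 / 2)) - 1 - -(a * (1 - a) * θ ^ 2 / 2) := by ring
      rw [e3]
      refine he.trans ?_
      have h5 : (a * (1 - a)) ^ 2 ≤ a ^ 2 := pow_le_pow_left₀ hw0 hw1 2
      have h6 : 0 ≤ θ ^ 4 := by positivity
      nlinarith [mul_le_mul_of_nonneg_right h5 h6, mul_nonneg (sq_nonneg a) h6]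
    calc _ ≤ _ := norm_sub_le_norm_sub_add_norm_sub _ _ _
      _ ≤ |θ| ^ 3 * a + a ^ 2 * θ ^ 4 := by
        refine add_le_add (hq.trans ?_) e2
        exact mul_le_mul_of_nonneg_left hw1 (by positivity)

/-- In this sparse regime the variance `a * (1 - a)` is asymptotic to `a`, and the error is the
convergent quantity `N * a / c ^ 2` times factors tending to zero. -/
lemma tendsto_berChar_pow {a c : ℕ → ℝ} {N : ℕ → ℕ} {ρ : ℝ} (h0 : ∀ k, 0 ≤ a k)
    (h1 : ∀ k, a k ≤ 1) (ha : Tendsto a atTop (𝓝 0)) (hc : Tendsto c atTop atTop)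
    (hN : Tendsto (fun k => N k * a k / c k ^ 2) atTop (𝓝 ρ)) (t : ℝ) :
    Tendsto (fun k => berChar (a k) (t / c k) ^ N k) atTop
      (𝓝 (Complex.exp ((-(ρ * t ^ 2 / 2) : ℝ) : ℂ))) := by
  have hinv : Tendsto (fun k => t / c k) atTop (𝓝 0) := tendsto_const_nhds.div_atTop hc
  have habs : Tendsto (fun k => |t / c k|) atTop (𝓝 0) := by simpa using hinv.abs
  have hmain : Tendsto (fun k => Complex.exp
      ((-(N k * (a k * (1 - a k)) * (t / c k) ^ 2 / 2) : ℝ) : ℂ)) atTop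
      (𝓝 (Complex.exp ((-(ρ * t ^ 2 / 2) : ℝ) : ℂ))) := by
    refine (Complex.continuous_exp.tendsto _).comp ((Complex.continuous_ofReal.tendsto _).comp ?_)
    have h := ((hN.mul (tendsto_const_nhds (x := (1 : ℝ)).sub ha)).mul_const (t ^ 2 / 2)).neg
    simp only [sub_zero, mul_one] at h
    convert h using 2
    · ring
    · ring
  have herr : Tendsto (fun k => N k * (|t / c k| ^ 3 * a k + a k ^ 2 * (t / c k) ^ 4)) atTop
      (𝓝 0) := by
    have h := ((hN.mul habs).mul_const (t ^ 2)).add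
      (((hN.mul ha).mul_const (t ^ 2)).mul (hinv.pow 2))
    simp only [mul_zero, zero_mul, add_zero] at h
    refine h.congr fun k => ?_
    have : |t / c k| ^ 3 = |t / c k| * (t / c k) ^ 2 := by rw [← sq_abs]; ring
    rw [this]
    ring
  refine (tendsto_iff_of_dist (f₁ := fun k => Complex.exp
      ((-(N k * (a k * (1 - a k)) * (t / c k) ^ 2 / 2) : ℝ) : ℂ)) ?_).1 hmain
  refine squeeze_zero' (Eventually.of_forall fun _ => dist_nonneg) ?_ herr
  filter_upwards [habs.eventually (ge_mem_nhds one_pos)] with k hk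
  rw [dist_comm, dist_eq_norm]
  exact norm_berChar_pow_sub_le (h0 k) (h1 k) hk (N k)

/-- The centred coordinates of a Bernoulli sequence. -/
def centred (a : ℝ) (i : ℕ) (x : ℕ → Bool) : ℝ := (x i).toNat - a

lemma isNoise_centred {a : ℝ} (h0 : 0 ≤ a) (h1 : a ≤ 1) : IsNoise (centred a) a (berSeq ℕ a) where
  measurable i := ((Measurable.of_discrete (f := fun b : Bool => (b.toNat : ℝ) - a)).comp
    (measurable_pi_apply i))
  indep := (iIndepFun_berSeq a).comp (fun _ (b : Bool) => (b.toNat : ℝ) - a) fun _ => .of_discrete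
  abs_le i x := by
    rw [centred, abs_le]; cases x i <;> constructor <;> norm_num <;> linarith
  mean i := by
    have h := (hasLaw_apply_berSeq a i).integral_comp (f := fun b : Bool => (b.toNat : ℝ) - a)
      .of_discrete
    simp only [Function.comp_def] at h
    simp only [centred]
    rw [h, integral_ber h0 h1]; simp; ring
  sq_le i := by
    have h := (hasLaw_apply_berSeq a i).integral_comp
      (f := fun b : Bool => ((b.toNat : ℝ) - a) ^ 2) .of_discrete
    simp only [Function.comp_def] at h
    simp only [centred]
    rw [h, integral_ber h0 h1]; simp; nlinarith

lemma psum_centred (a : ℝ) (k : ℕ) (x : ℕ → Bool) : psum (centred a) k x = count x k - k * a := by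
  simp [psum, centred, count]

lemma integral_cexp_centred (a : ℝ) (i : ℕ) (θ : ℝ) :
    ∫ x, Complex.exp (((θ * centred a i x : ℝ) : ℂ) * Complex.I) ∂(berSeq ℕ a) = berChar a θ := by
  have h := (hasLaw_apply_berSeq a i).integral_comp
    (f := fun b : Bool => Complex.exp (((θ * ((b.toNat : ℝ) - a) : ℝ) : ℂ) * Complex.I))
    .of_discrete
  simp only [Function.comp_def] at h
  simpa only [centred, berChar] using h

/-- Normalised block sums of Bernoulli sequences are asymptotically independent and Gaussian. -/
lemma tendsto_integral_cexp_blocks {a c : ℕ → ℝ} {e : ℕ → ℕ → ℕ} {ρ : ℝ} (h0 : ∀ k, 0 ≤ a k)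
    (h1 : ∀ k, a k ≤ 1) (ha : Tendsto a atTop (𝓝 0)) (hc : Tendsto c atTop atTop)
    (he : ∀ k, Monotone (e k))
    (hN : ∀ l, Tendsto (fun k => ((e k (l + 1) - e k l : ℕ) : ℝ) * a k / c k ^ 2) atTop (𝓝 ρ))
    (t : ℕ → ℝ) (n : ℕ) :
    Tendsto (fun k => ∫ x, Complex.exp (((∑ l ∈ Finset.range n, t l *
        ((psum (centred (a k)) (e k (l + 1)) x - psum (centred (a k)) (e k l) x) / c k) : ℝ) : ℂ)
        * Complex.I) ∂(berSeq ℕ (a k))) atTop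
      (𝓝 (∏ l ∈ Finset.range n, Complex.exp ((-(ρ * t l ^ 2 / 2) : ℝ) : ℂ))) := by
  have key : ∀ k, ∫ x, Complex.exp (((∑ l ∈ Finset.range n, t l *
        ((psum (centred (a k)) (e k (l + 1)) x - psum (centred (a k)) (e k l) x) / c k) : ℝ) : ℂ)
        * Complex.I) ∂(berSeq ℕ (a k))
      = ∏ l ∈ Finset.range n, berChar (a k) (t l / c k) ^ (e k (l + 1) - e k l) := fun k => by
    rw [← (isNoise_centred (h0 k) (h1 k)).integral_cexp_blocks (integral_cexp_centred (a k))
      (fun l => t l / c k) (he k) n]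
    refine integral_congr_ae (ae_of_all _ fun x => ?_)
    simp only [mul_div_assoc', div_mul_eq_mul_div]
  simp only [key]
  exact tendsto_finsetProd _ fun l _ => tendsto_berChar_pow h0 h1 ha hc (hN l) (t l)

/-- Lévy's continuity theorem for random vectors. -/
lemma tendsto_integral_of_tendsto_cexp {Θ Θ' : Type*} [MeasurableSpace Θ] [MeasurableSpace Θ']
    {Q : Measure Θ} {Q' : Measure Θ'} [IsProbabilityMeasure Q] [IsProbabilityMeasure Q'] {n : ℕ}
    {D : ℕ → Θ → Fin n → ℝ} {D' : Θ' → Fin n → ℝ} (hD : ∀ k, AEMeasurable (D k) Q)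
    (hD' : AEMeasurable D' Q')
    (h : ∀ t : Fin n → ℝ, Tendsto (fun k => ∫ ω, Complex.exp (((∑ l, t l * D k ω l : ℝ) : ℂ)
      * Complex.I) ∂Q) atTop (𝓝 (∫ ω, Complex.exp (((∑ l, t l * D' ω l : ℝ) : ℂ)
      * Complex.I) ∂Q'))) {G : (Fin n → ℝ) → ℝ} (hG : Continuous G) {C : ℝ} (hC : ∀ d, |G d| ≤ C) :
    Tendsto (fun k => ∫ ω, G (D k ω) ∂Q) atTop (𝓝 (∫ ω, G (D' ω) ∂Q')) := by
  have hL : Measurable (WithLp.toLp 2 : (Fin n → ℝ) → EuclideanSpace ℝ (Fin n)) :=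
    (PiLp.continuous_toLp 2 _).measurable
  have hE : ∀ k, AEMeasurable (fun ω => (WithLp.toLp 2 (D k ω) : EuclideanSpace ℝ (Fin n))) Q :=
    fun k => hL.comp_aemeasurable (hD k)
  have hE' : AEMeasurable (fun ω => (WithLp.toLp 2 (D' ω) : EuclideanSpace ℝ (Fin n))) Q' :=
    hL.comp_aemeasurable hD'
  let M : ℕ → ProbabilityMeasure (EuclideanSpace ℝ (Fin n)) := fun k =>
    ⟨Q.map fun ω => WithLp.toLp 2 (D k ω), Measure.isProbabilityMeasure_map (hE k)⟩
  let M' : ProbabilityMeasure (EuclideanSpace ℝ (Fin n)) :=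
    ⟨Q'.map fun ω => WithLp.toLp 2 (D' ω), Measure.isProbabilityMeasure_map hE'⟩
  have hchar : ∀ (x : Fin n → ℝ) (y : EuclideanSpace ℝ (Fin n)),
      (inner ℝ (WithLp.toLp 2 x : EuclideanSpace ℝ (Fin n)) y : ℝ) = ∑ l, y l * x l := fun x y => by
    simp [PiLp.inner_apply]
  have hM : Tendsto M atTop (𝓝 M') := by
    refine ProbabilityMeasure.tendsto_iff_tendsto_charFun.2 fun t => ?_
    have e1 : ∀ k, charFun (M k : Measure (EuclideanSpace ℝ (Fin n))) t
        = ∫ ω, Complex.exp (((∑ l, t l * D k ω l : ℝ) : ℂ) * Complex.I) ∂Q := fun k => by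
      rw [charFun_apply]
      change ∫ x, _ ∂(Q.map _) = _
      rw [integral_map (hE k) (by fun_prop)]
      exact integral_congr_ae (ae_of_all _ fun ω => by simp only [hchar])
    have e2 : charFun (M' : Measure (EuclideanSpace ℝ (Fin n))) t
        = ∫ ω, Complex.exp (((∑ l, t l * D' ω l : ℝ) : ℂ) * Complex.I) ∂Q' := by
      rw [charFun_apply]
      change ∫ x, _ ∂(Q'.map _) = _
      rw [integral_map hE' (by fun_prop)]
      exact integral_congr_ae (ae_of_all _ fun ω => by simp only [hchar])
    simp only [e1, e2]
    exact h t
  have hGc : Continuous fun x : EuclideanSpace ℝ (Fin n) => G (WithLp.ofLp x) :=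
    hG.comp (PiLp.continuous_ofLp 2 _)
  have := (ProbabilityMeasure.tendsto_iff_forall_integral_tendsto.1 hM)
    (BoundedContinuousFunction.ofNormedAddCommGroup (fun x => G (WithLp.ofLp x)) hGc C
      fun x => hC _)
  have f1 : ∀ k, ∫ x, G (WithLp.ofLp x) ∂(M k : Measure (EuclideanSpace ℝ (Fin n)))
      = ∫ ω, G (D k ω) ∂Q := fun k => by
    change ∫ x, _ ∂(Q.map _) = _
    rw [integral_map (hE k) hGc.aestronglyMeasurable]
  have f2 : ∫ x, G (WithLp.ofLp x) ∂(M' : Measure (EuclideanSpace ℝ (Fin n)))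
      = ∫ ω, G (D' ω) ∂Q' := by
    change ∫ x, _ ∂(Q'.map _) = _
    rw [integral_map hE' hGc.aestronglyMeasurable]
  simpa [f1, f2] using this

/-! ### Increments of Brownian motion -/

lemma integral_cexp_brownian_increments {Ω : Type*} [MeasurableSpace Ω] {P : Measure Ω}
    {W : ℝ≥0 → Ω → ℝ} (hW : IsPreBrownianReal W P) {m : ℕ} (hm : 0 < m) (t : ℕ → ℝ) (N : ℕ) :
    ∫ ω, Complex.exp (((∑ l ∈ Finset.range N, t l * (W (((l + 1 : ℕ) : ℝ≥0) / m) ω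
      - W ((l : ℝ≥0) / m) ω) : ℝ) : ℂ) * Complex.I) ∂P
      = ∏ l ∈ Finset.range N, Complex.exp ((-((m : ℝ)⁻¹ * t l ^ 2 / 2) : ℝ) : ℂ) := by
  have hmono : Monotone fun l : ℕ => (l : ℝ≥0) / m := fun a b hab => by
    simp only; gcongr
  have hlaw : ∀ l : ℕ, HasLaw (fun ω => W (((l + 1 : ℕ) : ℝ≥0) / m) ω - W ((l : ℝ≥0) / m) ω)
      (gaussianReal 0 (m : ℝ≥0)⁻¹) P := fun l => by
    have h := hW.hasLaw_sub (((l + 1 : ℕ) : ℝ≥0) / m) ((l : ℝ≥0) / m)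
    have e : nndist (((l + 1 : ℕ) : ℝ≥0) / m).1 ((l : ℝ≥0) / m).1 = (m : ℝ≥0)⁻¹ := by
      ext
      rw [coe_nndist, Real.dist_eq]
      change |((((l + 1 : ℕ) : ℝ≥0) / m : ℝ≥0) : ℝ) - (((l : ℝ≥0) / m : ℝ≥0) : ℝ)| = _
      push_cast
      rw [← sub_div, add_sub_cancel_left, one_div, abs_of_nonneg (by positivity)]
    rwa [e] at h
  rw [integral_cexp_sum (X := fun (l : ℕ) ω => W (((l + 1 : ℕ) : ℝ≥0) / m) ω
    - W ((l : ℝ≥0) / m) ω) (fun l => (hlaw l).aemeasurable) (hW.hasIndepIncrements.nat hmono)]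
  refine Finset.prod_congr rfl fun l _ => ?_
  have h := charFun_gaussianReal (μ := 0) (v := (m : ℝ≥0)⁻¹) (t l)
  rw [← (hlaw l).map_eq, charFun_apply_real, integral_map (hlaw l).aemeasurable (by fun_prop)] at h
  simp only [← Complex.ofReal_mul] at h
  rw [h]
  congr 1
  push_cast
  ring

/-- The left half of the grid is reflected, so that its increments become those of the backward
motion with opposite sign. -/
lemma sum_range_two_mul_sq (m : ℕ) (τ : ℕ → ℝ) (f : ℝ → ℝ) :
    ∑ l ∈ Finset.range (2 * m ^ 2), τ l * (f (((l + 1 : ℕ) - (m : ℝ) ^ 2) / m)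
        - f ((l - (m : ℝ) ^ 2) / m))
      = (∑ j ∈ Finset.range (m ^ 2), -τ (m ^ 2 - 1 - j) * (f (-(((j + 1 : ℕ) : ℝ) / m))
          - f (-((j : ℝ) / m))))
        + ∑ j ∈ Finset.range (m ^ 2), τ (m ^ 2 + j) * (f (((j + 1 : ℕ) : ℝ) / m)
          - f ((j : ℝ) / m)) := by
  rw [two_mul, Finset.sum_range_add, ← Finset.sum_range_reflect]
  congr 1
  · refine Finset.sum_congr rfl fun j hj => ?_
    have hj' := Finset.mem_range.1 hj
    have e1 : ((m ^ 2 - 1 - j : ℕ) : ℝ) = (m : ℝ) ^ 2 - 1 - j := by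
      rw [Nat.cast_sub (by omega), Nat.cast_sub (by omega)]; push_cast; ring
    have e2 : (((m ^ 2 - 1 - j + 1 : ℕ) : ℝ) - (m : ℝ) ^ 2) / m = -((j : ℝ) / m) := by
      rw [Nat.cast_add, e1]; push_cast; ring
    have e3 : (((m ^ 2 - 1 - j : ℕ) : ℝ) - (m : ℝ) ^ 2) / m = -(((j + 1 : ℕ) : ℝ) / m) := by
      rw [e1]; push_cast; ring
    rw [e2, e3]; ring
  · refine Finset.sum_congr rfl fun j _ => ?_
    have e2 : (((m ^ 2 + j + 1 : ℕ) : ℝ) - (m : ℝ) ^ 2) / m = ((j + 1 : ℕ) : ℝ) / m := by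
      push_cast; ring
    have e3 : (((m ^ 2 + j : ℕ) : ℝ) - (m : ℝ) ^ 2) / m = (j : ℝ) / m := by push_cast; ring
    rw [e2, e3]

/-- The increments of a two-sided Brownian motion over a grid of mesh `1 / m` are independent
centred Gaussian variables of variance `1 / m`. -/
lemma IsTwoSidedBrownian.integral_cexp_gridIncr {Ω : Type*} [MeasurableSpace Ω] {P : Measure Ω}
    {B : ℝ → Ω → ℝ} (hB : IsTwoSidedBrownian B P) {m : ℕ} (hm : 0 < m)
    (t : Fin (2 * m ^ 2) → ℝ) :
    ∫ ω, Complex.exp (((∑ l, t l * gridIncr m (fun u => B u ω) l : ℝ) : ℂ) * Complex.I) ∂P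
      = ∏ l, Complex.exp ((-((m : ℝ)⁻¹ * t l ^ 2 / 2) : ℝ) : ℂ) := by
  obtain ⟨τ, hτ⟩ : ∃ τ : ℕ → ℝ, ∀ l : Fin (2 * m ^ 2), t l = τ l :=
    ⟨fun l => if h : l < 2 * m ^ 2 then t ⟨l, h⟩ else 0, fun l => by simp⟩
  have hprob : IsProbabilityMeasure P := hB.forward.isGaussianProcess.isProbabilityMeasure
  let Φ : (ℕ → ℝ) → (ℝ≥0 → ℝ) → ℂ := fun κ w => Complex.exp (((∑ l ∈ Finset.range (m ^ 2),
    κ l * (w (((l + 1 : ℕ) : ℝ≥0) / m) - w ((l : ℝ≥0) / m)) : ℝ) : ℂ) * Complex.I)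
  have hΦ : ∀ κ, Measurable (Φ κ) := fun κ => by
    refine Complex.measurable_exp.comp ((Complex.measurable_ofReal.comp
      (Finset.measurable_sum _ fun l _ => ?_)).mul_const _)
    fun_prop
  have hfac : ∀ ω, Complex.exp (((∑ l, t l * gridIncr m (fun u => B u ω) l : ℝ) : ℂ) * Complex.I)
      = Φ (fun j => -τ (m ^ 2 - 1 - j)) (fun s => B (-s) ω)
        * Φ (fun j => τ (m ^ 2 + j)) (fun s => B s ω) := fun ω => by
    simp only [Φ, hτ, gridIncr]
    rw [← Complex.exp_add, ← add_mul, ← Complex.ofReal_add,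
      ← Finset.sum_range (fun l => τ l * (B (((l + 1 : ℕ) - (m : ℝ) ^ 2) / m) ω
        - B ((l - (m : ℝ) ^ 2) / m) ω)), sum_range_two_mul_sq m τ (fun u => B u ω)]
    simp
  have hΦm : ∀ κ (V : ℝ≥0 → Ω → ℝ), (∀ s, AEMeasurable (V s) P) →
      AEStronglyMeasurable (fun ω => Φ κ fun s => V s ω) P := fun κ V hV => by
    refine (Complex.measurable_exp.comp_aemeasurable ((Complex.measurable_ofReal.comp_aemeasurable
      (Finset.aemeasurable_fun_sum _ fun l _ => ?_)).mul_const _)).aestronglyMeasurable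
    exact ((hV _).sub (hV _)).const_mul _
  have hind : IndepFun (fun ω => Φ (fun j => -τ (m ^ 2 - 1 - j)) fun s => B (-s) ω)
      (fun ω => Φ (fun j => τ (m ^ 2 + j)) fun s => B s ω) P :=
    (hB.indep.symm.comp (hΦ _) (hΦ _))
  simp only [hfac]
  rw [hind.integral_fun_mul_eq_mul_integral
    (hΦm _ (fun s ω => B (-s) ω) fun s => hB.backward.aemeasurable s)
    (hΦm _ (fun s ω => B s ω) fun s => hB.forward.aemeasurable s)]
  have e1 := integral_cexp_brownian_increments hB.backward.toIsPreBrownianReal hm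
    (fun j => -τ (m ^ 2 - 1 - j)) (m ^ 2)
  have e2 := integral_cexp_brownian_increments hB.forward.toIsPreBrownianReal hm
    (fun j => τ (m ^ 2 + j)) (m ^ 2)
  simp only [Φ]
  rw [e1, e2]
  simp only [hτ]
  rw [← Finset.prod_range (fun l => Complex.exp ((-((m : ℝ)⁻¹ * τ l ^ 2 / 2) : ℝ) : ℂ)), two_mul,
    Finset.prod_range_add, ← Finset.prod_range_reflect (fun l =>
      Complex.exp ((-((m : ℝ)⁻¹ * τ l ^ 2 / 2) : ℝ) : ℂ))]
  simp

lemma IsTwoSidedBrownian.eval_zero {Ω : Type*} [MeasurableSpace Ω] {P : Measure Ω}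
    {B : ℝ → Ω → ℝ} (hB : IsTwoSidedBrownian B P) : ∀ᵐ ω ∂P, B 0 ω = 0 := by
  simpa using hB.forward.eval_zero_ae_eq_zero

lemma IsTwoSidedBrownian.aemeasurable {Ω : Type*} [MeasurableSpace Ω] {P : Measure Ω}
    {B : ℝ → Ω → ℝ} (hB : IsTwoSidedBrownian B P) (t : ℝ) : AEMeasurable (B t) P := by
  rcases le_total 0 t with h | h
  · simpa [Real.coe_toNNReal t h] using hB.forward.aemeasurable t.toNNReal
  · have := hB.backward.aemeasurable (-t).toNNReal
    simpa [Real.coe_toNNReal (-t) (by linarith)] using this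

/-! ### Convergence to Brownian motion -/

lemma abs_integral_sub_le_of_forall_notMem {Θ : Type*} [MeasurableSpace Θ] {Q : Measure Θ}
    [IsProbabilityMeasure Q] {f g : Θ → ℝ} (hf : Integrable f Q) (hg : Integrable g Q) {C ε : ℝ}
    (hfC : ∀ ω, |f ω| ≤ C) (hgC : ∀ ω, |g ω| ≤ C) (hε : 0 ≤ ε) {S : Set Θ}
    (hS : ∀ ω ∉ S, |f ω - g ω| ≤ ε) : |∫ ω, f ω ∂Q - ∫ ω, g ω ∂Q| ≤ ε + 2 * C * Q.real S := by
  -- The exceptional set involves uncountably many times and need not be measurable; its measurable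
  -- hull has the same measure.
  have hT : MeasurableSet (toMeasurable Q S) := measurableSet_toMeasurable Q S
  have hi : Integrable (fun ω => ε + (toMeasurable Q S).indicator (fun _ => 2 * C) ω) Q :=
    (integrable_const ε).add ((integrable_const _).indicator hT)
  rw [← integral_sub hf hg, ← Real.norm_eq_abs]
  refine (norm_integral_le_of_norm_le hi (ae_of_all _ fun ω => ?_)).trans_eq ?_
  · rw [Real.norm_eq_abs]
    by_cases hω : ω ∈ toMeasurable Q S
    · rw [indicator_of_mem hω]
      have := abs_sub (f ω) (g ω)
      linarith [hfC ω, hgC ω]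
    · rw [indicator_of_notMem hω, add_zero]
      exact hS ω fun h => hω (subset_toMeasurable Q S h)
  · rw [integral_add (integrable_const ε) ((integrable_const _).indicator hT),
      integral_indicator hT, setIntegral_const, measureReal_def, measure_toMeasurable,
      ← measureReal_def]
    simp
    ring

/-- The column at the rescaled position `u`. -/
def column (x₀ : ℕ) (r u : ℝ) : ℕ := ((x₀ : ℤ) + ⌊u * r⌋).toNat

lemma column_zero (x₀ : ℕ) (r : ℝ) : column x₀ r 0 = x₀ := by simp [column]

lemma column_mono (x₀ : ℕ) {r : ℝ} (hr : 0 ≤ r) : Monotone (column x₀ r) := fun _ _ h =>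
  Int.toNat_le_toNat (by gcongr)

lemma cast_column {x₀ : ℕ} {r u : ℝ} (h : -(u * r) ≤ x₀) : (column x₀ r u : ℝ) = x₀ + ⌊u * r⌋ := by
  have h1 : 0 ≤ (x₀ : ℤ) + ⌊u * r⌋ := by
    have : -(x₀ : ℤ) ≤ ⌊u * r⌋ := Int.le_floor.2 (by push_cast; linarith)
    linarith
  have : ((column x₀ r u : ℕ) : ℤ) = x₀ + ⌊u * r⌋ := Int.toNat_of_nonneg h1
  exact_mod_cast this

lemma abs_column_sub_le {x₀ : ℕ} {r u v : ℝ} (hu : -(u * r) ≤ x₀) (hv : -(v * r) ≤ x₀) :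
    |((column x₀ r v : ℝ) - column x₀ r u) - (v - u) * r| ≤ 1 := by
  rw [cast_column hu, cast_column hv, abs_le]
  constructor <;>
  linarith [Int.floor_le (u * r), Int.floor_le (v * r), Int.lt_floor_add_one (u * r),
    Int.lt_floor_add_one (v * r)]

/-- The rescaled centred walk. -/
def walk (a c r : ℝ) (x₀ : ℕ) (x : ℕ → Bool) (u : ℝ) : ℝ :=
  (psum (centred a) (column x₀ r u) x - psum (centred a) x₀ x) / c

/-- The oscillation of the rescaled walk over a short interval is small. -/
lemma measureReal_walk_block_le {a c r : ℝ} {x₀ : ℕ} (h0 : 0 ≤ a) (h1 : a ≤ 1) (hc : 0 < c)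
    {u v w : ℝ} (hu : -(u * r) ≤ x₀) (hv : -(v * r) ≤ x₀)
    (hw : ((v - u) * r + 1) * a / c ^ 2 ≤ w) (hr : 0 ≤ r) (huv : u ≤ v) {δ : ℝ} (hδ : 0 < δ) :
    (berSeq ℕ a).real {x | ∃ t, u ≤ t ∧ t ≤ v ∧ δ ≤ |walk a c r x₀ x t - walk a c r x₀ x u|}
      ≤ (3 * w ^ 2 + w / c ^ 2) / δ ^ 4 := by
  obtain ⟨N, hN⟩ : ∃ N, N = column x₀ r v - column x₀ r u := ⟨_, rfl⟩
  have hle := column_mono x₀ hr huv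
  have hNr : (N : ℝ) ≤ (v - u) * r + 1 := by
    rw [hN, Nat.cast_sub hle]; linarith [(abs_le.1 (abs_column_sub_le hu hv)).2]
  have hNw : N * a / c ^ 2 ≤ w := le_trans (by gcongr) hw
  have hnoise := (isNoise_centred h0 h1).shift (column x₀ r u)
  have hsub : {x | ∃ t, u ≤ t ∧ t ≤ v ∧ δ ≤ |walk a c r x₀ x t - walk a c r x₀ x u|}
      ⊆ {x | ∃ k ≤ N, δ * c ≤ |psum (fun i => centred a (column x₀ r u + i)) k x|} := by
    rintro x ⟨t, hut, htv, ht⟩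
    have h2 := column_mono x₀ hr hut
    have h3 := column_mono x₀ hr htv
    refine ⟨column x₀ r t - column x₀ r u, by omega, ?_⟩
    have e : psum (fun i => centred a (column x₀ r u + i)) (column x₀ r t - column x₀ r u) x
        = psum (centred a) (column x₀ r t) x - psum (centred a) (column x₀ r u) x := by
      simp only [psum]
      rw [← Finset.sum_Ico_eq_sub _ h2, Finset.sum_Ico_eq_sum_range]
    rw [e]
    rw [walk, walk, ← sub_div, abs_div, abs_of_pos hc, le_div_iff₀ hc] at ht
    rwa [sub_sub_sub_cancel_right] at ht
  refine (measureReal_mono hsub).trans ((hnoise.measureReal_exists_le (by positivity) N).trans ?_)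
  have hN0 : 0 ≤ N * a / c ^ 2 := by positivity
  calc (3 * (N * a) ^ 2 + N * a) / (δ * c) ^ 4
      = (3 * (N * a / c ^ 2) ^ 2 + (N * a / c ^ 2) / c ^ 2) / δ ^ 4 := by field_simp
    _ ≤ _ := by gcongr

section Donsker

variable {Θ : Type*} [MeasurableSpace Θ] {Q : Measure Θ}
  {a c r : ℕ → ℝ} {x₀ : ℕ → ℕ} {H : ℕ → Θ → ℕ → Bool}

lemma measurable_walk {a : ℝ} (h0 : 0 ≤ a) (h1 : a ≤ 1) (c r : ℝ) (x₀ : ℕ) (u : ℝ) :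
    Measurable fun x => walk a c r x₀ x u :=
  (((isNoise_centred h0 h1).measurable_psum _).sub
    ((isNoise_centred h0 h1).measurable_psum _)).div_const c

lemma tendsto_div_sq (ha : Tendsto a atTop (𝓝 0)) (hc : Tendsto c atTop atTop) :
    Tendsto (fun k => a k / c k ^ 2) atTop (𝓝 0) :=
  ha.div_atTop ((tendsto_pow_atTop two_ne_zero).comp hc)

/-- Rounding changes the number of columns by at most one, and `a / c ^ 2` tends to zero. -/
lemma tendsto_block_length (h0 : ∀ k, 0 ≤ a k) (ha : Tendsto a atTop (𝓝 0))
    (hc : Tendsto c atTop atTop) (hr : ∀ k, 0 ≤ r k)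
    (hrate : Tendsto (fun k => a k * r k / c k ^ 2) atTop (𝓝 1))
    (hx : ∀ K : ℝ, ∀ᶠ k in atTop, K * r k ≤ x₀ k) {u v : ℝ} (huv : u ≤ v) :
    Tendsto (fun k => ((column (x₀ k) (r k) v - column (x₀ k) (r k) u : ℕ) : ℝ) * a k / c k ^ 2)
      atTop (𝓝 (v - u)) := by
  have hlim : Tendsto (fun k => (v - u) * (a k * r k / c k ^ 2)) atTop (𝓝 (v - u)) := by
    simpa using hrate.const_mul (v - u)
  refine (tendsto_iff_of_dist ?_).1 hlim
  refine squeeze_zero' (Eventually.of_forall fun _ => dist_nonneg) ?_ (tendsto_div_sq ha hc)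
  filter_upwards [hx (-u), hx (-v)] with k hu hv
  have h := abs_column_sub_le (x₀ := x₀ k) (r := r k) (u := u) (v := v) (by linarith) (by linarith)
  rw [Nat.cast_sub (column_mono _ (hr k) huv), Real.dist_eq, abs_sub_comm]
  have e : ((column (x₀ k) (r k) v : ℝ) - column (x₀ k) (r k) u) * a k / c k ^ 2
      - (v - u) * (a k * r k / c k ^ 2)
      = (((column (x₀ k) (r k) v : ℝ) - column (x₀ k) (r k) u) - (v - u) * r k)
        * (a k / c k ^ 2) := by ring
  have hpos : 0 ≤ a k / c k ^ 2 := div_nonneg (h0 k) (sq_nonneg _)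
  rw [e, abs_mul, abs_of_nonneg hpos]
  exact mul_le_of_le_one_left hpos h

lemma tendsto_cexp_gridIncr_walk (h0 : ∀ k, 0 ≤ a k) (h1 : ∀ k, a k ≤ 1)
    (ha : Tendsto a atTop (𝓝 0)) (hc : Tendsto c atTop atTop) (hr : ∀ k, 0 ≤ r k)
    (hrate : Tendsto (fun k => a k * r k / c k ^ 2) atTop (𝓝 1))
    (hx : ∀ K : ℝ, ∀ᶠ k in atTop, K * r k ≤ x₀ k)
    (hH : ∀ k, HasLaw (H k) (berSeq ℕ (a k)) Q) (m : ℕ) (t : Fin (2 * m ^ 2) → ℝ) :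
    Tendsto (fun k => ∫ ω, Complex.exp (((∑ l, t l
        * gridIncr m (walk (a k) (c k) (r k) (x₀ k) (H k ω)) l : ℝ) : ℂ) * Complex.I) ∂Q) atTop
      (𝓝 (∏ l, Complex.exp ((-((m : ℝ)⁻¹ * t l ^ 2 / 2) : ℝ) : ℂ))) := by
  obtain ⟨τ, hτ⟩ : ∃ τ : ℕ → ℝ, ∀ l : Fin (2 * m ^ 2), t l = τ l :=
    ⟨fun l => if h : l < 2 * m ^ 2 then t ⟨l, h⟩ else 0, fun l => by simp⟩
  let g : ℕ → ℝ := fun l => (l - (m : ℝ) ^ 2) / m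
  have hg : Monotone g := fun i j hij => by simp only [g]; gcongr
  have hmain := tendsto_integral_cexp_blocks (e := fun k l => column (x₀ k) (r k) (g l))
    (ρ := (m : ℝ)⁻¹) h0 h1 ha hc (fun k => (column_mono _ (hr k)).comp hg) (fun l => by
      have h := tendsto_block_length h0 ha hc hr hrate hx (hg l.le_succ)
      have e : g l.succ - g l = (m : ℝ)⁻¹ := by
        simp only [g]; rw [← sub_div]; push_cast; ring
      rwa [e] at h) τ (2 * m ^ 2)
  simp only [hτ]
  rw [← Finset.prod_range (fun l => Complex.exp ((-((m : ℝ)⁻¹ * τ l ^ 2 / 2) : ℝ) : ℂ))]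
  refine hmain.congr fun k => ?_
  have hf : Measurable fun x : ℕ → Bool => Complex.exp (((∑ l ∈ Finset.range (2 * m ^ 2), τ l *
        ((psum (centred (a k)) (column (x₀ k) (r k) (g (l + 1))) x
          - psum (centred (a k)) (column (x₀ k) (r k) (g l)) x) / c k) : ℝ) : ℂ)
        * Complex.I) := by
    refine Complex.measurable_exp.comp ((Complex.measurable_ofReal.comp
      (Finset.measurable_sum _ fun l _ => ?_)).mul_const _)
    exact (((((isNoise_centred (h0 k) (h1 k)).measurable_psum _).sub
      ((isNoise_centred (h0 k) (h1 k)).measurable_psum _)).div_const _)).const_mul _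
  rw [← (hH k).integral_comp hf.aestronglyMeasurable]
  refine integral_congr_ae (ae_of_all _ fun ω => ?_)
  simp only [Function.comp_def]
  rw [Finset.sum_range]
  congr 3
  refine Finset.sum_congr rfl fun l _ => ?_
  simp only [gridIncr, walk, g]
  ring

lemma abs_floor_mul_div_sub {m : ℕ} (hm : 0 < m) (t : ℝ) :
    (⌊t * m⌋ : ℝ) / m ≤ t ∧ t ≤ ((⌊t * m⌋ : ℝ) + 1) / m := by
  have hm' : (0 : ℝ) < m := by exact_mod_cast hm
  exact ⟨by rw [div_le_iff₀ hm']; exact Int.floor_le _,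
    by rw [le_div_iff₀ hm']; exact (Int.lt_floor_add_one _).le⟩

/-- The oscillations of the rescaled walk over intervals of length `1 / m` are small. -/
lemma measureReal_walk_osc_le {a c r : ℝ} {x₀ : ℕ} (h0 : 0 ≤ a) (h1 : a ≤ 1) (hc : 0 < c)
    (hr : 0 ≤ r) {m R : ℕ} (hm : 0 < m) (hx : (R + 1) * r ≤ x₀) {w : ℝ}
    (hw : (r / m + 1) * a / c ^ 2 ≤ w) {δ : ℝ} (hδ : 0 < δ) :
    (berSeq ℕ a).real {x | ∃ t : ℝ, |t| ≤ R ∧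
        δ ≤ |walk a c r x₀ x t - walk a c r x₀ x (⌊t * m⌋ / m)|}
      ≤ (2 * R * m + 1) * ((3 * w ^ 2 + w / c ^ 2) / δ ^ 4) := by
  have hm' : (0 : ℝ) < m := by exact_mod_cast hm
  have hm1 : (1 : ℝ) ≤ m := by exact_mod_cast hm
  let g : ℕ → ℝ := fun q => ((q : ℝ) - R * m) / m
  let A : ℕ → Set (ℕ → Bool) := fun q => {x | ∃ t, g q ≤ t ∧ t ≤ g (q + 1) ∧
    δ ≤ |walk a c r x₀ x t - walk a c r x₀ x (g q)|}
  have hsub : {x | ∃ t : ℝ, |t| ≤ R ∧ δ ≤ |walk a c r x₀ x t - walk a c r x₀ x (⌊t * m⌋ / m)|}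
      ⊆ ⋃ q ∈ Finset.range (2 * R * m + 1), A q := by
    rintro x ⟨t, ht, hd⟩
    obtain ⟨t1, t2⟩ := abs_le.1 ht
    have f1 : -((R * m : ℕ) : ℤ) ≤ ⌊t * m⌋ := Int.le_floor.2 (by push_cast; nlinarith)
    have f2 : ⌊t * m⌋ ≤ ((R * m : ℕ) : ℤ) := by
      have : (⌊t * m⌋ : ℝ) ≤ (R * m : ℕ) := (Int.floor_le _).trans (by push_cast; nlinarith)
      exact_mod_cast this
    obtain ⟨q, hq⟩ : ∃ q : ℕ, (q : ℤ) = ⌊t * m⌋ + (R * m : ℕ) :=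
      ⟨(⌊t * m⌋ + (R * m : ℕ)).toNat, Int.toNat_of_nonneg (by linarith)⟩
    have hq' : (q : ℝ) = ⌊t * m⌋ + R * m := by exact_mod_cast hq
    have hgq : g q = ⌊t * m⌋ / m := by simp only [g]; rw [hq']; ring
    have hgq1 : g (q + 1) = (⌊t * m⌋ + 1) / m := by simp only [g]; push_cast; rw [hq']; ring
    have h3 := abs_floor_mul_div_sub hm t
    refine mem_iUnion₂.2 ⟨q, Finset.mem_range.2 ?_, t, ?_, ?_, ?_⟩
    · have : (q : ℤ) ≤ ((2 * R * m : ℕ) : ℤ) := by rw [hq]; push_cast at f2 ⊢; linarith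
      have : q ≤ 2 * R * m := by exact_mod_cast this
      omega
    · rw [hgq]; exact h3.1
    · rw [hgq1]; exact h3.2
    · rw [hgq]; exact hd
  have hA : ∀ q ∈ Finset.range (2 * R * m + 1), (berSeq ℕ a).real (A q)
      ≤ (3 * w ^ 2 + w / c ^ 2) / δ ^ 4 := fun q _ => by
    have b1 : -(R : ℝ) ≤ g q := by
      simp only [g]; rw [le_div_iff₀ hm']; linarith [(Nat.cast_nonneg q : (0 : ℝ) ≤ q)]
    have hstep : g (q + 1) - g q = 1 / m := by simp only [g]; rw [← sub_div]; push_cast; ring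
    have hle : g q ≤ g (q + 1) := by have : 0 < 1 / (m : ℝ) := by positivity
                                     linarith
    refine measureReal_walk_block_le h0 h1 hc ?_ ?_ (le_trans (le_of_eq ?_) hw) hr hle hδ
    · nlinarith
    · nlinarith
    · rw [hstep]; ring
  refine (measureReal_mono hsub (measure_ne_top _ _)).trans
    ((measureReal_biUnion_finset_le _ _).trans ((Finset.sum_le_sum hA).trans ?_))
  simp

lemma measureReal_preimage_le {Y : Type*} [MeasurableSpace Y] {f : Θ → Y} {ν : Measure Y}
    [IsProbabilityMeasure ν] (h : HasLaw f ν Q) (S : Set Y) : Q.real {ω | f ω ∈ S} ≤ ν.real S := by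
  rw [measureReal_def, measureReal_def, ← h.map_eq]
  refine ENNReal.toReal_mono ?_ (Measure.le_map_apply h.aemeasurable S)
  rw [h.map_eq]; exact measure_ne_top ν S

/-- Random paths which are locally uniformly close to rescaled Bernoulli walks converge in
distribution to Brownian motion. -/
theorem tendsto_integral_of_close_to_walk [IsProbabilityMeasure Q] {Θ' : Type*} [MeasurableSpace Θ'] {Q' : Measure Θ'}
    [IsProbabilityMeasure Q'] {B : Θ' → CadlagPath} (hB : IsTwoSidedBrownian (fun t ω => B ω t) Q')
    {Y : ℕ → Θ → CadlagPath} (hY : ∀ k, AEMeasurable (Y k) Q)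
    (h0 : ∀ k, 0 ≤ a k) (h1 : ∀ k, a k ≤ 1) (ha : Tendsto a atTop (𝓝 0))
    (hc : Tendsto c atTop atTop) (hr : ∀ k, 0 ≤ r k)
    (hrate : Tendsto (fun k => a k * r k / c k ^ 2) atTop (𝓝 1))
    (hx : ∀ K : ℝ, ∀ᶠ k in atTop, K * r k ≤ x₀ k)
    (hH : ∀ k, HasLaw (H k) (berSeq ℕ (a k)) Q)
    (hclose : ∀ K δ : ℝ, 0 < K → 0 < δ → Tendsto (fun k => Q.real {ω | ∃ u, |u| ≤ K ∧
      δ ≤ |Y k ω u - walk (a k) (c k) (r k) (x₀ k) (H k ω) u|}) atTop (𝓝 0))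
    {F : CadlagPath → ℝ} {C : ℝ} (hC : ∀ f, |F f| ≤ C) (hF : Continuous F)
    (hFu : ∀ ε > 0, ∃ δ > 0, ∀ f g, (f, g) ∈ skorokhodEntourage δ → |F f - F g| ≤ ε) :
    Tendsto (fun k => ∫ ω, F (Y k ω) ∂Q) atTop (𝓝 (∫ ω, F (B ω) ∂Q')) := by
  have hBm : AEMeasurable B Q' := aemeasurable_of_coordinates hB.aemeasurable hB.eval_zero
  have hC0 : 0 ≤ C := (abs_nonneg _).trans (hC (stepPath 0 0))
  have hint : ∀ {Z : Θ → CadlagPath}, AEMeasurable Z Q → Integrable (fun ω => F (Z ω)) Q :=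
    fun hZ => Integrable.of_bound (hF.measurable.comp_aemeasurable hZ).aestronglyMeasurable C
      (ae_of_all _ fun ω => hC _)
  have hWm : ∀ k m, AEMeasurable
      (fun ω => gridIncr m (walk (a k) (c k) (r k) (x₀ k) (H k ω))) Q := fun k m =>
    aemeasurable_pi_iff.2 fun l =>
      ((measurable_walk (h0 k) (h1 k) _ _ _ _).comp_aemeasurable (hH k).aemeasurable).sub
        ((measurable_walk (h0 k) (h1 k) _ _ _ _).comp_aemeasurable (hH k).aemeasurable)
  refine Metric.tendsto_nhds.2 fun ε' hε' => ?_
  -- The error budget is `ε + 2 * C * (2 * ε)` for replacing `Y` by a step path of the walk, `ε` for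
  -- the convergence of the grid increments, and `ε` for the step paths of `B`.
  obtain ⟨ε, hε, hεε⟩ : ∃ ε > 0, (3 + 4 * C) * ε < ε' :=
    ⟨ε' / (2 * (3 + 4 * C)), by positivity, by
      rw [← mul_div_assoc, div_lt_iff₀ (by positivity)]; nlinarith⟩
  obtain ⟨δ, hδ, hFδ⟩ := hFu ε hε
  obtain ⟨R, hR⟩ := exists_nat_ge (1 / δ)
  have hRpos : (0 : ℝ) < R := lt_of_lt_of_le (by positivity) hR
  have hstepB : Tendsto (fun m => ∫ ω, F (stepPath m (gridIncr m (B ω))) ∂Q') atTop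
      (𝓝 (∫ ω, F (B ω) ∂Q')) := by
    refine tendsto_integral_of_dominated_convergence (fun _ => C) (fun m => ?_)
      (integrable_const _) (fun m => ae_of_all _ fun ω => hC _) ?_
    · exact (hF.measurable.comp_aemeasurable ((continuous_stepPath m).measurable.comp_aemeasurable
        (aemeasurable_gridIncr hB.aemeasurable m))).aestronglyMeasurable
    · filter_upwards [hB.eval_zero] with ω hω
      exact (hF.tendsto _).comp (tendsto_stepPath_gridIncr (B ω) hω)
  -- About `2 * R * m` intervals, each with a large oscillation of probability of order `m ^ (-2)`;
  -- the fourth moment is what makes the union bound vanish.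
  have hmlim : Tendsto (fun m : ℕ => (2 * R * m + 1) * ((3 * (2 / (m : ℝ)) ^ 2
      + (1 / (m : ℝ)) ^ 2) / (δ / 2) ^ 4)) atTop (𝓝 0) := by
    have hi : Tendsto (fun m : ℕ => (1 : ℝ) / m) atTop (𝓝 0) := tendsto_one_div_atTop_nhds_zero_nat
    have h := ((hi.const_mul (2 * (R : ℝ) * 13)).add ((hi.pow 2).const_mul (13 : ℝ))).mul_const
      (1 / (δ / 2) ^ 4)
    simp only [mul_zero, ne_eq, OfNat.ofNat_ne_zero, not_false_eq_true, zero_pow, add_zero,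
      zero_mul] at h
    refine h.congr' ?_
    filter_upwards [eventually_gt_atTop 0] with m hm
    have hm' : (0 : ℝ) < m := by exact_mod_cast hm
    field_simp
    ring
  obtain ⟨m, hm0, hmR, hmB, hmosc⟩ : ∃ m : ℕ, 0 < m ∧ R ≤ m ∧
      |∫ ω, F (stepPath m (gridIncr m (B ω))) ∂Q' - ∫ ω, F (B ω) ∂Q'| < ε ∧
      (2 * R * m + 1) * ((3 * (2 / (m : ℝ)) ^ 2 + (1 / (m : ℝ)) ^ 2) / (δ / 2) ^ 4) < ε := by
    have e1 := (Metric.tendsto_nhds.1 hstepB) ε hε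
    simp only [Real.dist_eq] at e1
    have e2 := hmlim.eventually (gt_mem_nhds hε)
    exact ((eventually_gt_atTop 0).and ((eventually_ge_atTop R).and (e1.and e2))).exists
  have hm' : (0 : ℝ) < m := by exact_mod_cast hm0
  have hfdd : Tendsto (fun k => ∫ ω, F (stepPath m (gridIncr m
      (walk (a k) (c k) (r k) (x₀ k) (H k ω)))) ∂Q) atTop
      (𝓝 (∫ ω, F (stepPath m (gridIncr m (B ω))) ∂Q')) := by
    refine tendsto_integral_of_tendsto_cexp (G := fun d => F (stepPath m d)) (fun k => hWm k m)
      (aemeasurable_gridIncr hB.aemeasurable m) (fun t => ?_) (hF.comp (continuous_stepPath m))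
      (fun d => hC _)
    rw [hB.integral_cexp_gridIncr hm0 t]
    exact tendsto_cexp_gridIncr_walk h0 h1 ha hc hr hrate hx hH m t
  have ev1 : ∀ᶠ k in atTop, |∫ ω, F (stepPath m (gridIncr m
      (walk (a k) (c k) (r k) (x₀ k) (H k ω)))) ∂Q
      - ∫ ω, F (stepPath m (gridIncr m (B ω))) ∂Q'| < ε := by
    simpa only [Real.dist_eq] using (Metric.tendsto_nhds.1 hfdd) ε hε
  have ev2 := (hclose R (δ / 2) hRpos (by positivity)).eventually (gt_mem_nhds hε)
  have hw : Tendsto (fun k => (r k / m + 1) * a k / c k ^ 2) atTop (𝓝 (1 / (m : ℝ))) := by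
    have h := (hrate.mul_const (1 / (m : ℝ))).add (tendsto_div_sq ha hc)
    simp only [one_mul, add_zero] at h
    exact h.congr fun k => by ring
  have ev3 := hw.eventually (ge_mem_nhds (show 1 / (m : ℝ) < 2 / m by gcongr; norm_num))
  have ev4 := hc.eventually_ge_atTop (2 * m)
  have ev5 := hx (R + 1)
  filter_upwards [ev1, ev2, ev3, ev4, ev5] with k g1 g2 g3 g4 g5
  have hm1 : (1 : ℝ) ≤ m := by exact_mod_cast hm0
  have hck : 0 < c k := by linarith
  let S1 : Set Θ := {ω | ∃ u, |u| ≤ (R : ℝ) ∧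
    δ / 2 ≤ |Y k ω u - walk (a k) (c k) (r k) (x₀ k) (H k ω) u|}
  let S2 : Set Θ := {ω | H k ω ∈ {x | ∃ t : ℝ, |t| ≤ R ∧ δ / 2 ≤
    |walk (a k) (c k) (r k) (x₀ k) x t - walk (a k) (c k) (r k) (x₀ k) x (⌊t * m⌋ / m)|}}
  have hS2 : Q.real S2 < ε := by
    refine lt_of_le_of_lt ((measureReal_preimage_le (hH k) _).trans
      (measureReal_walk_osc_le (h0 k) (h1 k) hck (hr k) hm0 g5 g3 (by positivity))) ?_
    refine lt_of_le_of_lt ?_ hmosc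
    have : 2 / (m : ℝ) / c k ^ 2 ≤ (1 / (m : ℝ)) ^ 2 := by
      rw [div_div, div_pow, one_pow, div_le_div_iff₀ (by positivity) (by positivity)]
      nlinarith
    gcongr
  have hS : Q.real (S1 ∪ S2) ≤ 2 * ε := by
    have := measureReal_union_le (μ := Q) S1 S2
    linarith
  have hmain := abs_integral_sub_le_of_forall_notMem (hint (hY k))
    (hint ((continuous_stepPath m).measurable.comp_aemeasurable (hWm k m)))
    (fun ω => hC _) (fun ω => hC _) hε.le (S := S1 ∪ S2) fun ω hω => by
      rw [mem_union, not_or] at hω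
      refine hFδ _ _ (mem_skorokhodEntourage_of_forall hδ.le fun t ht => ?_)
      have htR : |t| ≤ R := ht.trans hR
      have q1 : |Y k ω t - walk (a k) (c k) (r k) (x₀ k) (H k ω) t| < δ / 2 := by
        by_contra hc
        exact hω.1 ⟨t, htR, not_lt.1 hc⟩
      have q2 : |walk (a k) (c k) (r k) (x₀ k) (H k ω) t
          - walk (a k) (c k) (r k) (x₀ k) (H k ω) (⌊t * m⌋ / m)| < δ / 2 := by
        by_contra hc
        exact hω.2 ⟨t, htR, not_lt.1 hc⟩
      have hz : walk (a k) (c k) (r k) (x₀ k) (H k ω) 0 = 0 := by simp [walk, column_zero]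
      change |stepPath m _ t - _| ≤ δ
      rw [stepPath_gridIncr hm0 _ (htR.trans (by exact_mod_cast hmR)), hz, sub_zero]
      rw [abs_lt] at q1 q2
      rw [abs_le]
      constructor <;> linarith [q1.1, q1.2, q2.1, q2.2]
  simp only [Function.comp_apply] at hmain
  rw [Real.dist_eq]
  have t1 := abs_sub_le (∫ ω, F (Y k ω) ∂Q) (∫ ω, F (stepPath m (gridIncr m
      (walk (a k) (c k) (r k) (x₀ k) (H k ω)))) ∂Q) (∫ ω, F (B ω) ∂Q')
  have t2 := abs_sub_le (∫ ω, F (stepPath m (gridIncr m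
      (walk (a k) (c k) (r k) (x₀ k) (H k ω)))) ∂Q) (∫ ω, F (stepPath m (gridIncr m (B ω))) ∂Q')
      (∫ ω, F (B ω) ∂Q')
  have t3 : 2 * C * Q.real (S1 ∪ S2) ≤ 2 * C * (2 * ε) := by gcongr
  linarith

end Donsker

/-! ### Increasing sequences of planar points -/

/-- `z` is an increasing sequence of points of `A`. -/
def IsIncreasing (A : Set (ℝ × ℝ)) {k : ℕ} (z : Fin k → ℝ × ℝ) : Prop :=
  (∀ i, z i ∈ A) ∧ StrictMono (fun i => (z i).1) ∧ StrictMono fun i => (z i).2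

lemma IsIncreasing.le_longestIncreasing {A : Set (ℝ × ℝ)} (hA : A.Finite) {k : ℕ}
    {z : Fin k → ℝ × ℝ} (hz : IsIncreasing A z) : k ≤ longestIncreasing A :=
  le_csSup (bddAbove_increasing hA) ⟨z, hz⟩

lemma exists_isIncreasing {A : Set (ℝ × ℝ)} (hA : A.Finite) :
    ∃ z : Fin (longestIncreasing A) → ℝ × ℝ, IsIncreasing A z := by
  have hne : {k | ∃ z : Fin k → ℝ × ℝ, (∀ i, z i ∈ A) ∧ StrictMono (fun i => (z i).1) ∧
      StrictMono fun i => (z i).2}.Nonempty :=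
    ⟨0, Fin.elim0, fun i => i.elim0, fun i => i.elim0, fun i => i.elim0⟩
  exact Nat.sSup_mem hne (bddAbove_increasing hA)

lemma longestIncreasing_mono {A B : Set (ℝ × ℝ)} (hB : B.Finite) (h : A ⊆ B) :
    longestIncreasing A ≤ longestIncreasing B := by
  obtain ⟨z, hz, h1, h2⟩ := exists_isIncreasing (hB.subset h)
  exact IsIncreasing.le_longestIncreasing hB ⟨fun i => h (hz i), h1, h2⟩

lemma IsIncreasing.snoc {A B : Set (ℝ × ℝ)} {k : ℕ} {z : Fin k → ℝ × ℝ} (hz : IsIncreasing A z)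
    (hAB : A ⊆ B) {p : ℝ × ℝ} (hp : p ∈ B) (h : ∀ q ∈ A, q.1 < p.1 ∧ q.2 < p.2) :
    IsIncreasing B (Fin.snoc z p : Fin (k + 1) → ℝ × ℝ) := by
  obtain ⟨h0, h1, h2⟩ := hz
  have aux : ∀ g : ℝ × ℝ → ℝ, StrictMono (fun i => g (z i)) → (∀ i, g (z i) < g p) →
      StrictMono fun i => g ((Fin.snoc z p : Fin (k + 1) → ℝ × ℝ) i) := by
    intro g hg hlt i j hij
    induction j using Fin.lastCases with
    | last =>
      induction i using Fin.lastCases with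
      | last => exact absurd hij (lt_irrefl _)
      | cast i => simpa using hlt i
    | cast j =>
      induction i using Fin.lastCases with
      | last => exact absurd hij (not_lt.2 (Fin.le_last _))
      | cast i => simpa using hg (Fin.castSucc_lt_castSucc_iff.1 hij)
  refine ⟨fun i => ?_, aux Prod.fst h1 fun i => (h _ (h0 i)).1,
    aux Prod.snd h2 fun i => (h _ (h0 i)).2⟩
  induction i using Fin.lastCases with
  | last => simpa using hp
  | cast i => simpa using hAB (h0 i)

lemma IsIncreasing.castSucc {A : Set (ℝ × ℝ)} {k : ℕ} {z : Fin (k + 1) → ℝ × ℝ}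
    (hz : IsIncreasing A z) :
    IsIncreasing {q ∈ A | q.1 < (z (Fin.last k)).1 ∧ q.2 < (z (Fin.last k)).2}
      fun i : Fin k => z i.castSucc :=
  ⟨fun i => ⟨hz.1 _, hz.2.1 (Fin.castSucc_lt_last i), hz.2.2 (Fin.castSucc_lt_last i)⟩,
    fun _ _ h => hz.2.1 (Fin.castSucc_lt_castSucc_iff.2 h),
    fun _ _ h => hz.2.2 (Fin.castSucc_lt_castSucc_iff.2 h)⟩

lemma IsIncreasing.le_last {A : Set (ℝ × ℝ)} {k : ℕ} {z : Fin (k + 1) → ℝ × ℝ}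
    (hz : IsIncreasing A z) (i : Fin (k + 1)) :
    (z i).1 ≤ (z (Fin.last k)).1 ∧ (z i).2 ≤ (z (Fin.last k)).2 :=
  ⟨hz.2.1.monotone (Fin.le_last i), hz.2.2.monotone (Fin.le_last i)⟩

lemma Configuration.finite_inter (S : Configuration) (x y x' y' : ℝ) :
    (S.points ∩ Ioc x y ×ˢ Ioc x' y').Finite :=
  (S.locallyFinite (Icc x y ×ˢ Icc x' y') (isCompact_Icc.prod isCompact_Icc)).subset
    (inter_subset_inter_right _ (prod_mono Ioc_subset_Icc_self Ioc_subset_Icc_self))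

lemma lastPassageZero_mono (S : Configuration) {x x' y y' : ℝ} (hx : x ≤ x') (hy : y ≤ y') :
    lastPassageZero S x y ≤ lastPassageZero S x' y' :=
  longestIncreasing_mono (S.finite_inter _ _ _ _)
    (inter_subset_inter_right _ (prod_mono (Ioc_subset_Ioc_right hx) (Ioc_subset_Ioc_right hy)))

lemma lastPassageZero_of_nonpos_left (S : Configuration) {x : ℝ} (hx : x ≤ 0) (y : ℝ) :
    lastPassageZero S x y = 0 := by
  have he : S.points ∩ Ioc ((0 : ℝ), (0 : ℝ)).1 ((x, y) : ℝ × ℝ).1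
      ×ˢ Ioc ((0 : ℝ), (0 : ℝ)).2 ((x, y) : ℝ × ℝ).2 = ∅ := by
    simp [Ioc_eq_empty_of_le hx]
  rw [lastPassageZero, lastPassage, he]
  obtain ⟨z, hz⟩ := exists_isIncreasing (A := ∅) Set.finite_empty
  by_contra h
  exact hz.1 ⟨0, Nat.pos_of_ne_zero h⟩

lemma lastPassageZero_of_nonpos_right (S : Configuration) (x : ℝ) {y : ℝ} (hy : y ≤ 0) :
    lastPassageZero S x y = 0 := by
  rw [lastPassageZero_of_nonpos S x hy, lastPassageZero_of_nonpos_left S le_rfl]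

/-! ### Occupied cells of a grid -/

/-- The cell in row `j` and column `i` of the grid with columns of width `d` and rows of
height `h`. -/
def gridCell (d h : ℝ) (c : ℕ × ℕ) : Set (ℝ × ℝ) :=
  Ioc (c.2 * d) ((c.2 + 1 : ℕ) * d) ×ˢ Ioc (c.1 * h) ((c.1 + 1 : ℕ) * h)

open Classical in
/-- The occupied cells. -/
def occupied (d h : ℝ) (S : Configuration) (c : ℕ × ℕ) : Bool :=
  decide (1 ≤ (S.points ∩ gridCell d h c).ncard)

/-- The points of column `i`, up to height `y`. -/
def columnStrip (d y : ℝ) (i : ℕ) : Set (ℝ × ℝ) := Ioc (i * d) ((i + 1 : ℕ) * d) ×ˢ Ioc 0 y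

/-- The points of row `j`, up to abscissa `x`. -/
def rowStrip (h x : ℝ) (j : ℕ) : Set (ℝ × ℝ) := Ioc 0 x ×ˢ Ioc (j * h) ((j + 1 : ℕ) * h)

/-- No row and no column of the window with `T` rows and `M` columns has two points. -/
def IsGood (d h : ℝ) (T M : ℕ) (S : Configuration) : Prop :=
  (∀ i < M, (S.points ∩ columnStrip d (T * h) i).ncard ≤ 1) ∧
    ∀ j < T, (S.points ∩ rowStrip h (M * d) j).ncard ≤ 1

section Grid

variable {d h : ℝ} {T M : ℕ} {S : Configuration}

/-- If the last point of an optimal sequence lies neither to the left of the cell nor below it, it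
lies in the cell. Being alone in its row and column, it leaves the other points to the smaller
rectangle. -/
lemma IsGood.lastPassageZero_succ (hS : IsGood d h T M S) (hd : 0 ≤ d) (hh : 0 ≤ h) {j i : ℕ}
    (hj : j < T) (hi : i < M) :
    lastPassageZero S ((i + 1 : ℕ) * d) ((j + 1 : ℕ) * h)
      = max (max (lastPassageZero S (i * d) ((j + 1 : ℕ) * h))
          (lastPassageZero S ((i + 1 : ℕ) * d) (j * h)))
        (lastPassageZero S (i * d) (j * h) + (occupied d h S (j, i)).toNat) := by
  have hid : (i : ℝ) * d ≤ (i + 1 : ℕ) * d := by gcongr; simp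
  have hjh : (j : ℝ) * h ≤ (j + 1 : ℕ) * h := by gcongr; simp
  have hMd : ((i + 1 : ℕ) : ℝ) * d ≤ M * d := by
    have : ((i + 1 : ℕ) : ℝ) ≤ M := by exact_mod_cast hi
    gcongr
  have hTh : ((j + 1 : ℕ) : ℝ) * h ≤ T * h := by
    have : ((j + 1 : ℕ) : ℝ) ≤ T := by exact_mod_cast hj
    gcongr
  have hid0 : 0 ≤ (i : ℝ) * d := by positivity
  have hjh0 : 0 ≤ (j : ℝ) * h := by positivity
  refine le_antisymm ?_ (max_le (max_le (lastPassageZero_mono S hid le_rfl)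
    (lastPassageZero_mono S le_rfl hjh)) ?_)
  · obtain ⟨k, hk⟩ : ∃ k, k = lastPassageZero S ((i + 1 : ℕ) * d) ((j + 1 : ℕ) * h) := ⟨_, rfl⟩
    obtain ⟨z, hz⟩ : ∃ z : Fin k → ℝ × ℝ, IsIncreasing
        (S.points ∩ Ioc 0 ((i + 1 : ℕ) * d) ×ˢ Ioc 0 ((j + 1 : ℕ) * h)) z := by
      rw [hk]; exact exists_isIncreasing (S.finite_inter 0 _ 0 _)
    rw [← hk]
    cases k with
    | zero => exact Nat.zero_le _
    | succ k =>
      have hlast := hz.1 (Fin.last k)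
      have hle := hz.le_last
      by_cases hc : (z (Fin.last k)).1 ≤ i * d
      · refine le_max_of_le_left (le_max_of_le_left ?_)
        exact IsIncreasing.le_longestIncreasing (z := z) (S.finite_inter _ _ _ _)
          ⟨fun l => ⟨(hz.1 l).1, ⟨(hz.1 l).2.1.1, (hle l).1.trans hc⟩, (hz.1 l).2.2⟩, hz.2⟩
      by_cases hr : (z (Fin.last k)).2 ≤ j * h
      · refine le_max_of_le_left (le_max_of_le_right ?_)
        exact IsIncreasing.le_longestIncreasing (z := z) (S.finite_inter _ _ _ _)
          ⟨fun l => ⟨(hz.1 l).1, (hz.1 l).2.1, ⟨(hz.1 l).2.2.1, (hle l).2.trans hr⟩⟩, hz.2⟩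
      rw [not_le] at hc hr
      have hocc : occupied d h S (j, i) = true := by
        have : (S.points ∩ gridCell d h (j, i)).Nonempty :=
          ⟨z (Fin.last k), hlast.1, ⟨hc, hlast.2.1.2⟩, ⟨hr, hlast.2.2.2⟩⟩
        exact decide_eq_true ((Set.ncard_pos (S.finite_inter _ _ _ _)).2 this)
      refine le_max_of_le_right ?_
      rw [hocc]
      refine Nat.add_le_add_right ?_ 1
      have hz' := hz.castSucc
      refine IsIncreasing.le_longestIncreasing (z := fun l => z l.castSucc)
        (S.finite_inter _ _ _ _) ⟨fun l => ?_, hz'.2⟩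
      obtain ⟨⟨hl, hl1, hl2⟩, hlt1, hlt2⟩ := hz'.1 l
      refine ⟨hl, ⟨hl1.1, ?_⟩, ⟨hl2.1, ?_⟩⟩
      -- A preceding point in the same column would coincide with the last one, contradicting strict
      -- monotonicity.
      · by_contra hcon
        have h1 := (Set.ncard_le_one (S.finite_inter _ _ _ _)).1 (hS.1 i hi) (z l.castSucc)
          ⟨hl, ⟨not_le.1 hcon, hl1.2⟩, ⟨hl2.1, hl2.2.trans hTh⟩⟩ (z (Fin.last k))
          ⟨hlast.1, ⟨hc, hlast.2.1.2⟩, ⟨hlast.2.2.1, hlast.2.2.2.trans hTh⟩⟩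
        exact absurd hlt1 (by beta_reduce; rw [h1]; exact lt_irrefl _)
      · by_contra hcon
        have h1 := (Set.ncard_le_one (S.finite_inter _ _ _ _)).1 (hS.2 j hj) (z l.castSucc)
          ⟨hl, ⟨hl1.1, hl1.2.trans hMd⟩, ⟨not_le.1 hcon, hl2.2⟩⟩ (z (Fin.last k))
          ⟨hlast.1, ⟨hlast.2.1.1, hlast.2.1.2.trans hMd⟩, ⟨hr, hlast.2.2.2⟩⟩
        exact absurd hlt2 (by beta_reduce; rw [h1]; exact lt_irrefl _)
  · cases hocc : occupied d h S (j, i) with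
    | false => exact lastPassageZero_mono S hid hjh
    | true =>
      obtain ⟨p, hpS, hp1, hp2⟩ := (Set.ncard_pos (S.finite_inter _ _ _ _)).1
        (of_decide_eq_true hocc)
      obtain ⟨z, hz⟩ := exists_isIncreasing (S.finite_inter 0 (i * d) 0 (j * h))
      refine (hz.snoc (B := S.points ∩ Ioc 0 ((i + 1 : ℕ) * d) ×ˢ Ioc 0 ((j + 1 : ℕ) * h)) (p := p)
        (inter_subset_inter_right _ (prod_mono (Ioc_subset_Ioc_right hid)
          (Ioc_subset_Ioc_right hjh))) ⟨hpS, ⟨hid0.trans_lt hp1.1, hp1.2⟩,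
            ⟨hjh0.trans_lt hp2.1, hp2.2⟩⟩ fun q hq => ⟨hq.2.1.2.trans_lt hp1.1,
              hq.2.2.2.trans_lt hp2.1⟩).le_longestIncreasing (S.finite_inter _ _ _ _)

/-- On the good event, the last-passage times at the points of the grid are those of the discrete
model. -/
lemma IsGood.lastPassageZero_eq_lpt (hS : IsGood d h T M S) (hd : 0 ≤ d) (hh : 0 ≤ h) :
    ∀ j ≤ T, ∀ i ≤ M, lastPassageZero S (i * d) (j * h)
      = lpt noPoints noPoints (occupied d h S) j i := by
  intro j
  induction j with
  | zero =>
    intro _ i _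
    rw [lpt_zero_left, count_noPoints, lastPassageZero_of_nonpos_right S _ (by simp)]
  | succ j ihj =>
    intro hj i
    induction i with
    | zero =>
      intro _
      rw [lpt_zero_right, count_noPoints, lastPassageZero_of_nonpos_left S (by simp)]
    | succ i ihi =>
      intro hi
      rw [hS.lastPassageZero_succ hd hh hj hi, ihi (by omega), ihj (by omega) _ hi,
        ihj (by omega) _ (by omega), ← isLastPassage_lpt]

/-- Monotonicity in `x` places the value between those at two neighbouring grid points, which differ
by a single edge. -/
lemma IsGood.abs_lastPassageZero_sub_le (hS : IsGood d h T M S) (hd : 0 < d) (hh : 0 ≤ h) {x : ℝ}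
    {i : ℕ} (hi : i < M) (h1 : i * d ≤ x) (h2 : x ≤ (i + 1 : ℕ) * d) :
    |(lastPassageZero S x (T * h) : ℝ) - lpt noPoints noPoints (occupied d h S) T i| ≤ 1 := by
  have e1 := lastPassageZero_mono S h1 (le_refl (T * h))
  have e2 := lastPassageZero_mono S h2 (le_refl (T * h))
  rw [hS.lastPassageZero_eq_lpt hd.le hh T le_rfl i hi.le] at e1
  rw [hS.lastPassageZero_eq_lpt hd.le hh T le_rfl (i + 1) hi, lpt_succ_right] at e2
  have e3 := Bool.toNat_le (hor noPoints noPoints (occupied d h S) T i)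
  have e4 : lastPassageZero S x (T * h) ≤ lpt noPoints noPoints (occupied d h S) T i + 1 := by omega
  have e1' : (lpt noPoints noPoints (occupied d h S) T i : ℝ) ≤ lastPassageZero S x (T * h) := by
    exact_mod_cast e1
  have e4' : (lastPassageZero S x (T * h) : ℝ) ≤ lpt noPoints noPoints (occupied d h S) T i + 1 := by
    exact_mod_cast e4
  rw [abs_le]; constructor <;> linarith

end Grid

/-! ### Poisson points in a grid -/

/-- The probability is `1 - exp (-r) * (1 + r)`, at most `1 - (1 - r) * (1 + r)`. -/
lemma poissonMeasure_real_two_le (r : ℝ≥0) : (poissonMeasure r).real {k | 2 ≤ k} ≤ (r : ℝ) ^ 2 := by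
  have hc : {k : ℕ | 2 ≤ k} = ({0, 1} : Set ℕ)ᶜ := by
    ext k; simp only [mem_ofPred_eq, mem_compl_iff, mem_insert_iff, mem_singleton_iff]; omega
  have h01 : (poissonMeasure r).real {0, 1} = Real.exp (-r) * (1 + r) := by
    rw [← Set.singleton_union, measureReal_union (by simp) (by measurability),
      poissonMeasure_real_singleton, poissonMeasure_real_singleton]
    simp; ring
  rw [hc, probReal_compl_eq_one_sub (by measurability), h01]
  have := Real.add_one_le_exp (-(r : ℝ))
  nlinarith [r.coe_nonneg]

namespace IsPoissonProcess

variable {Ω : Type*} [MeasurableSpace Ω] {P : Measure Ω} {X : Ω → Configuration}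

lemma isBounded_rect (a b c d : ℝ) : Bornology.IsBounded (Ioc a b ×ˢ Ioc c d) :=
  (Metric.isBounded_Ioc a b).prod (Metric.isBounded_Ioc c d)

lemma volume_rect {a b c d : ℝ} (hab : a ≤ b) :
    volume (Ioc a b ×ˢ Ioc c d) = ENNReal.ofReal ((b - a) * (d - c)) := by
  rw [Measure.volume_eq_prod, Measure.prod_prod, Real.volume_Ioc, Real.volume_Ioc,
    ENNReal.ofReal_mul (by linarith)]

lemma hasLaw_rect (hX : IsPoissonProcess X P) {a b c d : ℝ} (hab : a ≤ b) :
    HasLaw (fun ω => ((X ω).points ∩ Ioc a b ×ˢ Ioc c d).ncard)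
      (poissonMeasure ((b - a) * (d - c)).toNNReal) P := by
  have h := hX.hasLaw_count _ (measurableSet_Ioc.prod measurableSet_Ioc) (isBounded_rect a b c d)
  rw [volume_rect hab] at h
  exact h

lemma measureReal_two_le (hX : IsPoissonProcess X P) {a b c d : ℝ} (hab : a ≤ b) (hcd : c ≤ d) :
    P.real {ω | 2 ≤ ((X ω).points ∩ Ioc a b ×ˢ Ioc c d).ncard} ≤ ((b - a) * (d - c)) ^ 2 := by
  have h := measureReal_preimage_le (hX.hasLaw_rect (c := c) (d := d) hab) {k | 2 ≤ k}
  refine h.trans ((poissonMeasure_real_two_le _).trans_eq ?_)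
  rw [Real.coe_toNNReal _ (mul_nonneg (by linarith) (by linarith))]

lemma measureReal_not_isGood_le (hX : IsPoissonProcess X P) [IsProbabilityMeasure P] {d h : ℝ}
    (hd : 0 ≤ d) (hh : 0 ≤ h) (T M : ℕ) :
    P.real {ω | ¬ IsGood d h T M (X ω)} ≤ M * (d * (T * h)) ^ 2 + T * ((M * d) * h) ^ 2 := by
  have hsub : {ω | ¬ IsGood d h T M (X ω)} ⊆
      (⋃ i ∈ Finset.range M, {ω | 2 ≤ ((X ω).points ∩ columnStrip d (T * h) i).ncard}) ∪
      ⋃ j ∈ Finset.range T, {ω | 2 ≤ ((X ω).points ∩ rowStrip h (M * d) j).ncard} := by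
    intro ω hω
    rw [mem_ofPred_eq, IsGood, not_and_or] at hω
    push Not at hω
    rcases hω with ⟨i, hi, h2⟩ | ⟨j, hj, h2⟩
    · exact Or.inl (mem_iUnion₂.2 ⟨i, Finset.mem_range.2 hi, h2⟩)
    · exact Or.inr (mem_iUnion₂.2 ⟨j, Finset.mem_range.2 hj, h2⟩)
  refine (measureReal_mono hsub (measure_ne_top _ _)).trans ((measureReal_union_le _ _).trans ?_)
  have step : ∀ i : ℕ, ∀ e : ℝ, 0 ≤ e → (i : ℝ) * e ≤ (i + 1 : ℕ) * e := fun i e he => by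
    gcongr; simp
  refine add_le_add ((measureReal_biUnion_finset_le _ _).trans ?_)
    ((measureReal_biUnion_finset_le _ _).trans ?_)
  · refine (Finset.sum_le_sum (g := fun _ => (d * (T * h)) ^ 2) fun i _ => ?_).trans_eq (by simp)
    refine (hX.measureReal_two_le (step i d hd) (by positivity)).trans_eq ?_
    push_cast; ring
  · refine (Finset.sum_le_sum (g := fun _ => ((M * d) * h) ^ 2) fun i _ => ?_).trans_eq (by simp)
    refine (hX.measureReal_two_le (by positivity) (step i h hh)).trans_eq ?_
    push_cast; ring

lemma disjoint_gridCell {d h : ℝ} (hd : 0 ≤ d) (hh : 0 ≤ h) {c c' : ℕ × ℕ} (hc : c ≠ c') :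
    Disjoint (gridCell d h c) (gridCell d h c') := by
  have aux : ∀ (e : ℝ) (i i' : ℕ) (x : ℝ), 0 ≤ e → x ∈ Ioc (i * e) ((i + 1 : ℕ) * e) →
      x ∈ Ioc (i' * e) ((i' + 1 : ℕ) * e) → i ≤ i' := by
    intro e i i' x he h1 h2
    by_contra hlt
    have : ((i' + 1 : ℕ) : ℝ) * e ≤ i * e := by
      have : ((i' + 1 : ℕ) : ℝ) ≤ i := by exact_mod_cast not_le.1 hlt
      gcongr
    linarith [h1.1, h2.2]
  refine Set.disjoint_left.2 fun p h1 h2 => hc (Prod.ext ?_ ?_)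
  · exact le_antisymm (aux h _ _ _ hh h1.2 h2.2) (aux h _ _ _ hh h2.2 h1.2)
  · exact le_antisymm (aux d _ _ _ hd h1.1 h2.1) (aux d _ _ _ hd h2.1 h1.1)

/-- The occupied cells of a grid are independent Bernoulli variables. -/
lemma hasLaw_occupied (hX : IsPoissonProcess X P) [IsProbabilityMeasure P] {d h : ℝ} (hd : 0 ≤ d)
    (hh : 0 ≤ h) :
    HasLaw (fun ω => occupied d h (X ω)) (berSeq (ℕ × ℕ) (1 - Real.exp (-(d * h)))) P := by
  classical
  have hcell : ∀ c : ℕ × ℕ, HasLaw (fun ω => ((X ω).points ∩ gridCell d h c).ncard)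
      (poissonMeasure (d * h).toNNReal) P := fun c => by
    have h1 : (c.2 : ℝ) * d ≤ (c.2 + 1 : ℕ) * d := by gcongr; simp
    have := hX.hasLaw_rect (c := c.1 * h) (d := (c.1 + 1 : ℕ) * h) h1
    have e : (((c.2 + 1 : ℕ) : ℝ) * d - c.2 * d) * (((c.1 + 1 : ℕ) : ℝ) * h - c.1 * h) = d * h := by
      push_cast; ring
    rwa [e] at this
  have hdec : Measurable fun k : ℕ => decide (1 ≤ k) := .of_discrete
  have hlaw : ∀ c : ℕ × ℕ, HasLaw (fun ω => occupied d h (X ω) c)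
      (ber (1 - Real.exp (-(d * h)))) P := fun c => by
    have hm : AEMeasurable (fun ω => occupied d h (X ω) c) P :=
      hdec.comp_aemeasurable (hcell c).aemeasurable
    refine ⟨hm, ?_⟩
    have hprob : IsProbabilityMeasure (P.map fun ω => occupied d h (X ω) c) :=
      Measure.isProbabilityMeasure_map hm
    have h0 : 0 ≤ d * h := by positivity
    refine eq_ber (by simpa using h0) (by linarith [Real.exp_pos (-(d * h))]) ?_
    have e1 : (P.map fun ω => occupied d h (X ω) c) {true}
        = (poissonMeasure (d * h).toNNReal) {0}ᶜ := by
      rw [Measure.map_apply_of_aemeasurable hm (by measurability), ← (hcell c).map_eq,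
        Measure.map_apply_of_aemeasurable (hcell c).aemeasurable (by measurability)]
      congr 1
      ext ω
      simp [occupied, Nat.one_le_iff_ne_zero]
    rw [e1, prob_compl_eq_one_sub (by measurability), poissonMeasure_singleton,
      Real.coe_toNNReal _ h0, ENNReal.ofReal_sub _ (Real.exp_pos _).le]
    simp
  have hcount : iIndepFun (fun (c : ℕ × ℕ) ω => ((X ω).points ∩ gridCell d h c).ncard) P := by
    refine iIndepFun_iff_finset.2 fun s => ?_
    have := hX.iIndepFun_count s.card (fun k => gridCell d h (s.equivFin.symm k))
      (fun k => measurableSet_Ioc.prod measurableSet_Ioc)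
      (fun k => isBounded_rect _ _ _ _) fun k l hkl => disjoint_gridCell hd hh fun heq => hkl
        (s.equivFin.symm.injective (Subtype.ext heq))
    refine iIndepFun.of_precomp (g := s.equivFin.symm) s.equivFin.symm.surjective ?_
    exact this
  exact (hcount.comp (fun _ k => decide (1 ≤ k)) fun _ => hdec).hasLaw_infinitePi hlaw
    (aemeasurable_pi_iff.2 fun c => (hlaw c).aemeasurable)

/-- Last-passage times are random variables. -/
lemma aemeasurable_lastPassageZero (hX : IsPoissonProcess X P) [IsProbabilityMeasure P]
    (x t : ℝ) : AEMeasurable (fun ω => (lastPassageZero (X ω) x t : ℝ)) P := by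
  rcases le_or_gt x 0 with hx | hx
  · simp [lastPassageZero_of_nonpos_left _ hx]
  rcases le_or_gt t 0 with ht | ht
  · simp [lastPassageZero_of_nonpos_right _ _ ht]
  let d : ℕ → ℝ := fun k => x / 2 ^ k
  let h : ℕ → ℝ := fun k => t / 2 ^ k
  have hd : ∀ k, 0 ≤ d k := fun k => by positivity
  have hh : ∀ k, 0 ≤ h k := fun k => by positivity
  -- On dyadic grids the bad probabilities are summable, so by Borel–Cantelli the discrete times are
  -- almost surely eventually equal to the last-passage time.
  have hbad : ∀ k, P {ω | ¬ IsGood (d k) (h k) (2 ^ k) (2 ^ k) (X ω)}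
      ≤ ENNReal.ofReal (2 * (x * t) ^ 2 * (1 / 2) ^ k) := fun k => by
    have := hX.measureReal_not_isGood_le (hd k) (hh k) (2 ^ k) (2 ^ k)
    rw [← ofReal_measureReal]
    refine ENNReal.ofReal_le_ofReal (this.trans_eq ?_)
    simp only [d, h, one_div, inv_pow]
    push_cast
    field_simp
    ring
  have hsum : ∑' k, P {ω | ¬ IsGood (d k) (h k) (2 ^ k) (2 ^ k) (X ω)} ≠ ∞ := by
    refine ne_top_of_le_ne_top ?_ (ENNReal.tsum_le_tsum hbad)
    rw [← ENNReal.ofReal_tsum_of_nonneg (fun k => by positivity)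
      (summable_geometric_two.mul_left _)]
    exact ENNReal.ofReal_ne_top
  refine aemeasurable_of_tendsto_metrizable_ae atTop (f := fun k ω =>
    (lpt noPoints noPoints (occupied (d k) (h k) (X ω)) (2 ^ k) (2 ^ k) : ℝ)) (fun k => ?_) ?_
  · have hm : Measurable fun w : ℕ × ℕ → Bool => (lpt noPoints noPoints w (2 ^ k) (2 ^ k) : ℝ) :=
      (Measurable.of_discrete (f := fun m : ℕ => (m : ℝ))).comp
        (measurable_lpt measurable_const measurable_const measurable_id _ _)
    exact hm.comp_aemeasurable (hX.hasLaw_occupied (hd k) (hh k)).aemeasurable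
  · filter_upwards [ae_eventually_notMem hsum] with ω hω
    refine tendsto_const_nhds.congr' ?_
    filter_upwards [hω] with k hk
    rw [not_not] at hk
    have e := hk.lastPassageZero_eq_lpt (hd k) (hh k) _ le_rfl _ le_rfl
    rw [← e]
    simp only [d, h]
    push_cast
    rw [mul_div_cancel₀ _ (by positivity), mul_div_cancel₀ _ (by positivity)]

end IsPoissonProcess

/-! ### Coupling of the Poisson process with the discrete model -/

section Coupling

variable {Ω : Type*} [MeasurableSpace Ω] {P : Measure Ω}

/-- The map `g` is only almost everywhere measurable, so the product is formed with its measurable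
version. -/
lemma hasLaw_prodMk_comp_snd {α β : Type*} [MeasurableSpace α] [MeasurableSpace β] (μ : Measure α)
    [SFinite μ] [SFinite P] {g : Ω → β} {ν : Measure β} [SFinite ν] (hg : HasLaw g ν P) :
    HasLaw (fun z : α × Ω => (z.1, g z.2)) (μ.prod ν) (μ.prod P) := by
  have hm : MeasurePreserving (hg.aemeasurable.mk g) P ν :=
    ⟨hg.aemeasurable.measurable_mk, by
      rw [← Measure.map_congr hg.aemeasurable.ae_eq_mk, hg.map_eq]⟩
  refine ((MeasurePreserving.id μ).prod hm).hasLaw.congr ?_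
  filter_upwards [Measure.quasiMeasurePreserving_snd.ae_eq_comp (μ := μ.prod P)
    hg.aemeasurable.ae_eq_mk] with z hz
  exact Prod.ext rfl hz

/-- The configuration together with independent uniform levels for the sources and sinks. -/
def withLevels (P : Measure Ω) : Measure ((ℕ → ℝ) × (ℕ → ℝ) × Ω) := unifSeq.prod (unifSeq.prod P)

instance [IsProbabilityMeasure P] : IsProbabilityMeasure (withLevels P) := by
  unfold withLevels; infer_instance

lemma hasLaw_snd_snd_withLevels [IsProbabilityMeasure P] :
    HasLaw (fun θ : (ℕ → ℝ) × (ℕ → ℝ) × Ω => θ.2.2) P (withLevels P) :=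
  (measurePreserving_snd.comp (measurePreserving_snd (μ := unifSeq)
    (ν := unifSeq.prod P))).hasLaw

/-- The discrete model read off a configuration. -/
def discretise (X : Ω → Configuration) (d h : ℝ) (θ : (ℕ → ℝ) × (ℕ → ℝ) × Ω) : Base :=
  (θ.1, θ.2.1, occupied d h (X θ.2.2))

variable {X : Ω → Configuration}

lemma IsPoissonProcess.hasLaw_discretise (hX : IsPoissonProcess X P) [IsProbabilityMeasure P]
    {d h : ℝ} (hd : 0 ≤ d) (hh : 0 ≤ h) :
    HasLaw (discretise X d h) (base (1 - Real.exp (-(d * h)))) (withLevels P) :=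
  hasLaw_prodMk_comp_snd unifSeq (hasLaw_prodMk_comp_snd unifSeq (hX.hasLaw_occupied hd hh))

end Coupling

/-! ### Comparison with the walk at a fixed scale. -/

/-- The number of columns of width `s n / T` in an interval of length `n ^ γ`. -/
def rate (γ s n : ℝ) (T : ℕ) : ℝ := n ^ γ / (s * n / T)

/-- The normalisation of the increments. -/
def scale (γ s n : ℝ) : ℝ := s ^ (-(1 / 4) : ℝ) * n ^ (γ / 2)

lemma scale_pos {γ s n : ℝ} (hs : 0 < s) (hn : 0 < n) : 0 < scale γ s n :=
  mul_pos (Real.rpow_pos_of_pos hs _) (Real.rpow_pos_of_pos hn _)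

lemma rate_nonneg {γ s n : ℝ} (hs : 0 < s) (hn : 0 < n) (T : ℕ) : 0 ≤ rate γ s n T := by
  have := Real.rpow_pos_of_pos hn γ
  unfold rate; positivity

section FixedScale

variable {γ s n : ℝ} {T W : ℕ}

lemma column_mem_window (hs : 0 < s) (hn : 0 < n) (hW : W < T) {K u : ℝ}
    (hK : K * rate γ s n T + 1 ≤ W) (hu : |u| ≤ K) :
    (column T (rate γ s n T) u : ℝ) = T + ⌊u * rate γ s n T⌋ ∧
      T - W ≤ column T (rate γ s n T) u ∧ column T (rate γ s n T) u ≤ T + W := by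
  have hρ := rate_nonneg (γ := γ) hs hn T
  have hu' := abs_le.1 hu
  have h1 : -(K * rate γ s n T) ≤ u * rate γ s n T := by nlinarith
  have h2 : u * rate γ s n T ≤ K * rate γ s n T := by nlinarith
  have hWT : (W : ℝ) < T := by exact_mod_cast hW
  have hcol : (column T (rate γ s n T) u : ℝ) = T + ⌊u * rate γ s n T⌋ :=
    cast_column (by linarith)
  have h3 := Int.floor_le (u * rate γ s n T)
  have h4 := Int.lt_floor_add_one (u * rate γ s n T)
  have l1 : (T : ℝ) ≤ ((column T (rate γ s n T) u + W : ℕ) : ℝ) := by push_cast; linarith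
  have l2 : (column T (rate γ s n T) u : ℝ) ≤ ((T + W : ℕ) : ℝ) := by push_cast; linarith
  exact ⟨hcol, by have : T ≤ column T (rate γ s n T) u + W := by exact_mod_cast l1
                  omega, by exact_mod_cast l2⟩

/-- The `3` collects three roundings: the last-passage times at the two positions, and the centring
`a` times the rounding of the column. The term with `K` is the bias of the density `a` relative to
the slope of the last-passage time. -/
lemma abs_increment_sub_walk_le (hs : 0 < s) (hn : 0 < n) (hT : 0 < T) (hW : W < T)
    {S : Configuration} (hS : IsGood (s * n / T) (n / T) T (2 * T) S) {a : ℝ} (h0 : 0 ≤ a)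
    (h1 : a ≤ 1) {K u : ℝ} (hK : K * rate γ s n T + 1 ≤ W) (hu : |u| ≤ K) (H : ℕ → Bool) :
    |increment γ s n S u - walk a (scale γ s n) (rate γ s n T) T H u|
      ≤ (|((lpt noPoints noPoints (occupied (s * n / T) (n / T) S) T
            (column T (rate γ s n T) u) : ℝ)
          - lpt noPoints noPoints (occupied (s * n / T) (n / T) S) T T)
          - ((count H (column T (rate γ s n T) u) : ℝ) - count H T)|
        + (3 + K * |a * rate γ s n T - s ^ (-(1 / 2) : ℝ) * n ^ γ|)) / scale γ s n := by
  have hT' : (0 : ℝ) < T := by exact_mod_cast hT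
  have hd : 0 < s * n / T := by positivity
  have hh : 0 ≤ n / T := by positivity
  obtain ⟨hcol, hc1, hc2⟩ := column_mem_window hs hn hW hK hu
  set ρ := rate γ s n T with hρ
  set i := column T ρ u with hi
  have hTd : (T : ℝ) * (s * n / T) = s * n := by field_simp
  have hTh : (T : ℝ) * (n / T) = n := by field_simp
  have hρd : ρ * (s * n / T) = n ^ γ := by rw [hρ, rate]; field_simp
  have f1 := Int.floor_le (u * ρ)
  have f2 := Int.lt_floor_add_one (u * ρ)
  have b1 := hS.abs_lastPassageZero_sub_le hd hh (x := s * n + u * n ^ γ) (i := i) (by omega)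
    (by rw [hcol, add_mul, hTd, ← hρd, ← mul_assoc]; gcongr)
    (by
      push_cast
      rw [hcol, add_assoc, add_mul, hTd, ← hρd, ← mul_assoc]; gcongr)
  have b2 := hS.abs_lastPassageZero_sub_le hd hh (x := s * n) (i := T) (by omega) hTd.le
    (by push_cast; rw [add_mul, hTd]; linarith)
  rw [hTh] at b1 b2
  have b3 : |a * (((⌊u * ρ⌋ : ℤ) : ℝ) - u * ρ)| ≤ 1 := by
    rw [abs_mul, abs_of_nonneg h0]
    have : |((⌊u * ρ⌋ : ℤ) : ℝ) - u * ρ| ≤ 1 := by rw [abs_le]; constructor <;> linarith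
    nlinarith [abs_nonneg (((⌊u * ρ⌋ : ℤ) : ℝ) - u * ρ)]
  have b4 : |u * (a * ρ - s ^ (-(1 / 2) : ℝ) * n ^ γ)|
      ≤ K * |a * ρ - s ^ (-(1 / 2) : ℝ) * n ^ γ| := by
    rw [abs_mul]; gcongr
  have hsc := scale_pos (γ := γ) hs hn
  rw [increment, walk, psum_centred, psum_centred]
  change |_ / scale γ s n - _| ≤ _
  rw [← sub_div, abs_div, abs_of_pos hsc]
  gcongr
  set D := ((lpt noPoints noPoints (occupied (s * n / T) (n / T) S) T i : ℝ)
    - lpt noPoints noPoints (occupied (s * n / T) (n / T) S) T T)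
    - ((count H i : ℝ) - count H T) with hD
  have e : ((lastPassageZero S (s * n + u * n ^ γ) n : ℝ) - (lastPassageZero S (s * n) n : ℝ)
      - s ^ (-(1 / 2) : ℝ) * u * n ^ γ) - (((count H i : ℝ) - i * a) - ((count H T : ℝ) - T * a))
      = D + (((lastPassageZero S (s * n + u * n ^ γ) n : ℝ)
          - lpt noPoints noPoints (occupied (s * n / T) (n / T) S) T i)
        + (-((lastPassageZero S (s * n) n : ℝ)
          - lpt noPoints noPoints (occupied (s * n / T) (n / T) S) T T)
        + (a * (((⌊u * ρ⌋ : ℤ) : ℝ) - u * ρ)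
        + u * (a * ρ - s ^ (-(1 / 2) : ℝ) * n ^ γ)))) := by
    rw [hD, hcol]; ring
  rw [e]
  refine (abs_add_le _ _).trans (add_le_add le_rfl ?_)
  have b5 := (abs_add_le _ _).trans (add_le_add b3 b4)
  have b6 := (abs_add_le _ _).trans (add_le_add ((abs_neg _).trans_le b2) b5)
  have b7 := (abs_add_le _ _).trans (add_le_add b1 b6)
  linarith

variable {Ω : Type*} [MeasurableSpace Ω] {P : Measure Ω} [IsProbabilityMeasure P]
  {X : Ω → Configuration}

lemma IsPoissonProcess.measureReal_increment_sub_walk_le (hX : IsPoissonProcess X P) (hs : 0 < s)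
    (hn : 0 < n) (hT : 0 < T) {r η : ℝ} (hr : 0 < r) (hr1 : r ≤ 1 / 10)
    (hr2 : r ^ 2 = 1 - Real.exp (-(s * n / T * (n / T)))) (hη : 0 < η) (hη1 : η ≤ 1 / 32)
    (hW : W ≤ η / 8 * T) (hTr : 20 ≤ η ^ 3 * (T * r)) {K δ : ℝ} (hK : K * rate γ s n T + 1 ≤ W)
    (hδ : 0 < δ) (hδ' : 3 + K * |dens r (1 - 2 * η) * rate γ s n T - s ^ (-(1 / 2) : ℝ) * n ^ γ|
      ≤ δ / 2 * scale γ s n) :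
    (withLevels P).real {θ | ∃ u, |u| ≤ K ∧ δ ≤ |incrementPath γ s n (X θ.2.2) u
        - walk (dens r (1 - 2 * η)) (scale γ s n) (rate γ s n T) T
          (outgoing (dens r (1 - 2 * η)) (dens r (1 - 2 * η)⁻¹) T (T + W)
            (discretise X (s * n / T) (n / T) θ)).1 u|}
      ≤ 6 * s ^ 2 * n ^ 4 / T + 60192 / (η ^ 3 * (T * r))
        + 10 * η * r * W / (δ / 2 * scale γ s n) := by
  have hT' : (0 : ℝ) < T := by exact_mod_cast hT
  have hd : 0 < s * n / T := by positivity
  have hh : 0 ≤ n / T := by positivity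
  have hsc := scale_pos (γ := γ) hs hn
  have hl : 0 < 1 - 2 * η := by linarith
  have hWT : W < T := by
    have : (W : ℝ) < T := by nlinarith
    exact_mod_cast this
  have hB := balanced_dens hr (by linarith) hl
  have hcast : ((T - W : ℕ) : ℝ) = T - W := Nat.cast_sub hWT.le
  have hWT2 : (W : ℝ) ≤ T / 2 := by nlinarith
  have hη3 : 0 < η ^ 3 := by positivity
  have hTr' : η ^ 3 * (T * r) ≤ 2 * (η ^ 3 * (((T - W : ℕ) : ℝ) * r)) := by
    have : (T : ℝ) * r ≤ 2 * (((T - W : ℕ) : ℝ) * r) := by rw [hcast]; nlinarith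
    nlinarith
  have hwin := window_comparison_dens hr hr1 hη hη1 (T := T) (x₁ := T - W) (x₀ := T)
    (x₂ := T + W) (by omega) (by omega) (d := δ / 2 * scale γ s n) (by positivity) (by linarith)
    (by linarith)
    (by push_cast; rw [add_sub_cancel_left, abs_of_nonneg (Nat.cast_nonneg _)]; nlinarith)
    (by rw [hcast, sub_sub_cancel, abs_of_nonneg (Nat.cast_nonneg _)]; nlinarith)
  set E := {z : Base | ∃ x, T - W ≤ x ∧ x ≤ T + W ∧ δ / 2 * scale γ s n ≤
    |((lpt noPoints noPoints z.2.2 T x : ℝ) - lpt noPoints noPoints z.2.2 T T)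
      - ((count (outgoing (dens r (1 - 2 * η)) (dens r (1 - 2 * η)⁻¹) T (T + W) z).1 x : ℝ)
        - count (outgoing (dens r (1 - 2 * η)) (dens r (1 - 2 * η)⁻¹) T (T + W) z).1 T)|}
  have hE : (withLevels P).real {θ | discretise X (s * n / T) (n / T) θ ∈ E}
      ≤ (base (r ^ 2)).real E := by
    rw [hr2]; exact measureReal_preimage_le (hX.hasLaw_discretise hd.le hh) E
  -- With `2 * T` columns, the columns contribute `2 * s ^ 2 * n ^ 4 / T` and the rows `4 * s ^ 2 *
  -- n ^ 4 / T`.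
  have hG : (withLevels P).real {θ | ¬ IsGood (s * n / T) (n / T) T (2 * T) (X θ.2.2)}
      ≤ 6 * s ^ 2 * n ^ 4 / T := by
    refine (measureReal_preimage_le hasLaw_snd_snd_withLevels
      {ω | ¬ IsGood (s * n / T) (n / T) T (2 * T) (X ω)}).trans
      ((hX.measureReal_not_isGood_le hd.le hh T (2 * T)).trans_eq ?_)
    push_cast
    field_simp
    ring
  have hsub : {θ : (ℕ → ℝ) × (ℕ → ℝ) × Ω | ∃ u, |u| ≤ K ∧ δ ≤ |incrementPath γ s n (X θ.2.2) u
        - walk (dens r (1 - 2 * η)) (scale γ s n) (rate γ s n T) T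
          (outgoing (dens r (1 - 2 * η)) (dens r (1 - 2 * η)⁻¹) T (T + W)
            (discretise X (s * n / T) (n / T) θ)).1 u|}
      ⊆ {θ | ¬ IsGood (s * n / T) (n / T) T (2 * T) (X θ.2.2)}
        ∪ {θ | discretise X (s * n / T) (n / T) θ ∈ E} := by
    rintro θ ⟨u, hu, hθ⟩
    by_cases hS : IsGood (s * n / T) (n / T) T (2 * T) (X θ.2.2)
    swap
    · exact Or.inl hS
    obtain ⟨-, hc1, hc2⟩ := column_mem_window hs hn hWT hK hu
    refine Or.inr ⟨_, hc1, hc2, ?_⟩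
    have := hθ.trans (abs_increment_sub_walk_le hs hn hT hWT hS hB.a_nonneg hB.a_le hK hu _)
    rw [le_div_iff₀ hsc] at this
    have cancel : ∀ x y : ℝ, δ * scale γ s n ≤ x + y → y ≤ δ / 2 * scale γ s n →
      δ / 2 * scale γ s n ≤ x := fun x y h1 h2 => by linarith
    exact cancel _ _ this hδ'
  refine (measureReal_mono hsub (measure_ne_top _ _)).trans ((measureReal_union_le _ _).trans ?_)
  -- As `W ≤ T / 2`, the estimate at the left end of the window is at most twice that at the right
  -- end, whence `60192 = 3 * 20064`.
  have h2 : 20064 / (η ^ 3 * (((T - W : ℕ) : ℝ) * r)) ≤ 40128 / (η ^ 3 * (T * r)) := by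
    rw [div_le_div_iff₀ (by linarith) (by positivity)]
    linarith
  have h3 : 5 * η * r * (((T + W : ℕ) : ℝ) - ((T - W : ℕ) : ℝ)) = 10 * η * r * W := by
    rw [hcast]; push_cast; ring
  rw [h3] at hwin
  have h4 : 20064 / (η ^ 3 * (T * r)) + 40128 / (η ^ 3 * (T * r)) = 60192 / (η ^ 3 * (T * r)) := by
    ring
  linarith [hE.trans hwin]

end FixedScale

/-! ### Choice of the parameters -/

/-- The number of rows of the grid. -/
def gridRows (n : ℝ) : ℕ := ⌈n ^ 5⌉₊

/-- The square root of the probability that a cell is occupied. -/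
def cellRoot (s n : ℝ) : ℝ :=
  √(1 - Real.exp (-(s * n / gridRows n * (n / gridRows n))))

/-- The relative change of the density of the stationary model. -/
def tilt (γ n : ℝ) : ℝ := n ^ (-(γ / 4 + 1 / 6))

/-- Half the width of the window in which the models are compared. -/
def halfWindow (γ s n : ℝ) : ℕ := ⌈n ^ (1 / 12 - γ / 8) * rate γ s n (gridRows n)⌉₊

/-- The density of the sources. -/
def sourceDensity (γ s n : ℝ) : ℝ := dens (cellRoot s n) (1 - 2 * tilt γ n)

lemma gridRows_ge (n : ℝ) : n ^ 5 ≤ gridRows n := Nat.le_ceil _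

lemma gridRows_pos {n : ℝ} (hn : 0 < n) : 0 < gridRows n := Nat.ceil_pos.2 (by positivity)

lemma tilt_pos {γ n : ℝ} (hn : 0 < n) : 0 < tilt γ n := Real.rpow_pos_of_pos hn _

section

variable {s n : ℝ}

lemma cellRoot_sq (hs : 0 < s) (hn : 0 < n) :
    cellRoot s n ^ 2 = 1 - Real.exp (-(s * n / gridRows n * (n / gridRows n))) := by
  have : 0 ≤ s * n / gridRows n * (n / gridRows n) := by positivity
  rw [cellRoot, Real.sq_sqrt]
  simpa using this

/-- The leading order of `cellRoot`. -/
def rootIntensity (s n : ℝ) : ℝ := √s * n / gridRows n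

lemma rootIntensity_pos (hs : 0 < s) (hn : 0 < n) : 0 < rootIntensity s n := by
  have : (0 : ℝ) < gridRows n := by exact_mod_cast gridRows_pos hn
  have := Real.sqrt_pos.2 hs
  unfold rootIntensity; positivity

lemma rootIntensity_sq (hs : 0 < s) :
    rootIntensity s n ^ 2 = s * n / gridRows n * (n / gridRows n) := by
  rw [rootIntensity, div_pow, mul_pow, Real.sq_sqrt hs.le]; ring

lemma cellRoot_le (hs : 0 < s) (hn : 0 < n) : cellRoot s n ≤ rootIntensity s n := by
  refine Real.sqrt_le_iff.2 ⟨(rootIntensity_pos hs hn).le, ?_⟩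
  rw [rootIntensity_sq hs]
  linarith [Real.add_one_le_exp (-(s * n / gridRows n * (n / gridRows n)))]

lemma le_cellRoot (hs : 0 < s) (hn : 0 < n) (hv : rootIntensity s n ≤ 1) :
    rootIntensity s n * (1 - rootIntensity s n ^ 2) ≤ cellRoot s n := by
  have hv0 := rootIntensity_pos hs hn
  refine Real.le_sqrt_of_sq_le ?_
  rw [← rootIntensity_sq hs]
  set v := rootIntensity s n
  have hv2 : v ^ 2 ≤ 1 := by nlinarith
  have h1 : (1 - v ^ 2) ^ 2 ≤ 1 - v ^ 2 := by nlinarith [sq_nonneg v]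
  have h3 : Real.exp (-v ^ 2) ≤ (1 + v ^ 2)⁻¹ := by
    rw [Real.exp_neg]
    exact inv_anti₀ (by positivity) (by linarith [Real.add_one_le_exp (v ^ 2)])
  have h4 : (1 + v ^ 2)⁻¹ ≤ 1 - v ^ 2 * (1 - v ^ 2) := by
    rw [inv_le_iff_one_le_mul₀ (by positivity)]
    nlinarith [sq_nonneg (v ^ 2), mul_nonneg (sq_nonneg (v ^ 2)) (sq_nonneg v)]
  nlinarith [sq_nonneg v]

lemma cellRoot_pos (hs : 0 < s) (hn : 0 < n) : 0 < cellRoot s n := by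
  have hT : (0 : ℝ) < gridRows n := by exact_mod_cast gridRows_pos hn
  have : 0 < s * n / gridRows n * (n / gridRows n) := by positivity
  exact Real.sqrt_pos.2 (sub_pos.2 (by simpa using this))

/-- The relative error has two sources: lattice effects of the order of the mesh, and the tilt of
the rate. -/
lemma abs_sourceDensity_sub_le {γ : ℝ} (hs : 0 < s) (hn : 0 < n) (hv : rootIntensity s n ≤ 1)
    (hη : tilt γ n ≤ 1 / 32) :
    |sourceDensity γ s n - rootIntensity s n|
      ≤ rootIntensity s n * (2 * rootIntensity s n + 2 * tilt γ n) := by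
  have hv0 := rootIntensity_pos hs hn
  have hη0 := tilt_pos (γ := γ) hn
  have hr0 := cellRoot_pos hs hn
  have h1 := cellRoot_le hs hn
  have h2 := le_cellRoot hs hn hv
  have hl : 0 < 1 - 2 * tilt γ n := by linarith
  have h3 := dens_le hr0 hl
  have h4 : (1 - 2 * tilt γ n) * cellRoot s n * (1 - (1 - 2 * tilt γ n) * cellRoot s n)
      ≤ sourceDensity γ s n := by
    unfold sourceDensity dens
    have : 0 < (1 - 2 * tilt γ n) * cellRoot s n := by positivity
    rw [le_div_iff₀ (by positivity)]
    nlinarith [mul_pos (mul_pos this this) this]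
  have h3' : sourceDensity γ s n ≤ (1 - 2 * tilt γ n) * cellRoot s n := h3
  set v := rootIntensity s n
  set η := tilt γ n
  set ρ := cellRoot s n
  set a := sourceDensity γ s n
  have h5 : (1 - 2 * η) * ρ ≤ v := by nlinarith
  have h6 : (1 - 2 * η) * (v * (1 - v ^ 2)) ≤ (1 - 2 * η) * ρ := by gcongr
  have h7 : v * (1 - v ^ 2 - 2 * η) ≤ (1 - 2 * η) * ρ := by
    nlinarith [mul_pos (mul_pos hη0 hv0) (mul_pos hv0 hv0)]
  have h8 : ((1 - 2 * η) * ρ) * ((1 - 2 * η) * ρ) ≤ v * v :=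
    mul_le_mul h5 h5 (by positivity) hv0.le
  have h9 : v ^ 2 ≤ v := by nlinarith
  have h10 : v * v ^ 2 ≤ v * v := by gcongr
  rw [abs_le]
  constructor <;> nlinarith

/-- The mesh cancels: to leading order the walk has exactly the slope `s ^ (-1/2)` subtracted in
`increment`. -/
lemma rootIntensity_mul_rate {γ : ℝ} (hs : 0 < s) (hn : 0 < n) :
    rootIntensity s n * rate γ s n (gridRows n) = s ^ (-(1 / 2) : ℝ) * n ^ γ := by
  have hT : (0 : ℝ) < gridRows n := by exact_mod_cast gridRows_pos hn
  have h1 := Real.sqrt_pos.2 hs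
  have h2 : s = √s * √s := (Real.mul_self_sqrt hs.le).symm
  rw [rootIntensity, rate, Real.rpow_neg hs.le, ← Real.sqrt_eq_rpow]
  field_simp
  rw [sq, ← h2]

lemma scale_sq {γ : ℝ} (hs : 0 < s) (hn : 0 < n) :
    scale γ s n ^ 2 = s ^ (-(1 / 2) : ℝ) * n ^ γ := by
  rw [scale, mul_pow, ← Real.rpow_natCast, ← Real.rpow_natCast, ← Real.rpow_mul hs.le,
    ← Real.rpow_mul hn.le]
  norm_num

end

/-! ### Asymptotics of the parameters -/

section

variable {γ s : ℝ}

lemma tendsto_rpow_atTop_nhds_zero {e : ℝ} (he : e < 0) :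
    Tendsto (fun n : ℝ => n ^ e) atTop (𝓝 0) := by
  simpa using tendsto_rpow_neg_atTop (neg_pos.2 he)

lemma rate_eq {n : ℝ} (hn : 0 < n) (T : ℕ) : rate γ s n T = n ^ (γ - 1) / s * T := by
  rw [rate, Real.rpow_sub_one hn.ne']
  field_simp

lemma tendsto_rootIntensity_mul (s : ℝ) :
    Tendsto (fun n => rootIntensity s n * n) atTop (𝓝 0) := by
  have h : Tendsto (fun n : ℝ => √s / n) atTop (𝓝 0) := tendsto_const_nhds.div_atTop tendsto_id
  refine squeeze_zero' ?_ ?_ h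
  · filter_upwards [eventually_gt_atTop 0] with n hn
    unfold rootIntensity; positivity
  · filter_upwards [eventually_ge_atTop 1] with n hn
    have h1 : n ^ 3 ≤ gridRows n := (pow_le_pow_right₀ hn (by norm_num)).trans (gridRows_ge n)
    have h2 : (0 : ℝ) < gridRows n := by exact_mod_cast gridRows_pos (by linarith)
    have h3 := Real.sqrt_nonneg s
    rw [rootIntensity, div_mul_eq_mul_div, div_le_div_iff₀ h2 (by linarith)]
    calc √s * n * n * n = √s * n ^ 3 := by ring
      _ ≤ √s * gridRows n := by gcongr

lemma tendsto_rootIntensity (hs : 0 < s) : Tendsto (rootIntensity s) atTop (𝓝 0) := by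
  refine squeeze_zero' ?_ ?_ (tendsto_rootIntensity_mul s)
  · filter_upwards [eventually_gt_atTop 0] with n hn using (rootIntensity_pos hs hn).le
  · filter_upwards [eventually_ge_atTop 1] with n hn
    exact le_mul_of_one_le_right (rootIntensity_pos hs (by linarith)).le hn

lemma tendsto_tilt (hγ : 0 < γ) : Tendsto (tilt γ) atTop (𝓝 0) :=
  tendsto_rpow_atTop_nhds_zero (by linarith)

lemma tendsto_scale (hγ : 0 < γ) (hs : 0 < s) : Tendsto (scale γ s) atTop atTop :=
  (tendsto_rpow_atTop (half_pos hγ)).const_mul_atTop (Real.rpow_pos_of_pos hs _)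

lemma eventually_small (hγ : 0 < γ) (hs : 0 < s) : ∀ᶠ n in atTop, 1 ≤ n ∧ 0 < tilt γ n ∧
    tilt γ n ≤ 1 / 32 ∧ rootIntensity s n ≤ 1 / 10 := by
  filter_upwards [eventually_ge_atTop 1, (tendsto_tilt hγ).eventually_le_const
    (by norm_num : (0 : ℝ) < 1 / 32), (tendsto_rootIntensity hs).eventually_le_const
    (by norm_num : (0 : ℝ) < 1 / 10)] with n h1 h2 h3
  exact ⟨h1, tilt_pos (by linarith), h2, h3⟩

/-- The relative error of the density tends to zero fast enough. -/
lemma tendsto_scale_mul_error (hγ : 0 < γ) (hγ' : γ < 2 / 3) (hs : 0 < s) :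
    Tendsto (fun n => scale γ s n * (2 * rootIntensity s n + 2 * tilt γ n)) atTop (𝓝 0) := by
  have h1 : Tendsto (fun n : ℝ => n ^ (-(1 / 6 - γ / 4))) atTop (𝓝 0) :=
    tendsto_rpow_atTop_nhds_zero (by linarith)
  have h2 := (((tendsto_rootIntensity_mul s).const_mul 2).add (h1.const_mul 2)).const_mul
    (s ^ (-(1 / 4) : ℝ))
  simp only [mul_zero, add_zero] at h2
  refine squeeze_zero' ?_ ?_ h2
  · filter_upwards [eventually_small hγ hs] with n hn
    have := rootIntensity_pos hs (by linarith [hn.1] : 0 < n)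
    have := scale_pos (γ := γ) hs (by linarith [hn.1] : 0 < n)
    have := hn.2.1
    positivity
  · filter_upwards [eventually_small hγ hs] with n hn
    have hn0 : 0 < n := by linarith [hn.1]
    have hv := rootIntensity_pos hs hn0
    have hs4 : 0 < s ^ (-(1 / 4) : ℝ) := Real.rpow_pos_of_pos hs _
    -- The exponent `γ / 2 - (γ / 4 + 1 / 6)` is negative exactly when `γ < 2 / 3`: the tilt is
    -- invisible on the scale of the fluctuations.
    have e1 : n ^ (γ / 2) * tilt γ n = n ^ (-(1 / 6 - γ / 4)) := by
      rw [tilt, ← Real.rpow_add hn0]; ring_nf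
    have e2 : n ^ (γ / 2) ≤ n := by
      simpa using Real.rpow_le_rpow_of_exponent_le hn.1 (by linarith : γ / 2 ≤ 1)
    calc scale γ s n * (2 * rootIntensity s n + 2 * tilt γ n)
        = s ^ (-(1 / 4) : ℝ) * (2 * (rootIntensity s n * n ^ (γ / 2))
          + 2 * (n ^ (γ / 2) * tilt γ n)) := by rw [scale]; ring
      _ ≤ _ := by rw [e1]; gcongr

lemma sourceDensity_nonneg {n : ℝ} (hs : 0 < s) (hn : 0 < n) (hη : tilt γ n ≤ 1 / 32) :
    0 ≤ sourceDensity γ s n := by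
  have := cellRoot_pos hs hn
  have : 0 ≤ 1 - 2 * tilt γ n := by linarith
  unfold sourceDensity dens; positivity

lemma sourceDensity_le {n : ℝ} (hs : 0 < s) (hn : 0 < n) (hη : tilt γ n ≤ 1 / 32) :
    sourceDensity γ s n ≤ rootIntensity s n := by
  have h1 := cellRoot_pos hs hn
  have h2 := cellRoot_le hs hn
  have h3 := tilt_pos (γ := γ) hn
  have h4 : sourceDensity γ s n ≤ (1 - 2 * tilt γ n) * cellRoot s n := dens_le h1 (by linarith)
  nlinarith

lemma abs_sourceDensity_mul_rate_sub_le {n : ℝ} (hs : 0 < s) (hn : 0 < n)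
    (hv : rootIntensity s n ≤ 1) (hη : tilt γ n ≤ 1 / 32) :
    |sourceDensity γ s n * rate γ s n (gridRows n) - s ^ (-(1 / 2) : ℝ) * n ^ γ|
      ≤ scale γ s n ^ 2 * (2 * rootIntensity s n + 2 * tilt γ n) := by
  have hρ := rate_nonneg (γ := γ) hs hn (gridRows n)
  rw [scale_sq hs hn, ← rootIntensity_mul_rate hs hn, ← sub_mul, abs_mul, abs_of_nonneg hρ]
  calc _ ≤ rootIntensity s n * (2 * rootIntensity s n + 2 * tilt γ n) * rate γ s n (gridRows n) := by
        gcongr; exact abs_sourceDensity_sub_le hs hn hv hη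
    _ = _ := by ring

lemma tendsto_sourceDensity (hγ : 0 < γ) (hs : 0 < s) :
    Tendsto (sourceDensity γ s) atTop (𝓝 0) := by
  refine squeeze_zero' ?_ ?_ (tendsto_rootIntensity hs)
  · filter_upwards [eventually_small hγ hs] with n hn
    exact sourceDensity_nonneg hs (by linarith [hn.1]) hn.2.2.1
  · filter_upwards [eventually_small hγ hs] with n hn
    exact sourceDensity_le hs (by linarith [hn.1]) hn.2.2.1

lemma tendsto_sourceDensity_mul_rate (hγ : 0 < γ) (hs : 0 < s) :
    Tendsto (fun n => sourceDensity γ s n * rate γ s n (gridRows n) / scale γ s n ^ 2) atTop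
      (𝓝 1) := by
  have h : Tendsto (fun n => 2 * rootIntensity s n + 2 * tilt γ n) atTop (𝓝 0) := by
    simpa using ((tendsto_rootIntensity hs).const_mul 2).add ((tendsto_tilt hγ).const_mul 2)
  refine tendsto_iff_norm_sub_tendsto_zero.2 (squeeze_zero' (by simp) ?_ h)
  filter_upwards [eventually_small hγ hs] with n hn
  have hn0 : 0 < n := by linarith [hn.1]
  have hc := scale_pos (γ := γ) hs hn0
  have := abs_sourceDensity_mul_rate_sub_le hs hn0 (by linarith [hn.2.2.2]) hn.2.2.1
  rw [Real.norm_eq_abs, div_sub_one (by positivity), abs_div, abs_of_pos (by positivity : 0 <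
    scale γ s n ^ 2), div_le_iff₀ (by positivity), mul_comm (_ + _)]
  rwa [scale_sq hs hn0] at this ⊢

lemma eventually_error_le (hγ : 0 < γ) (hγ' : γ < 2 / 3) (hs : 0 < s) {K δ : ℝ} (hK : 0 < K)
    (hδ : 0 < δ) : ∀ᶠ n in atTop, 3 + K * |sourceDensity γ s n * rate γ s n (gridRows n)
      - s ^ (-(1 / 2) : ℝ) * n ^ γ| ≤ δ * scale γ s n := by
  have hδK : 0 < δ / 2 / K := by positivity
  filter_upwards [eventually_small hγ hs, (tendsto_scale hγ hs).eventually_ge_atTop (6 / δ),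
    (tendsto_scale_mul_error hγ hγ' hs).eventually_le_const hδK] with n hn h1 h2
  have hn0 : 0 < n := by linarith [hn.1]
  have hc := scale_pos (γ := γ) hs hn0
  have h3 := abs_sourceDensity_mul_rate_sub_le hs hn0 (by linarith [hn.2.2.2]) hn.2.2.1
  rw [div_le_iff₀ hδ] at h1
  rw [le_div_iff₀ hK] at h2
  have h4 := mul_le_mul_of_nonneg_left h3 hK.le
  have h5 := mul_le_mul_of_nonneg_right h2 hc.le
  nlinarith

lemma tendsto_rate (hγ : 0 < γ) (hs : 0 < s) :
    Tendsto (fun n => rate γ s n (gridRows n)) atTop atTop := by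
  have h : Tendsto (fun n : ℝ => n / s) atTop atTop := tendsto_id.atTop_div_const hs
  refine tendsto_atTop_mono' _ ?_ h
  filter_upwards [eventually_ge_atTop 1] with n hn
  have hn0 : 0 < n := by linarith
  rw [rate_eq hn0]
  have h1 : n⁻¹ ≤ n ^ (γ - 1) := by
    rw [← Real.rpow_neg_one]
    exact Real.rpow_le_rpow_of_exponent_le hn (by linarith)
  have h2 : n ^ 2 ≤ gridRows n := (pow_le_pow_right₀ hn (by norm_num)).trans (gridRows_ge n)
  calc n / s = n⁻¹ / s * n ^ 2 := by field_simp
    _ ≤ _ := by gcongr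

lemma eventually_mul_rate_le (hγ' : γ < 2 / 3) (s K : ℝ) :
    ∀ᶠ n in atTop, K * rate γ s n (gridRows n) ≤ gridRows n := by
  have h : Tendsto (fun n : ℝ => K * (n ^ (γ - 1) / s)) atTop (𝓝 0) := by
    simpa using ((tendsto_rpow_atTop_nhds_zero (by linarith : γ - 1 < 0)).div_const s).const_mul K
  filter_upwards [eventually_gt_atTop 0, h.eventually_le_const one_pos] with n hn h1
  rw [rate_eq hn, ← mul_assoc]
  exact mul_le_of_le_one_left (Nat.cast_nonneg _) h1

/-- The factor `n ^ (1 / 12 - γ / 8)` tends to infinity, so the window eventually contains every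
compact set of rescaled positions. -/
lemma eventually_le_halfWindow (hγ : 0 < γ) (hγ' : γ < 2 / 3) (hs : 0 < s) (K : ℝ) :
    ∀ᶠ n in atTop, K * rate γ s n (gridRows n) + 1 ≤ halfWindow γ s n := by
  filter_upwards [(tendsto_rpow_atTop (by linarith : 0 < 1 / 12 - γ / 8)).eventually_ge_atTop
    (K + 1), (tendsto_rate hγ hs).eventually_ge_atTop 1] with n h1 h2
  refine le_trans ?_ (Nat.le_ceil _)
  nlinarith

lemma eventually_halfWindow_le (hγ : 0 < γ) (hγ' : γ < 2 / 3) (hs : 0 < s) :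
    ∀ᶠ n in atTop, (halfWindow γ s n : ℝ)
      ≤ 2 * (n ^ (1 / 12 - γ / 8) * rate γ s n (gridRows n)) := by
  filter_upwards [(tendsto_rpow_atTop (by linarith : 0 < 1 / 12 - γ / 8)).eventually_ge_atTop 1,
    (tendsto_rate hγ hs).eventually_ge_atTop 1] with n h1 h2
  have h3 : 1 ≤ n ^ (1 / 12 - γ / 8) * rate γ s n (gridRows n) := by nlinarith
  have := Nat.ceil_lt_add_one (zero_le_one.trans h3)
  unfold halfWindow
  linarith

/-- The window must be short relative to the tilt, so that its two ends remain near-characteristic;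
the ratio is of order `n ^ (9 / 8 * γ - 3 / 4)`. -/
lemma eventually_halfWindow_le_tilt (hγ : 0 < γ) (hγ' : γ < 2 / 3) (hs : 0 < s) :
    ∀ᶠ n in atTop, (halfWindow γ s n : ℝ) ≤ tilt γ n / 8 * gridRows n := by
  have h : Tendsto (fun n : ℝ => 2 * (n ^ (9 / 8 * γ - 3 / 4) / s)) atTop (𝓝 0) := by
    simpa using ((tendsto_rpow_atTop_nhds_zero
      (by linarith : 9 / 8 * γ - 3 / 4 < 0)).div_const s).const_mul 2
  filter_upwards [eventually_gt_atTop 0, eventually_halfWindow_le hγ hγ' hs,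
    h.eventually_le_const (by norm_num : (0 : ℝ) < 1 / 8)] with n hn h1 h2
  refine h1.trans ?_
  have e : n ^ (1 / 12 - γ / 8) * n ^ (γ - 1) = tilt γ n * n ^ (9 / 8 * γ - 3 / 4) := by
    rw [tilt, ← Real.rpow_add hn, ← Real.rpow_add hn]; ring_nf
  have hη := tilt_pos (γ := γ) hn
  calc _ = tilt γ n * (2 * (n ^ (9 / 8 * γ - 3 / 4) / s)) * gridRows n := by
        rw [rate_eq hn]; linear_combination (2 / s * gridRows n) * e
    _ ≤ tilt γ n * (1 / 8) * gridRows n := by gcongr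
    _ = _ := by ring

/-- Since `gridRows n * cellRoot s n` is of order `n`, the exponent is `1 - 3 * (γ / 4 + 1 / 6) = 1
/ 2 - 3 / 4 * γ`, positive for `γ < 2 / 3`. Wrong exits thus become improbable. -/
lemma tendsto_tilt_pow_mul (hγ : 0 < γ) (hγ' : γ < 2 / 3) (hs : 0 < s) :
    Tendsto (fun n => tilt γ n ^ 3 * (gridRows n * cellRoot s n)) atTop atTop := by
  have hs' := Real.sqrt_pos.2 hs
  have h : Tendsto (fun n : ℝ => √s / 2 * n ^ (1 / 2 - 3 / 4 * γ)) atTop atTop :=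
    (tendsto_rpow_atTop (by linarith)).const_mul_atTop (by positivity)
  refine tendsto_atTop_mono' _ ?_ h
  filter_upwards [eventually_small hγ hs] with n hn
  have hn0 : 0 < n := by linarith [hn.1]
  have hT : (0 : ℝ) < gridRows n := by exact_mod_cast gridRows_pos hn0
  have hv := rootIntensity_pos hs hn0
  have h1 := le_cellRoot hs hn0 (by linarith [hn.2.2.2])
  have h2 : rootIntensity s n / 2 ≤ cellRoot s n := by nlinarith [hn.2.2.2]
  have e1 : gridRows n * rootIntensity s n = √s * n := by rw [rootIntensity]; field_simp
  have e2 : tilt γ n ^ 3 * n = n ^ (1 / 2 - 3 / 4 * γ) := by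
    rw [tilt, ← Real.rpow_natCast, ← Real.rpow_mul hn0.le, ← Real.rpow_add_one hn0.ne']
    ring_nf
  have hη := hn.2.1
  calc √s / 2 * n ^ (1 / 2 - 3 / 4 * γ) = tilt γ n ^ 3 * (gridRows n * (rootIntensity s n / 2)) := by
        rw [← e2]; linear_combination (-(1 / 2) * tilt γ n ^ 3) * e1
    _ ≤ _ := by gcongr

/-- The terms come from cells that are too coarse, negligible because the grid has at least `n ^ 5`
rows, from wrong exits, and from the gap between the two stationary models. The last is of order `n
^ (γ / 8 - 1 / 12)`: the window factor uses up only half of the margin `1 / 6 - γ / 4`. -/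
lemma tendsto_error_probability (hγ : 0 < γ) (hγ' : γ < 2 / 3) (hs : 0 < s) {δ : ℝ} (hδ : 0 < δ) :
    Tendsto (fun n => 6 * s ^ 2 * n ^ 4 / gridRows n
      + 60192 / (tilt γ n ^ 3 * (gridRows n * cellRoot s n))
      + 10 * tilt γ n * cellRoot s n * halfWindow γ s n / (δ * scale γ s n)) atTop (𝓝 0) := by
  have h1 : Tendsto (fun n => 6 * s ^ 2 * n ^ 4 / gridRows n) atTop (𝓝 0) := by
    have h : Tendsto (fun n : ℝ => 6 * s ^ 2 / n) atTop (𝓝 0) :=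
      tendsto_const_nhds.div_atTop tendsto_id
    refine squeeze_zero' ?_ ?_ h
    · filter_upwards [eventually_gt_atTop 0] with n hn
      positivity
    · filter_upwards [eventually_gt_atTop 0] with n hn
      have hT : (0 : ℝ) < gridRows n := by exact_mod_cast gridRows_pos hn
      rw [div_le_div_iff₀ hT hn, mul_assoc, ← pow_succ]
      gcongr
      exact gridRows_ge n
  have h2 : Tendsto (fun n => 60192 / (tilt γ n ^ 3 * (gridRows n * cellRoot s n))) atTop (𝓝 0) :=
    tendsto_const_nhds.div_atTop (tendsto_tilt_pow_mul hγ hγ' hs)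
  have h3 : Tendsto (fun n => 10 * tilt γ n * cellRoot s n * halfWindow γ s n
      / (δ * scale γ s n)) atTop (𝓝 0) := by
    have h : Tendsto (fun n : ℝ => 20 / δ * s ^ (-(1 / 4) : ℝ) * n ^ (γ / 8 - 1 / 12)) atTop
        (𝓝 0) := by
      simpa using (tendsto_rpow_atTop_nhds_zero (by linarith : γ / 8 - 1 / 12 < 0)).const_mul
        (20 / δ * s ^ (-(1 / 4) : ℝ))
    refine squeeze_zero' ?_ ?_ h
    · filter_upwards [eventually_gt_atTop 0] with n hn
      have := scale_pos (γ := γ) hs hn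
      have := tilt_pos (γ := γ) hn
      have := cellRoot_pos hs hn
      positivity
    · filter_upwards [eventually_gt_atTop 0, eventually_halfWindow_le hγ hγ' hs] with n hn h4
      have hc := scale_pos (γ := γ) hs hn
      have hη := tilt_pos (γ := γ) hn
      have hr := cellRoot_pos hs hn
      have hv := rootIntensity_pos hs hn
      have hρ := rate_nonneg (γ := γ) hs hn (gridRows n)
      have h5 := rootIntensity_mul_rate (γ := γ) hs hn
      rw [← scale_sq hs hn] at h5
      rw [div_le_iff₀ (by positivity)]
      have e : n ^ (γ / 2) * (tilt γ n * n ^ (1 / 12 - γ / 8)) = n ^ (γ / 8 - 1 / 12) := by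
        rw [tilt, ← Real.rpow_add hn, ← Real.rpow_add hn]; ring_nf
      have e' : tilt γ n * n ^ (1 / 12 - γ / 8) * scale γ s n
          = s ^ (-(1 / 4) : ℝ) * n ^ (γ / 8 - 1 / 12) := by
        rw [← e, scale]; ring
      calc 10 * tilt γ n * cellRoot s n * halfWindow γ s n
          ≤ 10 * tilt γ n * rootIntensity s n
            * (2 * (n ^ (1 / 12 - γ / 8) * rate γ s n (gridRows n))) := by
            gcongr
            exact cellRoot_le hs hn
        _ = 20 * (tilt γ n * n ^ (1 / 12 - γ / 8) * scale γ s n) * scale γ s n := by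
            linear_combination (20 * tilt γ n * n ^ (1 / 12 - γ / 8)) * h5
        _ = _ := by rw [e']; field_simp
  simpa using (h1.add h2).add h3

end

/-! ### Convergence of the increments -/

section

variable {Ω Ω' : Type*} [MeasurableSpace Ω] [MeasurableSpace Ω'] {P : Measure Ω}
  [IsProbabilityMeasure P] {P' : Measure Ω'} {X : Ω → Configuration}
  {B : Ω' → CadlagPath} {γ s : ℝ}

lemma IsPoissonProcess.aemeasurable_incrementPath (hX : IsPoissonProcess X P) (γ s n : ℝ) :
    AEMeasurable (fun ω => incrementPath γ s n (X ω)) P := by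
  refine aemeasurable_of_coordinates (fun u => ?_) (ae_of_all _ fun ω => ?_)
  · exact (((hX.aemeasurable_lastPassageZero _ _).sub (hX.aemeasurable_lastPassageZero _ _)).sub
      aemeasurable_const).div_const _
  · change increment γ s n (X ω) 0 = 0
    simp [increment]

lemma IsTwoSidedBrownian.aemeasurable_path (hB : IsTwoSidedBrownian (fun t ω => B ω t) P') :
    AEMeasurable B P' :=
  aemeasurable_of_coordinates hB.aemeasurable hB.eval_zero

/-- The sources of the stationary model, as seen along the top of the grid. -/
def stationarySteps (γ s n : ℝ) (X : Ω → Configuration) (θ : (ℕ → ℝ) × (ℕ → ℝ) × Ω) : ℕ → Bool :=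
  (outgoing (sourceDensity γ s n) (dens (cellRoot s n) (1 - 2 * tilt γ n)⁻¹) (gridRows n)
    (gridRows n + halfWindow γ s n) (discretise X (s * n / gridRows n) (n / gridRows n) θ)).1

lemma IsPoissonProcess.hasLaw_stationarySteps (hX : IsPoissonProcess X P) {n : ℝ} (hs : 0 < s)
    (hn : 0 < n) (hv : rootIntensity s n ≤ 1) (hη : tilt γ n ≤ 1 / 32) :
    HasLaw (stationarySteps γ s n X) (berSeq ℕ (sourceDensity γ s n)) (withLevels P) := by
  have hB := balanced_dens (cellRoot_pos hs hn) ((cellRoot_le hs hn).trans hv)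
    (by linarith : 0 < 1 - 2 * tilt γ n)
  rw [cellRoot_sq hs hn] at hB
  exact (hB.hasLaw_top _ _).comp (hX.hasLaw_discretise (by positivity) (by positivity))

/-- The increments of the last-passage time are close to a stationary random walk. -/
lemma IsPoissonProcess.tendsto_increment_sub_walk (hX : IsPoissonProcess X P) (hγ : 0 < γ)
    (hγ' : γ < 2 / 3) (hs : 0 < s) {K δ : ℝ} (hK : 0 < K) (hδ : 0 < δ) :
    Tendsto (fun n => (withLevels P).real {θ | ∃ u, |u| ≤ K ∧
      δ ≤ |incrementPath γ s n (X θ.2.2) u - walk (sourceDensity γ s n) (scale γ s n)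
        (rate γ s n (gridRows n)) (gridRows n) (stationarySteps γ s n X θ) u|}) atTop (𝓝 0) := by
  refine squeeze_zero' (Eventually.of_forall fun _ => measureReal_nonneg) ?_
    (tendsto_error_probability hγ hγ' hs (half_pos hδ))
  filter_upwards [eventually_small hγ hs, eventually_halfWindow_le_tilt hγ hγ' hs,
    (tendsto_tilt_pow_mul hγ hγ' hs).eventually_ge_atTop 20,
    eventually_le_halfWindow hγ hγ' hs K, eventually_error_le hγ hγ' hs hK (half_pos hδ)]
    with n h1 h2 h3 h4 h5
  have hn : 0 < n := by linarith [h1.1]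
  exact hX.measureReal_increment_sub_walk_le hs hn (gridRows_pos hn) (cellRoot_pos hs hn)
    ((cellRoot_le hs hn).trans h1.2.2.2) (cellRoot_sq hs hn) h1.2.1 h1.2.2.1 h2 h3 h4 hδ h5

lemma IsPoissonProcess.tendsto_integral_incrementPath (hX : IsPoissonProcess X P)
    [IsProbabilityMeasure P'] (hB : IsTwoSidedBrownian (fun t ω => B ω t) P') (hγ : 0 < γ) (hγ' : γ < 2 / 3) (hs : 0 < s)
    {F : CadlagPath → ℝ} {C : ℝ} (hC : ∀ f, |F f| ≤ C) (hF : Continuous F)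
    (hFu : ∀ ε > 0, ∃ δ > 0, ∀ f g, (f, g) ∈ skorokhodEntourage δ → |F f - F g| ≤ ε) :
    Tendsto (fun n => ∫ ω, F (incrementPath γ s n (X ω)) ∂P) atTop
      (𝓝 (∫ ω, F (B ω) ∂P')) := by
  refine tendsto_of_seq_tendsto fun n hn => ?_
  obtain ⟨k₀, hk₀⟩ := eventually_atTop.1 (hn.eventually (eventually_small hγ hs))
  -- Finitely many terms are dropped so that the bounds on the parameters hold along the whole
  -- sequence.
  refine (tendsto_add_atTop_iff_nat k₀).1 ?_
  have hm : Tendsto (fun k => n (k + k₀)) atTop atTop := hn.comp (tendsto_add_atTop_nat k₀)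
  have hsmall := fun k => hk₀ (k + k₀) (Nat.le_add_left _ _)
  have hpos : ∀ k, 0 < n (k + k₀) := fun k => by linarith [(hsmall k).1]
  have hv : ∀ k, rootIntensity s (n (k + k₀)) ≤ 1 := fun k => by linarith [(hsmall k).2.2.2]
  have hη := fun k => (hsmall k).2.2.1
  have hY : ∀ k, AEMeasurable (fun θ : (ℕ → ℝ) × (ℕ → ℝ) × Ω =>
      incrementPath γ s (n (k + k₀)) (X θ.2.2)) (withLevels P) := fun k =>
    (hX.aemeasurable_incrementPath γ s _).comp_quasiMeasurePreserving
      (Measure.quasiMeasurePreserving_snd.comp Measure.quasiMeasurePreserving_snd)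
  have key := tendsto_integral_of_close_to_walk (Q := withLevels P)
    (a := fun k => sourceDensity γ s (n (k + k₀))) (c := fun k => scale γ s (n (k + k₀)))
    (r := fun k => rate γ s (n (k + k₀)) (gridRows (n (k + k₀))))
    (x₀ := fun k => gridRows (n (k + k₀))) (H := fun k => stationarySteps γ s (n (k + k₀)) X)
    hB hY (fun k => sourceDensity_nonneg hs (hpos k) (hη k))
    (fun k => (sourceDensity_le hs (hpos k) (hη k)).trans (hv k))
    ((tendsto_sourceDensity hγ hs).comp hm) ((tendsto_scale hγ hs).comp hm)
    (fun k => rate_nonneg hs (hpos k) _) ((tendsto_sourceDensity_mul_rate hγ hs).comp hm)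
    (fun K => hm.eventually (eventually_mul_rate_le hγ' s K))
    (fun k => hX.hasLaw_stationarySteps hs (hpos k) (hv k) (hη k))
    (fun K δ hK hδ => (hX.tendsto_increment_sub_walk hγ hγ' hs hK hδ).comp hm) hC hF hFu
  -- The auxiliary levels integrate out, since the path depends only on the configuration.
  refine key.congr fun k => ?_
  exact (hasLaw_snd_snd_withLevels (P := P)).integral_comp
    (f := fun ω => F (incrementPath γ s (n (k + k₀)) (X ω)))
    (hF.measurable.comp_aemeasurable (hX.aemeasurable_incrementPath γ s _)).aestronglyMeasurable

end

end Hammersley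

end

theorem theorem2 {Ω Ω' : Type*} [MeasurableSpace Ω] [MeasurableSpace Ω']
    (P : Measure Ω) [IsProbabilityMeasure P] (P' : Measure Ω') [IsProbabilityMeasure P']
    (X : Ω → Hammersley.Configuration) (hX : Hammersley.IsPoissonProcess X P)
    (B : Ω' → Hammersley.CadlagPath)
    (hB : Hammersley.IsTwoSidedBrownian (fun t ω => B ω t) P')
    (γ s : ℝ) (hγ : 0 < γ) (hγ' : γ < 2 / 3) (hs : 0 < s) :
    TendstoInDistribution (fun (n : ℝ) ω => Hammersley.incrementPath γ s n (X ω)) atTop B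
      (fun _ => P) P' := by
  refine ⟨fun n => hX.aemeasurable_incrementPath γ s n, hB.aemeasurable_path,
    Hammersley.tendsto_of_forall_uniformContinuous fun F C hC hF hFu => ?_⟩
  have h := hX.tendsto_integral_incrementPath hB hγ hγ' hs hC hF hFu
  simp only [ProbabilityMeasure.coe_mk]
  rw [integral_map hB.aemeasurable_path hF.measurable.aestronglyMeasurable]
  refine h.congr fun n => ?_
  rw [integral_map (hX.aemeasurable_incrementPath γ s n) hF.measurable.aestronglyMeasurable]
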